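/- Let $\alpha,\beta\in(0,1]$ and $\lambda_0,\xi>0$. Write $E_a(z)=\sum_{m\ge0}\frac{z^m}{\Gamma(am+1)}$, $E_{a,b}(z)=\sum_{m\ge0}\frac{z^m}{\Gamma(am+b)}$, $E_{a,b}^{c}(z)=\sum_{s\ge0}\frac{(c)_s}{s!}\frac{z^s}{\Gamma(as+b)}$, where $(c)_s$ is the Pochhammer symbol, let $\Theta$ be the Heaviside function, and let $\frac{\partial^\beta}{\partial t^\beta}$ be the Caputo derivative with base point $0$ (the ordinary derivative if $\beta=1$). Distributions on $\mathbb R$ are tested against smooth compactly supported functions, $D_x$ is the distributional derivative, and $*$ is the convolution of distributions supported in $[0,\infty)$. For $\lambda>0$ let $G_\lambda(u)=(\lambda+1)\frac{(1-u)^\alpha}{\lambda+(1-u)^\alpha}=\sum_{n\ge 0}[G_\lambda]_nu^n$, and let $p_{\lambda,n}(t)$ be the coefficient of $u^n$ in $E_\beta(-\xi t^\beta G_\lambda(u))$. These are the state probabilities of the space-time Mittag-Leffler process: $p_{\lambda,n}(0)=\delta_{n,0}$ and $\frac{d^\beta}{dt^\beta}p_{\lambda,n}(t)=-\xi\sum_{k=0}^n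 p_{\lambda,k}(t)[G_\lambda]_{n-k}$ for $t>0$. 1. (Limiting state density.) Define the distribution $$\mathcal P(x,t)=\sum_{m=0}^\infty\frac{(-\xi t^\beta)^m}{\Gamma(\beta m+1)}e_{\alpha,0}^m(-\lambda_0,x)=E_\beta(-\xi t^\beta)\,\delta(x)+q(x,t),$$ where $$e^m_{\alpha,0}(-\lambda_0,x)=\delta(x)+\Theta(x)\sum_{s\ge1}\frac{(m)_s(-\lambda_0)^s x^{\alpha s-1}}{s!\,\Gamma(\alpha s)}$$ and $q(\cdot,t)$ is locally integrable and vanishes for $x\le0$. The series of distributions converges when tested against any test function. For every $t\ge0$, as $h\to0+$, the lattice densities $x\mapsto\Theta(x)\,h^{-1}p_{\lambda_0h^\alpha,\lfloor x/h\rfloor}(t)$ converge to $\mathcal P(\cdot,t)$ in the sense of distributions, and pointwise to $q(x,t)$ for every $x>0$. 2. (Laplacian density.) Let $\mathcal W(x)=\lambda_0x^{\alpha-1}E_{\alpha,\alpha}(-\lambda_0x^\alpha)$ for $x>0$ and $\mathcal W(x)=0$ for $x\le0$; it is locally integrable. As $h\to0+$, the lattice densities $\Theta(x)h^{-1}[G_{\lambda_0h^\alpha}]_{\lfloor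 x/h\rfloor}$ converge in the sense of distributions to $$\mathcal G=\delta-\mathcal W=D_x\left[\Theta(x)E_\alpha(-\lambda_0x^\alpha)\right],$$ one has $\mathcal W(x)=-\frac{d}{dx}E_\alpha(-\lambda_0x^\alpha)$ for $x>0$, and the Laplace transform of $\mathcal G$ is $\frac{s^\alpha}{s^\alpha+\lambda_0}$ for $\Re s>0$. 3. (Cauchy problem.) $\mathcal P(\cdot,0)=\delta$, and $\mathcal P(\cdot,t)\to\delta$ in the sense of distributions as $t\to0+$. For every $t>0$ the Caputo derivative of $\mathcal P$ exists in the sense of distributions in $x$ (i.e. tested against every test function), and $$\frac{\partial^\beta}{\partial t^\beta}\mathcal P=-\xi\,\mathcal G*\mathcal P=-\xi\mathcal P+\xi\,\mathcal W*\mathcal P=-\xi D_x\Big[\big(\Theta(x) E_\alpha(-\lambda_0x^\alpha)\big)*\mathcal P\Big]=-\xi\mathcal P+\xi\lambda_0\,\mathfrak E_x(\alpha,\alpha;1;-\lambda_0)\mathcal P,$$ where $\mathfrak E_x(a,b;c;w)$ is Prabhakar's integral operator, i.e. convolution in $x$ with $\Theta(x)x^{b-1}E_{a,b}^c(wx^a)$.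 Moreover, for all $t>0$, $x>0$ one has pointwise $\frac{\partial^\beta}{\partial t^\beta}E_\beta(-\xi t^\beta)=-\xi E_\beta(-\xi t^\beta)$ for the mass of the atom at the origin and $$\frac{\partial^\beta}{\partial t^\beta}q(x,t)=-\xi q(x,t)+\xi\left(E_\beta(-\xi t^\beta)\,\mathcal W(x)+\int_0^x\lambda_0(x-\tau)^{\alpha-1}E_{\alpha,\alpha}\big(-\lambda_0(x-\tau)^\alpha\big)\,q(\tau,t)\,d\tau\right).$$ -/

import Mathlib

open MeasureTheory Filter Topology Set
open scoped Distributions LineDeriv PowerSeries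

noncomputable section

/-! ### Special functions -/

/-- The three-parameter Mittag-Leffler (Prabhakar) function
`E_{a,b}^c(z) = ∑ (c)_s z^s / (s! Γ(a s + b))`, where `(c)_s` is the Pochhammer symbol. -/
def prabhakarFun (a b c z : ℝ) : ℝ :=
  ∑' s : ℕ, (ascPochhammer ℝ s).eval c / (s.factorial : ℝ) * (z ^ s / Real.Gamma (a * s + b))

/-- The generalized Mittag-Leffler function `E_{a,b}(z) = ∑ z^m / Γ(a m + b)`. -/
def mittagLefflerGen (a b z : ℝ) : ℝ :=
  ∑' m : ℕ, z ^ m / Real.Gamma (a * m + b)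

/-- The Mittag-Leffler function `E_a(z) = ∑ z^m / Γ(a m + 1)`. -/
def mittagLeffler (a z : ℝ) : ℝ :=
  ∑' m : ℕ, z ^ m / Real.Gamma (a * m + 1)

/-! ### Caputo derivative -/

/-- `f` has at the time `t` the Caputo derivative `v` of order `b ∈ (0, 1]` (with base point `0`):
`v = Γ(1 - b)⁻¹ ∫_0^t (t - τ)^(-b) f'(τ) dτ` for `b < 1`, and `v = f'(t)` for `b = 1`.
The regularity needed to make sense of this is part of the definition. -/
def HasCaputoDeriv (b : ℝ) (f : ℝ → ℝ) (t v : ℝ) : Prop :=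
  ContinuousOn f (Icc 0 t) ∧
    ((b = 1 ∧ HasDerivAt f v t) ∨
      (b < 1 ∧ DifferentiableOn ℝ f (Ioo 0 t) ∧
        IntervalIntegrable (fun τ => (t - τ) ^ (-b) * deriv f τ) volume 0 t ∧
        v = (Real.Gamma (1 - b))⁻¹ * ∫ τ in (0 : ℝ)..t, (t - τ) ^ (-b) * deriv f τ))

/-! ### The discrete process

An upper triangular circulant matrix `M` on the integer line (`M_{m,n} = M_{0,n-m}`, zero for
`n < m`) is the same thing as the formal power series `∑ M_{0,n} u^n`, matrix products being
products of power series; the Laplacian `1 - T_{-1}` is the series `1 - u`. -/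

/-- The binomial series `(1 - u)^a`, i.e. the fractional Laplacian matrix `(1 - T_{-1})^a`. -/
def fracLaplacian (a : ℝ) : ℝ⟦X⟧ :=
  PowerSeries.mk fun n => (-1) ^ n * Ring.choose a n

/-- The normalized Laplacian `(l + 1) (1 - u)^a / (l + (1 - u)^a)` which generates the discrete
Mittag-Leffler jumps. -/
def discreteLaplacian (a l : ℝ) : ℝ⟦X⟧ :=
  PowerSeries.C (l + 1) * fracLaplacian a * (PowerSeries.C l + fracLaplacian a)⁻¹

/-- The state probabilities `p_n(t)` of the space-time Mittag-Leffler process: the coefficient of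
`u^n` in `E_b(-ξ t^b G(u))`, where `G` is the normalized Laplacian. -/
def stateProb (a b l ξ : ℝ) (n : ℕ) (t : ℝ) : ℝ :=
  ∑' m : ℕ, (-ξ * t ^ b) ^ m / Real.Gamma (b * m + 1) *
    PowerSeries.coeff n (discreteLaplacian a l ^ m)

/-- The density on `ℝ` attached to a sequence `c` sitting on the lattice `h ℕ`, i.e.
`∑ n, c n * δ_h (x - n h)` with the discrete delta `δ_h = h⁻¹ 1_[0,h)`.
Its value at `x ∈ h ℕ` is `h⁻¹ c (x / h)`. -/
def latticeDensity (h : ℝ) (c : ℕ → ℝ) (x : ℝ) : ℝ :=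
  if 0 ≤ x then c ⌊x / h⌋₊ / h else 0

/-! ### Distributions on the real line -/

/-- Real distributions on `ℝ`. -/
abbrev RealDistribution : Type := 𝓓'((⊤ : TopologicalSpace.Opens ℝ), ℝ)

/-- Test functions on `ℝ`. -/
abbrev RealTest : Type := 𝓓((⊤ : TopologicalSpace.Opens ℝ), ℝ)

/-- The distribution `φ ↦ ∫ φ f` given by a locally integrable function `f`. -/
def ofFun (f : ℝ → ℝ) : RealDistribution :=
  TestFunction.integralAgainstBilinCLM (ContinuousLinearMap.mul ℝ ℝ) volume f

/-- Dirac's delta at the origin. -/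
def dirac0 : RealDistribution := Distribution.delta (0 : ℝ)

/-- The translated test function `x ↦ φ (x + y)`. -/
def shiftTest (y : ℝ) (φ : RealTest) : RealTest where
  toFun x := φ (x + y)
  contDiff' := φ.contDiff'.comp (contDiff_id.add contDiff_const)
  hasCompactSupport' := φ.hasCompactSupport'.comp_homeomorph (Homeomorph.addRight y)
  tsupport_subset' := fun _ _ => trivial

/-- `R = S * T` is the convolution of two distributions `S`, `T` supported in `[0, ∞)`:
`R(φ) = S_y (T_x (φ (x + y)))`. The function `y ↦ T_x (φ (x + y))` is smooth and vanishes for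
large `y`; since `S` is supported in `[0, ∞)` it can be applied to any test function `ψ` that
agrees with it on a neighbourhood of `[0, ∞)`. -/
def IsCausalConv (S T R : RealDistribution) : Prop :=
  Distribution.IsVanishingOn S (Iio (0 : ℝ)) ∧ Distribution.IsVanishingOn T (Iio (0 : ℝ)) ∧
    ∀ φ : RealTest, ∃ ψ : RealTest,
      (∃ ε > 0, ∀ y > -ε, ψ y = T (shiftTest y φ)) ∧ R φ = S ψ

/-- The distribution `T = c δ + f`, with `f` locally integrable and zero on `(-∞, 0)`, has an
(absolutely convergent) Laplace transform at `s`, with value `v = c + ∫_0^∞ e^{-s x} f(x) dx`. -/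
def HasLaplaceTransform (T : RealDistribution) (s v : ℂ) : Prop :=
  ∃ (c : ℝ) (f : ℝ → ℝ), LocallyIntegrable f ∧ (∀ x < 0, f x = 0) ∧
    T = c • dirac0 + ofFun f ∧
    IntegrableOn (fun x : ℝ => Complex.exp (-s * x) * (f x : ℂ)) (Ioi 0) ∧
    v = c + ∫ x in Ioi (0 : ℝ), Complex.exp (-s * x) * (f x : ℂ)

/-- The kernel `Θ(x) x^(b-1) E_{a,b}^c(w x^a)` of Prabhakar's integral operator. -/
def prabhakarIntegralKernel (a b c w x : ℝ) : ℝ :=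
  if 0 < x then x ^ (b - 1) * prabhakarFun a b c (w * x ^ a) else 0

/-- `R` is the Prabhakar integral `𝔈(a, b; c; w) T`, i.e.
`∫_0^x (x - τ)^(b-1) E_{a,b}^c(w (x - τ)^a) T(τ) dτ`, of a distribution `T` supported
in `[0, ∞)`. -/
def IsPrabhakarIntegral (a b c w : ℝ) (T R : RealDistribution) : Prop :=
  LocallyIntegrable (prabhakarIntegralKernel a b c w) ∧
    IsCausalConv (ofFun (prabhakarIntegralKernel a b c w)) T R

/-! ### Objects of the diffusion limit -/

/-- The function `Θ(x) E_a(-l x^a)`. -/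
def survivalFun (a l x : ℝ) : ℝ :=
  if 0 ≤ x then mittagLeffler a (-l * x ^ a) else 0

/-- The Mittag-Leffler density `W(x) = l x^(a-1) E_{a,a}(-l x^a)`, `x > 0`. -/
def mlDensity (a l x : ℝ) : ℝ :=
  if 0 < x then l * x ^ (a - 1) * mittagLefflerGen a a (-l * x ^ a) else 0

/-- The Laplacian density `𝒢 = δ - W`. -/
def laplacianDensity (a l : ℝ) : RealDistribution :=
  dirac0 - ofFun (mlDensity a l)

/-- The part on `x > 0` of the Prabhakar kernel `e_{a,0}^c(z, x)`:
`∑_{s ≥ 1} (c)_s z^s x^(a s - 1) / (s! Γ(a s))`. -/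
def prabhakarKernelReg (a c z x : ℝ) : ℝ :=
  if 0 < x then
    ∑' s : ℕ, (ascPochhammer ℝ (s + 1)).eval c / ((s + 1).factorial : ℝ) * z ^ (s + 1) *
      (x ^ (a * ((s : ℝ) + 1) - 1) / Real.Gamma (a * ((s : ℝ) + 1)))
  else 0

/-- The Prabhakar kernel `e_{a,0}^c(z, ·)`. -/
def prabhakarKernel (a c z : ℝ) : RealDistribution :=
  dirac0 + ofFun (prabhakarKernelReg a c z)

/-- The part on `x > 0` of the state density,
`∑_m (-ξ t^b)^m / Γ(b m + 1) e_{a,0}^m(-l, x)`. -/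
def stateDensityReg (a b l ξ t x : ℝ) : ℝ :=
  ∑' m : ℕ, (-ξ * t ^ b) ^ m / Real.Gamma (b * m + 1) * prabhakarKernelReg a m (-l) x

/-- The state density `𝒫(·, t)`, an atom of mass `E_b(-ξ t^b)` at the origin plus a density. -/
def stateDensity (a b l ξ t : ℝ) : RealDistribution :=
  mittagLeffler b (-ξ * t ^ b) • dirac0 + ofFun (stateDensityReg a b l ξ t)

end

noncomputable section

/-! ### Reciprocal Gamma bounds -/

/-! All objects are double series, with index `m` from the Mittag-Leffler function in time and index
`s` from an expansion in space.

Space. Since `G = (l + 1) (1 + l (1 - u)^(-α))⁻¹`, expanding in `l` gives `G ^ m = (l + 1)^m ∑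
multichoose m s (-l)^s (1 - u)^(-α s)` (`coeff_discreteLaplacian_pow`), and the coefficient of `u^n`
in `(1 - u)^(-α s)` is `multichoose (α s) n ~ n^(α s - 1) / Γ(α s)`. With `l = l₀ h^α` and `n = ⌊x /
h⌋` each term with `s ≥ 1`, divided by `h`, tends to a term of the Prabhakar kernel
(`tendsto_coeff_pow_lattice`). The term `s = 0` lives at `n = 0` only and becomes the atom. The
difficulty is domination uniformly in `s`, `m`, `n` and small `h`; `multichoose_lattice_bound`
provides it by evaluating the generating function at a radius `1 - c h`. The majorant `x^(α - 1)` is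
locally integrable, so pointwise limits give distributional limits once the first lattice cell is
split off as an approximate delta (`tendsto_integral_latticeDensity`).

Time. For exponentially bounded `y`, the Caputo derivative of `∑ (-ξ t^β)^m / Γ(β m + 1) y_m` is
`-ξ` times the series with `y_(m+1)` in place of `y_m` (`hasCaputoDeriv_tsum_mlCoeff`). With the
coefficients of `G ^ m` for `y_m` this is the discrete equation. With Prabhakar kernels, paired with
a test function or evaluated at a point, it leaves the algebraic fact `e^(m+1) = (δ - W) * e^m`,
proved after summation over `m` in `mlDensity_conv_tsum`. There both sides are fractional power
series, whose convolution is a Cauchy product by Euler's Beta integral, and the coefficients agree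
by summing `multichoose` over its lower index.

The forms of the right-hand side follow from `𝒢 = D(Θ E_α) = δ - W` and from derivatives of a
convolution falling on one factor. For the Laplace transform, `W` solves a Volterra equation, which
settles real `s`; the identity theorem extends the result to `Re s > 0`. The positivity of `W`
needed there is inherited from the signs of the coefficients of `G`. -/

/-- Keeping only the part of the Gamma integral beyond `T` gives `Γ(y + 1) ≥ T^y e^(-T)`. Taking `T
= 2 / ρ` leaves a spare `2^y` to absorb the factor `y` in `Γ(y + 1) = y Γ(y)`. Because `ρ` is
arbitrary, the Gamma function beats any exponential growth of coefficients. -/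
theorem inv_Gamma_le_rpow {ρ : ℝ} (hρ : 0 < ρ) :
    ∃ C : ℝ, 0 < C ∧ ∀ y : ℝ, 0 < y → (Real.Gamma y)⁻¹ ≤ C * ρ ^ y := by
  have key : ∀ T : ℝ, 0 < T → ∀ y : ℝ, 0 < y → T ^ y * Real.exp (-T) ≤ Real.Gamma (y + 1) := by
    intro T hT y hy
    have hint := Real.GammaIntegral_convergent (show 0 < y + 1 by linarith)
    rw [Real.Gamma_eq_integral (by linarith), ← integral_exp_neg_Ioi T,
      ← integral_const_mul]
    have hsub : Ioi T ⊆ Ioi (0 : ℝ) := Ioi_subset_Ioi hT.le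
    refine le_trans ?_ (setIntegral_mono_set hint ?_ hsub.eventuallyLE)
    · refine setIntegral_mono_on ?_ (hint.mono_set hsub) measurableSet_Ioi ?_
      · exact (integrableOn_exp_neg_Ioi T).const_mul _
      · intro x hx
        rw [mul_comm]
        refine mul_le_mul_of_nonneg_left ?_ (Real.exp_pos _).le
        simp only [add_sub_cancel_right]
        exact Real.rpow_le_rpow hT.le (le_of_lt hx) hy.le
    · refine (ae_restrict_iff' measurableSet_Ioi).2 (Eventually.of_forall fun x hx => ?_)
      have : (0 : ℝ) < x := hx
      simp only [Pi.zero_apply]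
      positivity
  refine ⟨Real.exp (2 / ρ), Real.exp_pos _, fun y hy => ?_⟩
  have hT : 0 < 2 / ρ := by positivity
  have h1 := key (2 / ρ) hT y hy
  rw [Real.Gamma_add_one hy.ne'] at h1
  have hG := Real.Gamma_pos_of_pos hy
  have hy2 : y ≤ 2 ^ y := by
    rcases le_total 1 y with h | h
    · have := one_add_mul_self_le_rpow_one_add (s := 1) (by norm_num) h
      rw [show (1 : ℝ) + 1 = 2 by norm_num] at this
      linarith
    · exact h.trans (Real.one_le_rpow (by norm_num) hy.le)
  rw [inv_le_iff_one_le_mul₀ hG]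
  have h2 : (2 / ρ) ^ y * Real.exp (-(2 / ρ)) ≤ 2 ^ y * Real.Gamma y :=
    h1.trans (mul_le_mul_of_nonneg_right hy2 hG.le)
  have h3 : (2 / ρ) ^ y = 2 ^ y * (ρ ^ y)⁻¹ := by
    rw [Real.div_rpow (by norm_num) hρ.le]; rfl
  have hp2 : (0 : ℝ) < 2 ^ y := by positivity
  have hpr : (0 : ℝ) < ρ ^ y := by positivity
  rw [h3, mul_assoc] at h2
  have h4 := le_of_mul_le_mul_left h2 hp2
  have h5 : 1 ≤ Real.exp (2 / ρ) * ρ ^ y * ((ρ ^ y)⁻¹ * Real.exp (-(2 / ρ))) := by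
    rw [Real.exp_neg]
    have := Real.exp_pos (2 / ρ)
    field_simp
    exact le_refl _
  refine h5.trans ?_
  exact mul_le_mul_of_nonneg_left h4 (by positivity)

/-! ### Fractional power series -/

/-- The sequence `f` grows at most exponentially. -/
def ExpBdd (f : ℕ → ℝ) : Prop := ∃ C K : ℝ, 0 ≤ C ∧ 0 < K ∧ ∀ s, |f s| ≤ C * K ^ s

/-- The fractional power series `∑ f_s x^(a s + b - 1) / Γ(a s + b)`. -/
def fracSeries (a b : ℝ) (f : ℕ → ℝ) (x : ℝ) : ℝ :=
  ∑' s : ℕ, f s * (x ^ (a * s + b - 1) / Real.Gamma (a * s + b))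

theorem ExpBdd.comp_succ {f : ℕ → ℝ} (hf : ExpBdd f) : ExpBdd (fun s => f (s + 1)) := by
  obtain ⟨C, K, hC, hK, h⟩ := hf
  refine ⟨C * K, K, by positivity, hK, fun s => ?_⟩
  rw [mul_assoc, ← pow_succ']
  exact h _

theorem expBdd_pow (z : ℝ) : ExpBdd (fun s => z ^ s) := by
  refine ⟨1, |z| + 1, by positivity, by positivity, fun s => ?_⟩
  rw [abs_pow, one_mul]
  exact pow_le_pow_left₀ (abs_nonneg _) (by linarith) _

theorem ExpBdd.const_mul {f : ℕ → ℝ} (hf : ExpBdd f) (c : ℝ) : ExpBdd (fun s => c * f s) := by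
  obtain ⟨C, K, hC, hK, h⟩ := hf
  refine ⟨|c| * C, K, by positivity, hK, fun s => ?_⟩
  rw [abs_mul, mul_assoc]
  exact mul_le_mul_of_nonneg_left (h s) (abs_nonneg _)

theorem ExpBdd.mul {f g : ℕ → ℝ} (hf : ExpBdd f) (hg : ExpBdd g) :
    ExpBdd (fun s => f s * g s) := by
  obtain ⟨C, K, hC, hK, h⟩ := hf
  obtain ⟨C', K', hC', hK', h'⟩ := hg
  refine ⟨C * C', K * K', by positivity, by positivity, fun s => ?_⟩
  rw [abs_mul, mul_pow, mul_mul_mul_comm]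
  exact mul_le_mul (h s) (h' s) (abs_nonneg _) (by positivity)

/-- One geometric majorant, uniform on `(0, R]`, with the singularity `x^(b - 1)` factored out.
Convergence, termwise differentiation and local integrability all come from it. -/
theorem fracSeries_term_bound {a b R : ℝ} {f : ℕ → ℝ} (ha : 0 < a) (hb : 0 < b) (hR : 0 < R)
    (hf : ExpBdd f) :
    ∃ M : ℝ, 0 ≤ M ∧ ∀ x : ℝ, 0 < x → x ≤ R → ∀ s : ℕ,
      |f s| * (x ^ (a * s + b - 1) / Real.Gamma (a * s + b)) ≤ M * (1 / 2) ^ s * x ^ (b - 1) := by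
  obtain ⟨C, K, hC, hK, h⟩ := hf
  -- Chosen so that `K * R ^ a * ρ ^ a = 1 / 2`, the ratio of the majorant.
  set ρ : ℝ := (2 * K * R ^ a)⁻¹ ^ a⁻¹ with hρ
  have hRa : 0 < R ^ a := by positivity
  have hρ0 : 0 < ρ := by positivity
  have hρa : ρ ^ a = (2 * K * R ^ a)⁻¹ := by
    rw [hρ, ← Real.rpow_mul (by positivity), inv_mul_cancel₀ ha.ne', Real.rpow_one]
  obtain ⟨C', hC', hG⟩ := inv_Gamma_le_rpow hρ0
  refine ⟨C * (C' * ρ ^ b), by positivity, fun x hx hxR s => ?_⟩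
  have hy : 0 < a * s + b := by positivity
  have hxs : x ^ (a * s + b - 1) = x ^ (b - 1) * (x ^ a) ^ s := by
    rw [← Real.rpow_natCast, ← Real.rpow_mul hx.le, ← Real.rpow_add hx]; congr 1; ring
  have hρs : ρ ^ (a * s + b) = ρ ^ b * (ρ ^ a) ^ s := by
    rw [← Real.rpow_natCast, ← Real.rpow_mul hρ0.le, ← Real.rpow_add hρ0]; congr 1; ring
  have hxa : (x ^ a) ^ s ≤ (R ^ a) ^ s := by gcongr
  calc |f s| * (x ^ (a * s + b - 1) / Real.Gamma (a * s + b))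
      ≤ (C * K ^ s) * ((x ^ (b - 1) * (R ^ a) ^ s) * (C' * (ρ ^ b * (ρ ^ a) ^ s))) := by
        rw [div_eq_mul_inv, hxs, ← hρs]
        have := hG _ hy
        have h0 : 0 ≤ (Real.Gamma (a * s + b))⁻¹ := (inv_pos.2 (Real.Gamma_pos_of_pos hy)).le
        have := h s
        gcongr
    _ = C * (C' * ρ ^ b) * (K * R ^ a * ρ ^ a) ^ s * x ^ (b - 1) := by
        rw [mul_pow, mul_pow]; ring
    _ = _ := by
        rw [hρa]
        congr 3
        field_simp

theorem fracSeries_summable {a b x : ℝ} {f : ℕ → ℝ} (ha : 0 < a) (hb : 0 < b) (hx : 0 < x)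
    (hf : ExpBdd f) :
    Summable fun s : ℕ => ‖f s * (x ^ (a * s + b - 1) / Real.Gamma (a * s + b))‖ := by
  obtain ⟨M, hM, h⟩ := fracSeries_term_bound ha hb hx hf
  refine Summable.of_nonneg_of_le (fun _ => norm_nonneg _) (fun s => ?_)
    ((summable_geometric_two.mul_left M).mul_right (x ^ (b - 1)))
  have hG : 0 < Real.Gamma (a * s + b) := Real.Gamma_pos_of_pos (by positivity)
  rw [norm_mul, Real.norm_eq_abs, Real.norm_of_nonneg (by positivity)]
  exact h x hx le_rfl s

theorem fracSeries_hasSum {a b x : ℝ} {f : ℕ → ℝ} (ha : 0 < a) (hb : 0 < b) (hx : 0 < x)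
    (hf : ExpBdd f) :
    HasSum (fun s : ℕ => f s * (x ^ (a * s + b - 1) / Real.Gamma (a * s + b)))
      (fracSeries a b f x) :=
  (fracSeries_summable ha hb hx hf).of_norm.hasSum

theorem abs_fracSeries_le {a b R : ℝ} {f : ℕ → ℝ} (ha : 0 < a) (hb : 0 < b) (hR : 0 < R)
    (hf : ExpBdd f) :
    ∃ M : ℝ, 0 ≤ M ∧ ∀ x : ℝ, 0 < x → x ≤ R → |fracSeries a b f x| ≤ M * x ^ (b - 1) := by
  obtain ⟨M, hM, h⟩ := fracSeries_term_bound ha hb hR hf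
  refine ⟨M * 2, by positivity, fun x hx hxR => ?_⟩
  have hs := ((hasSum_geometric_two).mul_left M).mul_right (x ^ (b - 1))
  rw [fracSeries, ← Real.norm_eq_abs]
  refine tsum_of_norm_bounded hs fun s => ?_
  have hG : 0 < Real.Gamma (a * s + b) := Real.Gamma_pos_of_pos (by positivity)
  rw [norm_mul, Real.norm_eq_abs, Real.norm_of_nonneg (by positivity)]
  exact h x hx hxR s

theorem fracSeries_eq_rpow_mul {a b x : ℝ} {f : ℕ → ℝ} (hx : 0 < x) :
    fracSeries a b f x = x ^ (b - 1) * ∑' s : ℕ, f s * (x ^ a) ^ s / Real.Gamma (a * s + b) := by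
  rw [fracSeries, ← tsum_mul_left]
  congr 1 with s
  have hxs : x ^ (a * s + b - 1) = x ^ (b - 1) * (x ^ a) ^ s := by
    rw [← Real.rpow_natCast, ← Real.rpow_mul hx.le, ← Real.rpow_add hx]; congr 1; ring
  rw [hxs]; ring

/-- The sum of the endpoint values serves both signs of `e`; the exponent `b - 1` met below can have
either. -/
theorem rpow_le_add_rpow {p q y : ℝ} (hp : 0 < p) (hpy : p ≤ y) (hyq : y ≤ q) (e : ℝ) :
    y ^ e ≤ p ^ e + q ^ e := by
  have hy : 0 < y := hp.trans_le hpy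
  have hq : 0 < q := hy.trans_le hyq
  rcases le_total 0 e with he | he
  · exact (Real.rpow_le_rpow hy.le hyq he).trans (le_add_of_nonneg_left (by positivity))
  · exact (Real.rpow_le_rpow_of_nonpos hp hpy he).trans (le_add_of_nonneg_right (by positivity))

/-- The factor from differentiating the power cancels against `Γ(y + 1) = y Γ(y)`, so
differentiation only lowers the second parameter by one. -/
theorem hasDerivAt_fracSeries {a b x : ℝ} {f : ℕ → ℝ} (ha : 0 < a) (hb : 0 < b) (hx : 0 < x)
    (hf : ExpBdd f) : HasDerivAt (fracSeries a (b + 1) f) (fracSeries a b f x) x := by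
  obtain ⟨M, hM, h⟩ := fracSeries_term_bound ha hb (show 0 < 2 * x by linarith) hf
  set B : ℝ := (x / 2) ^ (b - 1) + (2 * x) ^ (b - 1) with hB
  refine hasDerivAt_tsum_of_isPreconnected (u := fun s : ℕ => M * (1 / 2) ^ s * B)
    (t := Ioo (x / 2) (2 * x)) (y₀ := x)
    (g := fun (s : ℕ) (y : ℝ) => f s * (y ^ (a * s + (b + 1) - 1) / Real.Gamma (a * s + (b + 1))))
    (g' := fun (s : ℕ) (y : ℝ) => f s * (y ^ (a * s + b - 1) / Real.Gamma (a * s + b)))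
    ((summable_geometric_two.mul_left M).mul_right B) isOpen_Ioo isPreconnected_Ioo ?_ ?_
    ⟨by linarith, by linarith⟩ (fracSeries_summable ha (by linarith) hx hf).of_norm
    ⟨by linarith, by linarith⟩
  · intro s y hy
    have hy0 : 0 < y := by linarith [hy.1]
    have hp : 0 < a * s + b := by positivity
    have h1 := (Real.hasDerivAt_rpow_const (x := y) (p := a * s + (b + 1) - 1)
      (Or.inl hy0.ne')).div_const (Real.Gamma (a * s + (b + 1)))
    have h2 := h1.const_mul (f s)
    simp only [← add_assoc, Real.Gamma_add_one hp.ne', add_sub_cancel_right,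
      mul_div_mul_left _ _ hp.ne'] at h2 ⊢
    exact h2
  · intro s y hy
    have hy0 : 0 < y := by linarith [hy.1]
    have hG : 0 < Real.Gamma (a * s + b) := Real.Gamma_pos_of_pos (by positivity)
    rw [norm_mul, Real.norm_eq_abs, Real.norm_of_nonneg (by positivity)]
    refine (h y hy0 hy.2.le s).trans ?_
    gcongr
    exact rpow_le_add_rpow (by linarith) hy.1.le hy.2.le _

theorem continuousAt_fracSeries {a b x : ℝ} {f : ℕ → ℝ} (ha : 0 < a) (hb : 0 < b) (hx : 0 < x)
    (hf : ExpBdd f) : ContinuousAt (fracSeries a b f) x := by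
  obtain ⟨M, hM, h⟩ := fracSeries_term_bound ha hb (show 0 < 2 * x by linarith) hf
  set B : ℝ := (x / 2) ^ (b - 1) + (2 * x) ^ (b - 1) with hB
  have : ContinuousOn (fracSeries a b f) (Ioo (x / 2) (2 * x)) := by
    refine continuousOn_tsum (u := fun s : ℕ => M * (1 / 2) ^ s * B) ?_
      ((summable_geometric_two.mul_left M).mul_right B) ?_
    · intro s y hy
      have hy0 : 0 < y := by linarith [hy.1]
      exact (((Real.continuousAt_rpow_const _ _ (Or.inl hy0.ne')).div_const _).const_mul
        _).continuousWithinAt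
    · intro s y hy
      have hy0 : 0 < y := by linarith [hy.1]
      have hG : 0 < Real.Gamma (a * s + b) := Real.Gamma_pos_of_pos (by positivity)
      rw [norm_mul, Real.norm_eq_abs, Real.norm_of_nonneg (by positivity)]
      refine (h y hy0 hy.2.le s).trans ?_
      gcongr
      exact rpow_le_add_rpow (by linarith) hy.1.le hy.2.le _
  exact this.continuousAt (Ioo_mem_nhds (by linarith) (by linarith))

theorem continuousOn_fracSeries {a b : ℝ} {f : ℕ → ℝ} (ha : 0 < a) (hb : 0 < b)
    (hf : ExpBdd f) : ContinuousOn (fracSeries a b f) (Ioi 0) :=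
  fun _ hx => (continuousAt_fracSeries ha hb hx hf).continuousWithinAt

/-- For `b ≥ 1` no exponent is negative, so the terms are continuous at `0` and are dominated by
their sizes at `R`. -/
theorem continuousOn_fracSeries_Icc {a b R : ℝ} {f : ℕ → ℝ} (ha : 0 < a) (hb : 1 ≤ b)
    (hR : 0 < R) (hf : ExpBdd f) : ContinuousOn (fracSeries a b f) (Icc 0 R) := by
  have h := fracSeries_summable ha (by linarith : 0 < b) hR hf
  refine continuousOn_tsum (fun s => ?_) h fun s x hx => ?_
  · have : 0 ≤ a * s + b - 1 := by have : 0 ≤ a * s := by positivity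
                                   linarith
    exact (((Real.continuous_rpow_const this).div_const _).const_mul _).continuousOn
  · have h0 : 0 ≤ a * s + b - 1 := by have : 0 ≤ a * s := by positivity
                                      linarith
    have hG : 0 < Real.Gamma (a * s + b) := Real.Gamma_pos_of_pos (by linarith)
    have hx0 : 0 ≤ x := hx.1
    have h1 : 0 ≤ x ^ (a * s + b - 1) / Real.Gamma (a * s + b) := by positivity
    have h2 : 0 ≤ R ^ (a * s + b - 1) / Real.Gamma (a * s + b) := by positivity
    rw [norm_mul, norm_mul, Real.norm_of_nonneg h1, Real.norm_of_nonneg h2]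
    gcongr
    exact hx.2

theorem fracSeries_one_eq_add {a x : ℝ} {f : ℕ → ℝ} (ha : 0 < a) (hx : 0 < x) (hf : ExpBdd f) :
    fracSeries a 1 f x = f 0 + fracSeries a (a + 1) (fun s => f (s + 1)) x := by
  rw [fracSeries, (fracSeries_summable ha one_pos hx hf).of_norm.tsum_eq_zero_add]
  simp only [CharP.cast_eq_zero, mul_zero, zero_add, sub_self, Real.rpow_zero, Real.Gamma_one,
    div_one, mul_one, fracSeries]
  congr 1
  refine tsum_congr fun s => ?_
  push_cast
  rw [show a * ((s : ℝ) + 1) + 1 = a * s + (a + 1) by ring]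

/-- At second parameter `1` the leading term is constant; once it is removed the series starts at
exponent `a` and the general rule applies. -/
theorem hasDerivAt_fracSeries_one {a x : ℝ} {f : ℕ → ℝ} (ha : 0 < a) (hx : 0 < x)
    (hf : ExpBdd f) :
    HasDerivAt (fracSeries a 1 f) (fracSeries a a (fun s => f (s + 1)) x) x := by
  refine ((hasDerivAt_fracSeries ha ha hx hf.comp_succ).const_add (f 0)).congr_of_eventuallyEq ?_
  filter_upwards [lt_mem_nhds hx] with y hy using fracSeries_one_eq_add ha hy hf

/-! ### Convolution of fractional power series -/

theorem integral_beta_kernel {p q x : ℝ} (hp : 0 < p) (hq : 0 < q) (hx : 0 < x) :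
    ∫ τ in (0 : ℝ)..x, (x - τ) ^ (p - 1) * τ ^ (q - 1) =
      Real.Gamma p * Real.Gamma q / Real.Gamma (p + q) * x ^ (p + q - 1) := by
  have h := Complex.betaIntegral_scaled (q : ℂ) (p : ℂ) hx
  rw [Complex.betaIntegral_eq_Gamma_mul_div _ _ (by simpa using hq) (by simpa using hp)] at h
  have h2 : (∫ τ in (0 : ℝ)..x, ((τ : ℂ) ^ ((q : ℂ) - 1)) * ((x : ℂ) - τ) ^ ((p : ℂ) - 1)) =
      ∫ τ in (0 : ℝ)..x, (((x - τ) ^ (p - 1) * τ ^ (q - 1) : ℝ) : ℂ) := by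
    rw [intervalIntegral.integral_of_le hx.le, intervalIntegral.integral_of_le hx.le]
    refine setIntegral_congr_fun measurableSet_Ioc fun τ hτ => ?_
    rw [Complex.ofReal_mul, Complex.ofReal_cpow (sub_nonneg.2 hτ.2), Complex.ofReal_cpow hτ.1.le]
    push_cast
    ring
  rw [h2, intervalIntegral.integral_ofReal, Complex.Gamma_ofReal, Complex.Gamma_ofReal,
    ← Complex.ofReal_add, Complex.Gamma_ofReal, ← Complex.ofReal_one, ← Complex.ofReal_sub,
    ← Complex.ofReal_cpow hx.le] at h
  have h3 := congrArg Complex.re h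
  rw [Complex.ofReal_re] at h3
  rw [h3]
  have : ((x ^ (q + p - 1) : ℝ) : ℂ) *
      ((Real.Gamma q : ℂ) * (Real.Gamma p : ℂ) / (Real.Gamma (q + p) : ℂ)) =
      ((x ^ (q + p - 1) * (Real.Gamma q * Real.Gamma p / Real.Gamma (q + p)) : ℝ) : ℂ) := by
    push_cast; rfl
  rw [this, Complex.ofReal_re, add_comm q p]
  ring

/-- The integral of a non-integrable function is `0` by convention, whereas the Beta integral is
positive. -/
theorem intervalIntegrable_beta_kernel {p q x : ℝ} (hp : 0 < p) (hq : 0 < q) (hx : 0 < x) :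
    IntervalIntegrable (fun τ => (x - τ) ^ (p - 1) * τ ^ (q - 1)) volume 0 x := by
  by_contra h
  have h1 := intervalIntegral.integral_undef h
  rw [integral_beta_kernel hp hq hx] at h1
  have := Real.Gamma_pos_of_pos hp
  have := Real.Gamma_pos_of_pos hq
  have := Real.Gamma_pos_of_pos (add_pos hp hq)
  have : 0 < x ^ (p + q - 1) := by positivity
  exact absurd h1 (by positivity)

theorem hasSum_antidiagonal {F : ℕ × ℕ → ℝ} {S : ℝ} (h : HasSum F S) :
    HasSum (fun n => ∑ p ∈ Finset.HasAntidiagonal.antidiagonal n, F p) S := by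
  have h2 := (Finset.HasAntidiagonal.sigmaAntidiagonalEquivProd.hasSum_iff (f := F)).2 h
  have h3 := h2.sigma fun n => hasSum_fintype _
  convert h3 using 1
  ext n
  exact (Finset.sum_coe_sort (Finset.HasAntidiagonal.antidiagonal n) F).symm

theorem intervalIntegrable_fracSeries_conv {a b d x : ℝ} {f g : ℕ → ℝ} (ha : 0 < a) (hb : 0 < b)
    (hd : 0 < d) (hx : 0 < x) (hf : ExpBdd f) (hg : ExpBdd g) :
    IntervalIntegrable (fun τ => fracSeries a b f (x - τ) * fracSeries a d g τ) volume 0 x := by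
  obtain ⟨M, hM, h⟩ := abs_fracSeries_le ha hb hx hf
  obtain ⟨M', hM', h'⟩ := abs_fracSeries_le ha hd hx hg
  rw [intervalIntegrable_iff_integrableOn_Ioo_of_le hx.le]
  have hk := (intervalIntegrable_beta_kernel hb hd hx).const_mul (M * M')
  rw [intervalIntegrable_iff_integrableOn_Ioo_of_le hx.le] at hk
  refine Integrable.mono' hk ?_ ?_
  · refine ContinuousOn.aestronglyMeasurable ?_ measurableSet_Ioo
    refine ContinuousOn.mul ?_ ((continuousOn_fracSeries ha hd hg).mono Ioo_subset_Ioi_self)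
    exact (continuousOn_fracSeries ha hb hf).comp (by fun_prop)
      fun τ hτ => mem_Ioi.2 (sub_pos.2 hτ.2)
  · refine (ae_restrict_iff' measurableSet_Ioo).2 (Eventually.of_forall fun τ hτ => ?_)
    have h1 := h (x - τ) (sub_pos.2 hτ.2) (by linarith [hτ.1])
    have h2 := h' τ hτ.1 hτ.2.le
    rw [norm_mul, mul_mul_mul_comm]
    exact mul_le_mul h1 h2 (abs_nonneg _) ((abs_nonneg _).trans h1)

/-- The functions `x^(p - 1) / Γ(p)` form a convolution semigroup by the Beta integral, so
convolution multiplies the coefficient sequences in the Cauchy sense and adds the second parameters.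
-/
theorem integral_fracSeries_conv {a b d x : ℝ} {f g : ℕ → ℝ} (ha : 0 < a) (hb : 0 < b)
    (hd : 0 < d) (hx : 0 < x) (hf : ExpBdd f) (hg : ExpBdd g) :
    ∫ τ in (0 : ℝ)..x, fracSeries a b f (x - τ) * fracSeries a d g τ =
      fracSeries a (b + d) (fun n => ∑ p ∈ Finset.HasAntidiagonal.antidiagonal n, f p.1 * g p.2) x := by
  have hpos : ∀ (e : ℝ) (i : ℕ), 0 < e → 0 < a * i + e := fun e i he => by positivity
  set K : ℕ × ℕ → ℝ → ℝ := fun p τ =>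
    (x - τ) ^ (a * p.1 + b - 1) * τ ^ (a * p.2 + d - 1) with hK
  set c : ℕ × ℕ → ℝ := fun p =>
    f p.1 * g p.2 / (Real.Gamma (a * p.1 + b) * Real.Gamma (a * p.2 + d)) with hc
  set Φ : ℕ → ℝ := fun n => x ^ (a * n + (b + d) - 1) / Real.Gamma (a * n + (b + d)) with hΦ
  have hKint : ∀ p, IntegrableOn (K p) (Ioo 0 x) := fun p => by
    rw [← intervalIntegrable_iff_integrableOn_Ioo_of_le hx.le]
    exact intervalIntegrable_beta_kernel (hpos b p.1 hb) (hpos d p.2 hd) hx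
  have hKval : ∀ p : ℕ × ℕ, ∫ τ in Ioo 0 x, K p τ =
      Real.Gamma (a * p.1 + b) * Real.Gamma (a * p.2 + d) * Φ (p.1 + p.2) := by
    intro p
    have := integral_beta_kernel (hpos b p.1 hb) (hpos d p.2 hd) hx
    rw [intervalIntegral.integral_of_le hx.le, integral_Ioc_eq_integral_Ioo] at this
    rw [hK, this, hΦ]
    push_cast
    rw [show a * (p.1 : ℝ) + b + (a * p.2 + d) = a * (p.1 + p.2) + (b + d) by ring]
    ring
  have hcK : ∀ p : ℕ × ℕ, ∫ τ in Ioo 0 x, c p * K p τ = f p.1 * g p.2 * Φ (p.1 + p.2) := by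
    intro p
    have h1 := (Real.Gamma_pos_of_pos (hpos b p.1 hb)).ne'
    have h2 := (Real.Gamma_pos_of_pos (hpos d p.2 hd)).ne'
    rw [integral_const_mul, hKval, hc]
    field_simp
  have hcKn : ∀ p : ℕ × ℕ, ∫ τ in Ioo 0 x, ‖c p * K p τ‖ = |f p.1| * |g p.2| * Φ (p.1 + p.2) := by
    intro p
    have h1 := (Real.Gamma_pos_of_pos (hpos b p.1 hb))
    have h2 := (Real.Gamma_pos_of_pos (hpos d p.2 hd))
    have : ∫ τ in Ioo 0 x, ‖c p * K p τ‖ = ∫ τ in Ioo 0 x, |c p| * K p τ := by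
      refine setIntegral_congr_fun measurableSet_Ioo fun τ hτ => ?_
      have h3 : 0 < x - τ := sub_pos.2 hτ.2
      have h4 : 0 < τ := hτ.1
      simp only [norm_mul, Real.norm_eq_abs]
      congr 1
      exact abs_of_nonneg (by positivity)
    rw [this, integral_const_mul, hKval, hc]
    simp only [abs_div, abs_mul, abs_of_pos h1, abs_of_pos h2]
    field_simp
  have hΦ0 : ∀ n, 0 ≤ Φ n := fun n => by
    have := Real.Gamma_pos_of_pos (hpos (b + d) n (by positivity))
    positivity
  -- `Φ` sees only `p.1 + p.2`, so the term bound for the single sequence `C * C' * (L + L') ^ n`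
  -- dominates by a product of two geometric series.
  have hsum : Summable fun p : ℕ × ℕ => |f p.1| * |g p.2| * Φ (p.1 + p.2) := by
    obtain ⟨C, L, hC, hL, h⟩ := hf
    obtain ⟨C', L', hC', hL', h'⟩ := hg
    have hbd : ExpBdd (fun n => C * C' * (L + L') ^ n) :=
      ⟨C * C', L + L', by positivity, by positivity, fun s => by
        rw [abs_of_nonneg (by positivity)]⟩
    obtain ⟨M, hM, hb'⟩ := fracSeries_term_bound ha (add_pos hb hd) hx hbd
    have hg2 : Summable fun p : ℕ × ℕ => ((1 : ℝ) / 2) ^ p.1 * (1 / 2) ^ p.2 :=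
      summable_geometric_two.mul_of_nonneg summable_geometric_two
        (fun _ => by positivity) (fun _ => by positivity)
    refine Summable.of_nonneg_of_le (fun p => by have := hΦ0 (p.1 + p.2); positivity) (fun p => ?_)
      ((hg2.mul_left M).mul_right (x ^ (b + d - 1)))
    have := hb' x hx le_rfl (p.1 + p.2)
    rw [abs_of_nonneg (by positivity)] at this
    rw [← pow_add]
    refine le_trans (mul_le_mul_of_nonneg_right ?_ (hΦ0 _)) this
    calc |f p.1| * |g p.2| ≤ (C * L ^ p.1) * (C' * L' ^ p.2) :=
          mul_le_mul (h _) (h' _) (abs_nonneg _) (by positivity)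
      _ ≤ (C * (L + L') ^ p.1) * (C' * (L + L') ^ p.2) := by
          gcongr <;> linarith
      _ = C * C' * (L + L') ^ (p.1 + p.2) := by rw [pow_add]; ring
  have hS := hasSum_integral_of_summable_integral_norm (μ := volume.restrict (Ioo 0 x))
    (F := fun p τ => c p * K p τ) (fun p => (hKint p).const_mul _) (by simpa only [hcKn] using hsum)
  simp only [hcK] at hS
  have hval : ∫ τ in Ioo 0 x, ∑' p, c p * K p τ =
      ∫ τ in (0 : ℝ)..x, fracSeries a b f (x - τ) * fracSeries a d g τ := by
    rw [intervalIntegral.integral_of_le hx.le, integral_Ioc_eq_integral_Ioo]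
    refine setIntegral_congr_fun measurableSet_Ioo fun τ hτ => ?_
    rw [fracSeries, fracSeries, tsum_mul_tsum_of_summable_norm
      (fracSeries_summable ha hb (sub_pos.2 hτ.2) hf) (fracSeries_summable ha hd hτ.1 hg)]
    refine tsum_congr fun p => ?_
    simp only [hc, hK]
    field_simp
  rw [hval] at hS
  have h5 := (hasSum_antidiagonal hS).tsum_eq
  rw [← h5, fracSeries]
  refine tsum_congr fun n => ?_
  rw [Finset.sum_mul]
  refine Finset.sum_congr rfl fun p hp => ?_
  rw [Finset.HasAntidiagonal.mem_antidiagonal.1 hp]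

/-- The Riemann–Liouville kernel is itself a fractional series, with coefficients `1, 0, 0, …`, so
this is a case of the convolution formula. -/
theorem integral_rpow_fracSeries {a b d x : ℝ} {g : ℕ → ℝ} (ha : 0 < a) (hb : 0 < b)
    (hd : 0 < d) (hx : 0 < x) (hg : ExpBdd g) :
    IntervalIntegrable (fun τ => (x - τ) ^ (b - 1) * fracSeries a d g τ) volume 0 x ∧
    (Real.Gamma b)⁻¹ * ∫ τ in (0 : ℝ)..x, (x - τ) ^ (b - 1) * fracSeries a d g τ =
      fracSeries a (b + d) g x := by
  set δ : ℕ → ℝ := fun n => if n = 0 then 1 else 0 with hδ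
  have hδe : ExpBdd δ := ⟨1, 1, by norm_num, by norm_num, fun s => by
    simp only [hδ]; split_ifs <;> simp⟩
  have h0 : ∀ y, fracSeries a b δ y = y ^ (b - 1) / Real.Gamma b := fun y => by
    rw [fracSeries, tsum_eq_single 0 fun n hn => by simp [hδ, hn]]
    simp [hδ]
  have hG := (Real.Gamma_pos_of_pos hb).ne'
  have h1 := intervalIntegrable_fracSeries_conv ha hb hd hx hδe hg
  have h2 := integral_fracSeries_conv ha hb hd hx hδe hg
  simp only [h0] at h1 h2
  constructor
  · refine (h1.const_mul (Real.Gamma b)).congr fun τ _ => ?_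
    field_simp
  · rw [← intervalIntegral.integral_const_mul]
    calc _ = ∫ τ in (0 : ℝ)..x, (x - τ) ^ (b - 1) / Real.Gamma b * fracSeries a d g τ := by
          congr 1; ext τ; ring
      _ = _ := by
          rw [h2]
          congr 1
          ext n
          rw [Finset.sum_eq_single (0, n)]
          · simp [hδ]
          · rintro ⟨i, j⟩ hp hne
            have : i ≠ 0 := by
              rintro rfl
              simp at hp
              exact hne (by simp [hp])
            simp [hδ, this]
          · simp

/-! ### The Caputo derivative of Mittag-Leffler type series -/

/-- The coefficients `(-ξ t^b)^m / Γ(b m + 1)` of `E_b(-ξ t^b)`. -/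
def mlCoeff (b ξ t : ℝ) (m : ℕ) : ℝ := (-ξ * t ^ b) ^ m / Real.Gamma (b * m + 1)

theorem mlCoeff_eq {b ξ t : ℝ} (ht : 0 ≤ t) (m : ℕ) :
    mlCoeff b ξ t m = (-ξ) ^ m * (t ^ (b * m + 1 - 1) / Real.Gamma (b * m + 1)) := by
  rw [mlCoeff, mul_pow, add_sub_cancel_right, Real.rpow_mul ht, Real.rpow_natCast]
  ring

theorem tsum_mlCoeff_mul_eq {b ξ t : ℝ} (ht : 0 ≤ t) (y : ℕ → ℝ) :
    ∑' m, mlCoeff b ξ t m * y m = fracSeries b 1 (fun m => (-ξ) ^ m * y m) t := by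
  refine tsum_congr fun m => ?_
  rw [mlCoeff_eq ht]
  ring

theorem mlCoeff_zero {b ξ : ℝ} (hb : 0 < b) (m : ℕ) :
    mlCoeff b ξ 0 m = if m = 0 then 1 else 0 := by
  rw [mlCoeff, Real.zero_rpow hb.ne', mul_zero]
  rcases eq_or_ne m 0 with rfl | h
  · simp
  · simp [h]

theorem abs_mlCoeff_mul_summable {b ξ t : ℝ} (hb : 0 < b) (ht : 0 ≤ t) {y : ℕ → ℝ}
    (hy : ExpBdd y) : Summable fun m => ‖mlCoeff b ξ t m * y m‖ := by
  rcases ht.eq_or_lt with rfl | ht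
  · refine summable_of_ne_finset_zero (s := {0}) fun m hm => ?_
    rw [mlCoeff_zero hb, if_neg (by simpa using hm)]
    simp
  · refine (fracSeries_summable hb one_pos ht ((expBdd_pow (-ξ)).mul hy)).congr fun m => ?_
    rw [mlCoeff_eq ht.le]
    congr 1
    ring

/-- The derivative turns a series with second parameter `1` into one with parameter `b` and shifted
coefficients; for `b < 1` the fractional integral of order `1 - b` restores the parameter `1`.
Leaving `y` free lets one statement serve the state probabilities, the atom, the tested distribution
and the pointwise density. -/
theorem hasCaputoDeriv_tsum_mlCoeff {b ξ t : ℝ} (hb : 0 < b) (hb1 : b ≤ 1) (ht : 0 < t)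
    {y : ℕ → ℝ} (hy : ExpBdd y) :
    HasCaputoDeriv b (fun r => ∑' m, mlCoeff b ξ r m * y m) t
      (-ξ * ∑' m, mlCoeff b ξ t m * y (m + 1)) := by
  have hY : ExpBdd (fun m => (-ξ) ^ m * y m) := (expBdd_pow _).mul hy
  set Y : ℕ → ℝ := fun m => (-ξ) ^ (m + 1) * y (m + 1) with hYdef
  have hd : ∀ r, 0 < r → HasDerivAt (fun r => ∑' m, mlCoeff b ξ r m * y m)
      (fracSeries b b Y r) r := by
    intro r hr
    refine (hasDerivAt_fracSeries_one hb hr hY).congr_of_eventuallyEq ?_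
    filter_upwards [lt_mem_nhds hr] with s hs using tsum_mlCoeff_mul_eq hs.le y
  have hval : -ξ * ∑' m, mlCoeff b ξ t m * y (m + 1) = fracSeries b 1 Y t := by
    rw [tsum_mlCoeff_mul_eq ht.le (fun m => y (m + 1)), fracSeries, fracSeries, ← tsum_mul_left]
    refine tsum_congr fun m => ?_
    simp only [hYdef, pow_succ]
    ring
  refine ⟨?_, ?_⟩
  · refine (continuousOn_fracSeries_Icc hb le_rfl ht hY).congr fun r hr => ?_
    exact tsum_mlCoeff_mul_eq hr.1 y
  rw [hval]
  rcases hb1.eq_or_lt with rfl | hb1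
  · exact Or.inl ⟨rfl, hd t ht⟩
  · right
    refine ⟨hb1, fun r hr => (hd r hr.1).differentiableAt.differentiableWithinAt, ?_⟩
    obtain ⟨h1, h2⟩ := integral_rpow_fracSeries hb (sub_pos.2 hb1) hb ht hY.comp_succ
    have he : ∀ τ ∈ Ioc 0 t, (t - τ) ^ (1 - b - 1) * fracSeries b b Y τ =
        (t - τ) ^ (-b) * deriv (fun r => ∑' m, mlCoeff b ξ r m * y m) τ := by
      intro τ hτ
      rw [(hd τ hτ.1).deriv, show 1 - b - 1 = -b by ring]
    constructor
    · refine h1.congr fun τ hτ => he τ ?_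
      rwa [uIoc_of_le ht.le] at hτ
    · rw [show (1 : ℝ) - b + b = 1 by ring] at h2
      rw [← h2]
      congr 1
      rw [intervalIntegral.integral_of_le ht.le, intervalIntegral.integral_of_le ht.le]
      exact setIntegral_congr_fun measurableSet_Ioc he

theorem mittagLeffler_eq_tsum_mlCoeff (b ξ t : ℝ) :
    mittagLeffler b (-ξ * t ^ b) = ∑' m, mlCoeff b ξ t m * 1 := by
  simp only [mul_one]; rfl

theorem expBdd_one : ExpBdd (fun _ => 1) := ⟨1, 1, by norm_num, by norm_num, by simp⟩

theorem hasCaputoDeriv_mittagLeffler {b ξ t : ℝ} (hb : 0 < b) (hb1 : b ≤ 1) (ht : 0 < t) :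
    HasCaputoDeriv b (fun r => mittagLeffler b (-ξ * r ^ b)) t
      (-ξ * mittagLeffler b (-ξ * t ^ b)) := by
  simp only [mittagLeffler_eq_tsum_mlCoeff]
  exact hasCaputoDeriv_tsum_mlCoeff hb hb1 ht expBdd_one

/-! ### The state probabilities -/

/-- The truncated `ℓ¹` norm is submultiplicative, because coefficients of a product up to degree `n`
involve only coefficients up to degree `n`. Hence each coefficient of `F ^ m` is exponentially
bounded in `m`. -/
theorem abs_coeff_pow_le (F : ℝ⟦X⟧) (n m : ℕ) :
    |PowerSeries.coeff n (F ^ m)| ≤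
      (∑ k ∈ Finset.range (n + 1), |PowerSeries.coeff k F|) ^ m := by
  set N := ∑ k ∈ Finset.range (n + 1), |PowerSeries.coeff k F| with hN
  suffices h : ∑ k ∈ Finset.range (n + 1), |PowerSeries.coeff k (F ^ m)| ≤ N ^ m from
    (Finset.single_le_sum (f := fun k => |PowerSeries.coeff k (F ^ m)|)
      (fun _ _ => abs_nonneg _) (Finset.self_mem_range_succ n)).trans h
  induction m with
  | zero =>
    rw [pow_zero, pow_zero, Finset.sum_eq_single 0]
    · simp
    · intro k _ hk
      simp [PowerSeries.coeff_one, hk]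
    · simp
  | succ m ih =>
    rw [pow_succ, pow_succ]
    refine le_trans ?_ (mul_le_mul_of_nonneg_right ih (Finset.sum_nonneg fun _ _ => abs_nonneg _))
    calc ∑ k ∈ Finset.range (n + 1), |PowerSeries.coeff k (F ^ m * F)|
        ≤ ∑ k ∈ Finset.range (n + 1), ∑ i ∈ Finset.range (k + 1),
          |PowerSeries.coeff i (F ^ m)| * |PowerSeries.coeff (k - i) F| := by
          refine Finset.sum_le_sum fun k _ => ?_
          rw [PowerSeries.coeff_mul, Finset.Nat.sum_antidiagonal_eq_sum_range_succ
            (fun i j => PowerSeries.coeff i (F ^ m) * PowerSeries.coeff j F)]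
          refine (Finset.abs_sum_le_sum_abs _ _).trans (le_of_eq ?_)
          simp only [abs_mul]
      _ ≤ _ := by
          rw [hN, Finset.sum_mul_sum, Finset.sum_range_diag_flip (n + 1)
            (fun i j => |PowerSeries.coeff i (F ^ m)| * |PowerSeries.coeff j F|)]
          refine Finset.sum_le_sum fun i _ => ?_
          exact Finset.sum_le_sum_of_subset_of_nonneg
            (Finset.range_subset_range.2 (Nat.sub_le _ _)) fun _ _ _ => by positivity

/-- Passing from `m` to `m + 1` multiplies `G ^ m` by `G`, and the coefficient of that product is
the finite convolution. -/
theorem hasCaputoDeriv_stateProb {a b l ξ t : ℝ} (hb : 0 < b) (hb1 : b ≤ 1) (ht : 0 < t) (n : ℕ) :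
    HasCaputoDeriv b (stateProb a b l ξ n) t
      (-ξ * ∑ k ∈ Finset.range (n + 1), stateProb a b l ξ k t *
          PowerSeries.coeff (n - k) (discreteLaplacian a l)) := by
  set G := discreteLaplacian a l with hG
  have hE : ∀ k, ExpBdd fun m => PowerSeries.coeff k (G ^ m) := fun k =>
    ⟨1, (∑ j ∈ Finset.range (k + 1), |PowerSeries.coeff j G|) + 1, by norm_num,
      by have := Finset.sum_nonneg (s := Finset.range (k + 1))
          (fun j _ => abs_nonneg (PowerSeries.coeff j G))
         linarith, fun m => by
      rw [one_mul]
      refine (abs_coeff_pow_le G k m).trans (pow_le_pow_left₀ ?_ (by linarith) _)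
      exact Finset.sum_nonneg fun _ _ => abs_nonneg _⟩
  change HasCaputoDeriv b (fun r => ∑' m, mlCoeff b ξ r m * PowerSeries.coeff n (G ^ m)) t _
  convert hasCaputoDeriv_tsum_mlCoeff (ξ := ξ) hb hb1 ht (hE n) using 2
  have h1 := hasSum_sum (s := Finset.range (n + 1)) (f := fun k m =>
    mlCoeff b ξ t m * PowerSeries.coeff k (G ^ m) * PowerSeries.coeff (n - k) G)
    (a := fun k => stateProb a b l ξ k t * PowerSeries.coeff (n - k) G) fun k _ =>
    ((abs_mlCoeff_mul_summable hb ht.le (hE k)).of_norm.hasSum).mul_right _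
  rw [← h1.tsum_eq]
  refine tsum_congr fun m => ?_
  rw [pow_succ, PowerSeries.coeff_mul, Finset.Nat.sum_antidiagonal_eq_sum_range_succ
    (fun i j => PowerSeries.coeff i (G ^ m) * PowerSeries.coeff j G), Finset.mul_sum]
  exact Finset.sum_congr rfl fun k _ => by ring

theorem stateProb_zero {a b l ξ : ℝ} (hb : 0 < b) (n : ℕ) :
    stateProb a b l ξ n 0 = if n = 0 then 1 else 0 := by
  have : stateProb a b l ξ n 0 =
      ∑' m, mlCoeff b ξ 0 m * PowerSeries.coeff n (discreteLaplacian a l ^ m) := rfl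
  rw [this, tsum_eq_single 0 fun m hm => by rw [mlCoeff_zero hb, if_neg hm, zero_mul]]
  simp [mlCoeff_zero hb, PowerSeries.coeff_one]

/-! ### Coefficients of powers of the normalized Laplacian -/

theorem factorial_mul_multichoose (r : ℝ) (n : ℕ) :
    (n.factorial : ℝ) * Ring.multichoose r n = (ascPochhammer ℝ n).eval r := by
  rw [← nsmul_eq_mul, Ring.factorial_nsmul_multichoose_eq_ascPochhammer,
    Polynomial.ascPochhammer_smeval_eq_eval]

theorem multichoose_eq_div (r : ℝ) (n : ℕ) :
    Ring.multichoose r n = (ascPochhammer ℝ n).eval r / n.factorial := by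
  rw [← factorial_mul_multichoose, mul_div_cancel_left₀]
  exact_mod_cast n.factorial_ne_zero

theorem succ_mul_multichoose_succ (r : ℝ) (n : ℕ) :
    ((n : ℝ) + 1) * Ring.multichoose r (n + 1) = Ring.multichoose r n * (r + n) := by
  rw [multichoose_eq_div, multichoose_eq_div, ascPochhammer_succ_eval, Nat.factorial_succ]
  push_cast
  have : (n.factorial : ℝ) ≠ 0 := by exact_mod_cast n.factorial_ne_zero
  field_simp

theorem multichoose_succ_eq (r : ℝ) (n : ℕ) :
    Ring.multichoose r (n + 1) = Ring.multichoose r n * ((r + n) / (n + 1)) := by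
  rw [← mul_div_assoc, ← succ_mul_multichoose_succ]
  field_simp

theorem multichoose_nonneg {r : ℝ} (hr : 0 ≤ r) (n : ℕ) : 0 ≤ Ring.multichoose r n := by
  induction n with
  | zero => simp
  | succ n ih => rw [multichoose_succ_eq]; positivity

theorem multichoose_le_multichoose {r r' : ℝ} (hr : 0 ≤ r) (h : r ≤ r') (n : ℕ) :
    Ring.multichoose r n ≤ Ring.multichoose r' n := by
  induction n with
  | zero => simp
  | succ n ih =>
    rw [multichoose_succ_eq, multichoose_succ_eq]
    have := multichoose_nonneg hr n
    gcongr
    exact (multichoose_nonneg (hr.trans h) n)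

/-- The first factor is `-a`; all later factors are nonnegative because `a ≤ 1`. -/
theorem multichoose_neg_nonpos {a : ℝ} (ha : 0 ≤ a) (ha1 : a ≤ 1) (n : ℕ) :
    Ring.multichoose (-a) (n + 1) ≤ 0 := by
  induction n with
  | zero => simpa using ha
  | succ n ih =>
    rw [multichoose_succ_eq]
    refine mul_nonpos_of_nonpos_of_nonneg ih (div_nonneg ?_ (by positivity))
    push_cast
    have : (0 : ℝ) ≤ n := n.cast_nonneg
    linarith

/-- Double induction through Pascal's rule. This crude bound is the origin of the powers of `2` and
`4` in the later estimates. -/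
theorem multichoose_natCast_le (m s : ℕ) : Ring.multichoose (m : ℝ) s ≤ 2 ^ (m + s) := by
  induction m generalizing s with
  | zero =>
    cases s with
    | zero => simp
    | succ s => simp
  | succ m ihm =>
    induction s with
    | zero => simpa using one_le_pow₀ (by norm_num : (1 : ℝ) ≤ 2)
    | succ s ihs =>
      push_cast at ihs ⊢
      rw [Ring.multichoose_succ_succ]
      refine (add_le_add (ihm (s + 1)) ihs).trans (le_of_eq ?_)
      rw [show m + 1 + s = m + (s + 1) by ring, show m + 1 + (s + 1) = m + (s + 1) + 1 by ring,
        pow_succ]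
      ring

theorem coeff_fracLaplacian (a : ℝ) (n : ℕ) :
    PowerSeries.coeff n (fracLaplacian a) = Ring.multichoose (-a) n := by
  have h := Ring.choose_neg' (-a) n
  rw [neg_neg] at h
  rw [fracLaplacian, PowerSeries.coeff_mk, h, Units.smul_def, zsmul_eq_mul, ← mul_assoc]
  have : ((-1 : ℝ) ^ n * ((Int.negOnePow n : ℤˣ) : ℤ)) = 1 := by
    rw [Int.cast_negOnePow_natCast, ← mul_pow]
    simp
  rw [this, one_mul]

theorem fracLaplacian_add (a b : ℝ) :
    fracLaplacian (a + b) = fracLaplacian a * fracLaplacian b := by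
  have h : ∀ a : ℝ, fracLaplacian a =
      PowerSeries.rescale (-1 : ℝ) (PowerSeries.binomialSeries ℝ a) := fun a => by
    ext n
    simp [fracLaplacian]
  rw [h, h, h, PowerSeries.binomialSeries_add, map_mul]

theorem fracLaplacian_zero : fracLaplacian 0 = 1 := by
  ext n
  rw [coeff_fracLaplacian, neg_zero, PowerSeries.coeff_one]
  cases n <;> simp

theorem constantCoeff_fracLaplacian (a : ℝ) :
    PowerSeries.constantCoeff (fracLaplacian a) = 1 := by
  rw [← PowerSeries.coeff_zero_eq_constantCoeff_apply, coeff_fracLaplacian]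
  simp

/-- Vandermonde's identity, read off from `(1 - u)^(-a) (1 - u)^(-b) = (1 - u)^(-(a + b))`. -/
theorem sum_multichoose_mul_multichoose (a b : ℝ) (n : ℕ) :
    ∑ p ∈ Finset.HasAntidiagonal.antidiagonal n,
      Ring.multichoose a p.1 * Ring.multichoose b p.2 = Ring.multichoose (a + b) n := by
  have h := congrArg (PowerSeries.coeff n) (fracLaplacian_add (-a) (-b))
  rw [PowerSeries.coeff_mul, coeff_fracLaplacian] at h
  simp only [coeff_fracLaplacian, neg_neg] at h
  rw [← h]
  congr 1
  ring

theorem constantCoeff_add_fracLaplacian_ne_zero (a : ℝ) {l : ℝ} (hl : 0 < l) :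
    PowerSeries.constantCoeff (PowerSeries.C l + fracLaplacian a) ≠ 0 := by
  rw [map_add, constantCoeff_fracLaplacian, PowerSeries.constantCoeff_C]
  linarith

/-- A positive constant term followed by nonpositive coefficients makes the recursion for the
inverse series preserve nonnegativity. -/
theorem coeff_inv_add_fracLaplacian_nonneg {a l : ℝ} (ha : 0 ≤ a) (ha1 : a ≤ 1) (hl : 0 < l)
    (n : ℕ) : 0 ≤ PowerSeries.coeff n (PowerSeries.C l + fracLaplacian a)⁻¹ := by
  have hc : 0 < PowerSeries.constantCoeff (PowerSeries.C l + fracLaplacian a) := by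
    rw [map_add, constantCoeff_fracLaplacian, PowerSeries.constantCoeff_C]
    linarith
  induction n using Nat.strong_induction_on with
  | _ n ih =>
    rw [PowerSeries.coeff_inv]
    split_ifs with hn
    · exact (inv_pos.2 hc).le
    · rw [neg_mul, ← mul_neg, ← Finset.sum_neg_distrib]
      refine mul_nonneg (inv_pos.2 hc).le (Finset.sum_nonneg fun p hp => ?_)
      split_ifs with hlt
      · have hp1 : p.1 + p.2 = n := Finset.HasAntidiagonal.mem_antidiagonal.1 hp
        obtain ⟨k, hk⟩ : ∃ k, p.1 = k + 1 := ⟨p.1 - 1, by omega⟩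
        rw [← neg_mul]
        refine mul_nonneg ?_ (ih _ hlt)
        rw [map_add, hk, coeff_fracLaplacian, PowerSeries.coeff_C]
        have := multichoose_neg_nonpos ha ha1 k
        simpa using this
      · simp

theorem fracLaplacian_mul_inv {a l : ℝ} (hl : 0 < l) :
    fracLaplacian a * (PowerSeries.C l + fracLaplacian a)⁻¹ =
      1 - PowerSeries.C l * (PowerSeries.C l + fracLaplacian a)⁻¹ := by
  have h := PowerSeries.mul_inv_cancel _ (constantCoeff_add_fracLaplacian_ne_zero a hl)
  rw [add_mul] at h
  rw [← h]
  ring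

/-- From `G = (l + 1) (1 - l (l + (1 - u)^a)⁻¹)`. In the limit this sign becomes the positivity of
the Mittag-Leffler density. -/
theorem coeff_succ_discreteLaplacian_nonpos {a l : ℝ} (ha : 0 ≤ a) (ha1 : a ≤ 1) (hl : 0 < l)
    (n : ℕ) : PowerSeries.coeff (n + 1) (discreteLaplacian a l) ≤ 0 := by
  rw [discreteLaplacian, mul_assoc, fracLaplacian_mul_inv hl, PowerSeries.coeff_C_mul, map_sub,
    PowerSeries.coeff_C_mul]
  have := coeff_inv_add_fracLaplacian_nonneg ha ha1 hl (n + 1)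
  have h1 : PowerSeries.coeff (n + 1) (1 : ℝ⟦X⟧) = 0 := by simp [PowerSeries.coeff_one]
  rw [h1, zero_sub, mul_neg]
  have : 0 ≤ (l + 1) * (l * PowerSeries.coeff (n + 1) (PowerSeries.C l + fracLaplacian a)⁻¹) := by
    positivity
  linarith

theorem constantCoeff_discreteLaplacian {a l : ℝ} (hl : 0 < l) :
    PowerSeries.constantCoeff (discreteLaplacian a l) = 1 := by
  rw [discreteLaplacian, map_mul, map_mul, PowerSeries.constantCoeff_inv]
  simp [constantCoeff_fracLaplacian]
  field_simp

theorem coeff_zero_discreteLaplacian_pow {a l : ℝ} (hl : 0 < l) (m : ℕ) :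
    PowerSeries.coeff 0 (discreteLaplacian a l ^ m) = 1 := by
  rw [PowerSeries.coeff_zero_eq_constantCoeff_apply, map_pow, constantCoeff_discreteLaplacian hl,
    one_pow]

/-! ### Expansion of the powers of the Laplacian in powers of `l` -/

/-- Each of the two binomial coefficients costs a factor `2 ^ s`, whence `l < 1 / 4`. The
restriction is harmless since `l = l₀ h^α` tends to `0`. -/
theorem summable_multichoose_mul {a l : ℝ} (ha : 0 ≤ a) (ha1 : a ≤ 1) (hl : 0 < l) (hl4 : l < 1 / 4)
    (m n : ℕ) :
    Summable fun s : ℕ => Ring.multichoose (m : ℝ) s * (-l) ^ s * Ring.multichoose (a * s) n := by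
  refine Summable.of_norm_bounded (g := fun s : ℕ => 2 ^ (m + n) * (4 * l) ^ s)
    ((summable_geometric_of_lt_one (by positivity) (by linarith)).mul_left _) fun s => ?_
  have h1 := multichoose_nonneg (Nat.cast_nonneg (α := ℝ) m) s
  have h2 := multichoose_nonneg (show 0 ≤ a * s by positivity) n
  rw [norm_mul, norm_mul, norm_pow, norm_neg, Real.norm_of_nonneg h1, Real.norm_of_nonneg hl.le,
    Real.norm_of_nonneg h2]
  have h3 : Ring.multichoose (a * s) n ≤ 2 ^ (s + n) :=
    (multichoose_le_multichoose (by positivity)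
      (mul_le_of_le_one_left (Nat.cast_nonneg s) ha1) n).trans (multichoose_natCast_le s n)
  calc _ ≤ 2 ^ (m + s) * l ^ s * 2 ^ (s + n) := by
        have := multichoose_natCast_le m s
        gcongr
    _ = 2 ^ (m + n) * (4 * l) ^ s := by
        rw [mul_pow, show (4 : ℝ) = 2 * 2 by norm_num, mul_pow, pow_add, pow_add, pow_add]; ring

/-- The power series of `(1 + l (1 - u)^(-a))^(-m)`, expanded in powers of `l`. -/
def prabhakarSeries (a l : ℝ) (m : ℕ) : ℝ⟦X⟧ :=
  PowerSeries.mk fun n =>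
    ∑' s : ℕ, Ring.multichoose (m : ℝ) s * (-l) ^ s * Ring.multichoose (a * s) n

theorem prabhakarSeries_zero (a l : ℝ) : prabhakarSeries a l 0 = 1 := by
  ext n
  rw [prabhakarSeries, PowerSeries.coeff_mk, tsum_eq_single 0, PowerSeries.coeff_one]
  · cases n <;> simp
  · intro s hs
    obtain ⟨k, rfl⟩ := Nat.exists_eq_succ_of_ne_zero hs
    simp

/-- Multiplication by `(1 - u)^(-a)` moves `s` to `s + 1` by Vandermonde, and Pascal's rule in `(m,
s)` collapses the two sums. As `l` is a number and not a formal variable, the argument runs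
coefficientwise with convergent sums. -/
theorem one_add_mul_prabhakarSeries {a l : ℝ} (ha : 0 ≤ a) (ha1 : a ≤ 1) (hl : 0 < l)
    (hl4 : l < 1 / 4) (m : ℕ) :
    (1 + PowerSeries.C l * fracLaplacian (-a)) * prabhakarSeries a l (m + 1) =
      prabhakarSeries a l m := by
  ext n
  have hs := fun m n => summable_multichoose_mul ha ha1 hl hl4 m n
  rw [add_mul, one_mul, map_add, mul_assoc, PowerSeries.coeff_C_mul, PowerSeries.coeff_mul]
  simp only [prabhakarSeries, PowerSeries.coeff_mk, coeff_fracLaplacian, neg_neg]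
  have h1 := hasSum_sum (s := Finset.HasAntidiagonal.antidiagonal n)
    (fun p _ => (hs (m + 1) p.2).hasSum.mul_left (Ring.multichoose a p.1))
  have h2 : HasSum (fun s : ℕ => Ring.multichoose ((m + 1 : ℕ) : ℝ) s * (-l) ^ s *
      Ring.multichoose (a * (s + 1 : ℕ)) n) (∑ p ∈ Finset.HasAntidiagonal.antidiagonal n,
        Ring.multichoose a p.1 * ∑' s : ℕ,
          Ring.multichoose ((m + 1 : ℕ) : ℝ) s * (-l) ^ s * Ring.multichoose (a * s) p.2) := by
    refine h1.congr_fun fun s => ?_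
    rw [show a * ((s + 1 : ℕ) : ℝ) = a + a * s by push_cast; ring,
      ← sum_multichoose_mul_multichoose, Finset.mul_sum]
    exact Finset.sum_congr rfl fun p _ => by ring
  rw [(hs (m + 1) n).tsum_eq_zero_add, (hs m n).tsum_eq_zero_add, add_assoc]
  congr 1
  · simp
  · rw [← h2.tsum_eq, ← tsum_mul_left, ← Summable.tsum_add
      ((summable_nat_add_iff 1).2 (hs (m + 1) n)) (h2.summable.mul_left _)]
    refine tsum_congr fun s => ?_
    have := Ring.multichoose_succ_succ (m : ℝ) s
    rw [Nat.cast_succ m, this, pow_succ]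
    ring

theorem prabhakarSeries_eq_pow {a l : ℝ} (ha : 0 ≤ a) (ha1 : a ≤ 1) (hl : 0 < l)
    (hl4 : l < 1 / 4) (m : ℕ) :
    prabhakarSeries a l m = (fracLaplacian a * (PowerSeries.C l + fracLaplacian a)⁻¹) ^ m := by
  induction m with
  | zero => rw [prabhakarSeries_zero, pow_zero]
  | succ m ih =>
    have h := PowerSeries.mul_inv_cancel _ (constantCoeff_add_fracLaplacian_ne_zero a hl)
    have hv : fracLaplacian a * fracLaplacian (-a) = 1 := by
      rw [← fracLaplacian_add, add_neg_cancel, fracLaplacian_zero]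
    rw [pow_succ, ← ih, ← one_add_mul_prabhakarSeries ha ha1 hl hl4 m]
    calc prabhakarSeries a l (m + 1)
        = ((PowerSeries.C l + fracLaplacian a) * (PowerSeries.C l + fracLaplacian a)⁻¹) *
            prabhakarSeries a l (m + 1) := by rw [h, one_mul]
      _ = ((PowerSeries.C l * (fracLaplacian a * fracLaplacian (-a)) + fracLaplacian a) *
            (PowerSeries.C l + fracLaplacian a)⁻¹) * prabhakarSeries a l (m + 1) := by
          rw [hv, mul_one]
      _ = _ := by ring

theorem coeff_discreteLaplacian_pow {a l : ℝ} (ha : 0 ≤ a) (ha1 : a ≤ 1) (hl : 0 < l)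
    (hl4 : l < 1 / 4) (m n : ℕ) :
    PowerSeries.coeff n (discreteLaplacian a l ^ m) = (l + 1) ^ m *
      ∑' s : ℕ, Ring.multichoose (m : ℝ) s * (-l) ^ s * Ring.multichoose (a * s) n := by
  rw [discreteLaplacian, mul_assoc, mul_pow, ← prabhakarSeries_eq_pow ha ha1 hl hl4, ← map_pow,
    PowerSeries.coeff_C_mul, prabhakarSeries, PowerSeries.coeff_mk]

/-- The omitted term `s = 0` is the series `1`, which is invisible away from `n = 0`: it is the
future atom. -/
theorem coeff_succ_discreteLaplacian_pow {a l : ℝ} (ha : 0 ≤ a) (ha1 : a ≤ 1) (hl : 0 < l)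
    (hl4 : l < 1 / 4) (m n : ℕ) :
    PowerSeries.coeff (n + 1) (discreteLaplacian a l ^ m) = (l + 1) ^ m *
      ∑' s : ℕ, Ring.multichoose (m : ℝ) (s + 1) * (-l) ^ (s + 1) *
        Ring.multichoose (a * (s + 1 : ℕ)) (n + 1) := by
  rw [coeff_discreteLaplacian_pow ha ha1 hl hl4,
    (summable_multichoose_mul ha ha1 hl hl4 m (n + 1)).tsum_eq_zero_add]
  simp

/-! ### Asymptotics and uniform bounds of binomial coefficients -/

theorem multichoose_eq_prod (a : ℝ) (n : ℕ) :
    (n.factorial : ℝ) * Ring.multichoose a n = ∏ j ∈ Finset.range n, (a + j) := by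
  induction n with
  | zero => simp
  | succ n ih =>
    rw [Finset.prod_range_succ, ← ih, Nat.factorial_succ]
    have := succ_mul_multichoose_succ a n
    push_cast
    linear_combination (n.factorial : ℝ) * this

theorem multichoose_pos {a : ℝ} (ha : 0 < a) (n : ℕ) : 0 < Ring.multichoose a n := by
  induction n with
  | zero => simp
  | succ n ih => rw [multichoose_succ_eq]; positivity

/-- Inverse of Euler's limit for the Gamma function. The sequence `Real.GammaSeq` has one more
factor `a + n` in its product, corrected by `n / (n + a) → 1`. -/
theorem tendsto_multichoose_mul_rpow {a : ℝ} (ha : 0 < a) :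
    Tendsto (fun n : ℕ => Ring.multichoose a n * (n : ℝ) ^ (1 - a)) atTop
      (𝓝 (Real.Gamma a)⁻¹) := by
  have h1 := (Real.GammaSeq_tendsto_Gamma a).inv₀ (Real.Gamma_pos_of_pos ha).ne'
  have h2 : Tendsto (fun n : ℕ => (n : ℝ) / ((n : ℝ) + a)) atTop (𝓝 1) :=
    tendsto_natCast_div_add_atTop a
  have h3 := h2.mul h1
  rw [one_mul] at h3
  refine h3.congr' ?_
  filter_upwards [eventually_gt_atTop 0] with n hn
  have hn' : (0 : ℝ) < n := by exact_mod_cast hn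
  have hf : (n.factorial : ℝ) ≠ 0 := by exact_mod_cast n.factorial_ne_zero
  have hm := (multichoose_pos ha n).ne'
  rw [Real.GammaSeq, Finset.prod_range_succ, ← multichoose_eq_prod, Real.rpow_sub hn',
    Real.rpow_one]
  have : (n : ℝ) ^ a ≠ 0 := by positivity
  have : (n : ℝ) + a ≠ 0 := by positivity
  have : a + (n : ℝ) ≠ 0 := by positivity
  field_simp
  ring

theorem tendsto_floor_div_mul {x : ℝ} (hx : 0 < x) :
    Tendsto (fun h : ℝ => (⌊x / h⌋₊ : ℝ) * h) (𝓝[>] 0) (𝓝 x) := by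
  have h := (tendsto_nat_floor_mul_div_atTop hx.le).comp tendsto_inv_nhdsGT_zero
  refine h.congr fun h => ?_
  simp [div_eq_mul_inv]

theorem tendsto_floor_div_atTop {x : ℝ} (hx : 0 < x) :
    Tendsto (fun h : ℝ => ⌊x / h⌋₊) (𝓝[>] 0) atTop := by
  refine tendsto_nat_floor_atTop.comp (f := fun h : ℝ => x / h) ?_
  simp only [div_eq_mul_inv]
  exact tendsto_inv_nhdsGT_zero.const_mul_atTop hx

theorem tendsto_rpow_mul_multichoose_floor {a x : ℝ} (ha : 0 < a) (hx : 0 < x) :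
    Tendsto (fun h : ℝ => h ^ (a - 1) * Ring.multichoose a ⌊x / h⌋₊) (𝓝[>] 0)
      (𝓝 (x ^ (a - 1) / Real.Gamma a)) := by
  have h1 := (tendsto_multichoose_mul_rpow ha).comp (tendsto_floor_div_atTop hx)
  have h2 := (tendsto_floor_div_mul hx).rpow_const (p := a - 1) (Or.inl hx.ne')
  refine (h2.mul h1).congr' ?_
  filter_upwards [(tendsto_floor_div_atTop hx).eventually_gt_atTop 0, self_mem_nhdsWithin]
    with h hn hh
  have hh : 0 < h := hh
  have hn' : (0 : ℝ) < ⌊x / h⌋₊ := by exact_mod_cast hn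
  change _ * (Ring.multichoose a ⌊x / h⌋₊ * (⌊x / h⌋₊ : ℝ) ^ (1 - a)) = _
  rw [Real.mul_rpow hn'.le hh.le, show 1 - a = -(a - 1) by ring, Real.rpow_neg hn'.le]
  have : (⌊x / h⌋₊ : ℝ) ^ (a - 1) ≠ 0 := by positivity
  field_simp

theorem exists_multichoose_le_rpow {a : ℝ} (ha : 0 < a) :
    ∃ M : ℝ, 0 ≤ M ∧ ∀ n : ℕ, n ≠ 0 → Ring.multichoose a n ≤ M * (n : ℝ) ^ (a - 1) := by
  obtain ⟨M, hM⟩ := (tendsto_multichoose_mul_rpow ha).bddAbove_range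
  have h : ∀ n : ℕ, Ring.multichoose a n * (n : ℝ) ^ (1 - a) ≤ M := fun n => hM ⟨n, rfl⟩
  refine ⟨M, le_trans ?_ (h 1), fun n hn => ?_⟩
  · have := multichoose_nonneg ha.le 1
    positivity
  · have hn' : (0 : ℝ) < n := by positivity
    have := h n
    rwa [show 1 - a = -(a - 1) by ring, Real.rpow_neg hn'.le, ← div_eq_mul_inv,
      div_le_iff₀ (by positivity)] at this

/-! ### Bounds uniform in the order of the binomial coefficient -/

theorem multichoose_mono {a : ℝ} (ha : 1 ≤ a) : Monotone (Ring.multichoose a) := by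
  refine monotone_nat_of_le_succ fun n => ?_
  rw [multichoose_succ_eq]
  refine le_mul_of_one_le_right (multichoose_nonneg (by linarith) n) ?_
  rw [one_le_div (by positivity)]
  linarith

theorem hasSum_multichoose_mul_pow {a r : ℝ} (hr : 0 ≤ r) (hr1 : r < 1) :
    HasSum (fun n => Ring.multichoose a n * r ^ n) (((1 - r) ^ a)⁻¹) := by
  have h := (Real.one_div_one_sub_rpow_hasFPowerSeriesOnBall_zero a).hasSum (y := r) (by
    simp [abs_of_nonneg hr, hr1, enorm_eq_nnnorm, ← NNReal.coe_lt_one])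
  simp only [FormalMultilinearSeries.ofScalars_apply_eq, zero_add, one_div, smul_eq_mul] at h
  refine h.congr_fun fun n => ?_
  rw [Ring.multichoose_eq]

/-- By monotonicity in `n`, each of the `N` terms of the binomial series with `N ≤ n < 2 N` is at
least the term on the left. The factor `N` gained over a one-term estimate later compensates the
division by `h`. -/
theorem mul_multichoose_mul_pow_le {a r : ℝ} (ha : 1 ≤ a) (hr : 0 ≤ r) (hr1 : r < 1) (N : ℕ) :
    N * Ring.multichoose a N * r ^ (2 * N) ≤ ((1 - r) ^ a)⁻¹ := by
  have h := hasSum_multichoose_mul_pow (a := a) hr hr1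
  have h0 : ∀ n, 0 ≤ Ring.multichoose a n := multichoose_nonneg (by linarith)
  refine le_trans ?_ (sum_le_hasSum (Finset.Ico N (2 * N))
    (fun n _ => mul_nonneg (h0 n) (by positivity)) h)
  have : (N : ℝ) * Ring.multichoose a N * r ^ (2 * N) =
      ∑ _n ∈ Finset.Ico N (2 * N), Ring.multichoose a N * r ^ (2 * N) := by
    rw [Finset.sum_const, Nat.card_Ico, nsmul_eq_mul, show 2 * N - N = N by omega]
    ring
  rw [this]
  refine Finset.sum_le_sum fun n hn => ?_
  rw [Finset.mem_Ico] at hn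
  exact mul_le_mul (multichoose_mono ha hn.1) (pow_le_pow_of_le_one hr hr1.le hn.2.le)
    (by positivity) (h0 n)

theorem inv_one_sub_pow_le_exp {y : ℝ} (hy : 0 ≤ y) (hy2 : y ≤ 1 / 2) (n : ℕ) :
    ((1 - y) ^ n)⁻¹ ≤ Real.exp (2 * y * n) := by
  have h1 : (1 - y)⁻¹ ≤ Real.exp (2 * y) := by
    refine le_trans ?_ (Real.add_one_le_exp _)
    rw [inv_le_iff_one_le_mul₀ (by linarith)]
    nlinarith
  rw [← inv_pow, mul_comm (2 * y), Real.exp_nat_mul]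
  exact pow_le_pow_left₀ (inv_nonneg.2 (by linarith)) h1 n

theorem multichoose_lattice_bound_of_one_le {α l R ρ : ℝ} (hα : 0 < α) (hα1 : α ≤ 1)
    (hl : 0 < l) (hR : 0 < R) (hρ : 0 < ρ) :
    ∃ C : ℝ, 0 ≤ C ∧ ∀ᶠ h : ℝ in 𝓝[>] 0, ∀ n : ℕ, n ≠ 0 → n * h ≤ R → ∀ s : ℕ, 1 ≤ α * s →
      (l * h ^ α) ^ s * Ring.multichoose (α * s) n / h ≤ C * ρ ^ s * (n * h) ^ (α - 1) := by
  -- With `r = 1 - c h` the generating function contributes `(c h)^(-α s)`, and this `c` makes its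
  -- product with `(l h^α)^s` equal to `ρ ^ s`.
  set c : ℝ := (l / ρ) ^ α⁻¹ with hc
  have hc0 : 0 < c := by positivity
  have hcα : c ^ α = l / ρ := by
    rw [hc, ← Real.rpow_mul (by positivity), inv_mul_cancel₀ hα.ne', Real.rpow_one]
  refine ⟨R⁻¹ * Real.exp (4 * c * (R + 1)) * R ^ (1 - α), by positivity, ?_⟩
  filter_upwards [Ioo_mem_nhdsGT (show (0 : ℝ) < min (1 / (2 * c)) 1 by positivity)]
    with h hh n hn hnR s hs
  have hh0 : 0 < h := hh.1
  have hh1 : h ≤ 1 := (hh.2.trans_le (min_le_right _ _)).le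
  have hch : c * h ≤ 1 / 2 := by
    have := (hh.2.trans_le (min_le_left _ _)).le
    rw [le_div_iff₀ (by positivity)] at this
    linarith
  have hn0 : (0 : ℝ) < n := by positivity
  -- The one index `N` serves all `n ≤ N`. As `N * h` lies between `R` and `R + 1`, `r^(-2 N)` stays
  -- bounded and `1 / (N h) ≤ 1 / R`.
  set N := ⌈R / h⌉₊ with hN
  have hNR : R ≤ N * h := by
    rw [← div_le_iff₀ hh0]; exact Nat.le_ceil _
  have hNR1 : N * h ≤ R + 1 := by
    have := (Nat.ceil_lt_add_one (show 0 ≤ R / h by positivity)).le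
    have h2 := mul_le_mul_of_nonneg_right this hh0.le
    rw [add_mul, div_mul_cancel₀ _ hh0.ne', one_mul] at h2
    linarith
  have hN0 : (0 : ℝ) < N := by
    by_contra hcon
    have : (N : ℝ) * h ≤ 0 := mul_nonpos_of_nonpos_of_nonneg (not_lt.1 hcon) hh0.le
    linarith
  have hnN : n ≤ N := by
    have : (n : ℝ) * h ≤ N * h := hnR.trans hNR
    exact_mod_cast le_of_mul_le_mul_right this hh0
  have hch0 : 0 < c * h := by positivity
  have h1 := mul_multichoose_mul_pow_le hs (r := 1 - c * h) (by linarith) (by linarith) N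
  rw [sub_sub_cancel] at h1
  have h2 : Ring.multichoose (α * s) n ≤
      (N : ℝ)⁻¹ * ((1 - c * h) ^ (2 * N))⁻¹ * ((c * h) ^ (α * s))⁻¹ := by
    refine (multichoose_mono hs hnN).trans ?_
    have hr : 0 < (1 - c * h) ^ (2 * N) := pow_pos (by linarith) _
    have h3 := mul_le_mul_of_nonneg_left h1
      (show 0 ≤ (N : ℝ)⁻¹ * ((1 - c * h) ^ (2 * N))⁻¹ by positivity)
    refine le_trans (le_of_eq ?_) h3
    field_simp
  have h3 : ((1 - c * h) ^ (2 * N))⁻¹ ≤ Real.exp (4 * c * (R + 1)) := by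
    refine (inv_one_sub_pow_le_exp hch0.le hch _).trans (Real.exp_le_exp.2 ?_)
    push_cast
    have := mul_le_mul_of_nonneg_left hNR1 (show 0 ≤ 4 * c by positivity)
    linarith
  -- The bound so far is free of `n`; this factor brings it to the shape that the small orders
  -- require.
  have h4 : (1 : ℝ) ≤ R ^ (1 - α) * (n * h) ^ (α - 1) := by
    have h5 : (n * h) ^ (1 - α) ≤ R ^ (1 - α) :=
      Real.rpow_le_rpow (by positivity) hnR (by linarith)
    rw [show α - 1 = -(1 - α) by ring, Real.rpow_neg (by positivity), ← div_eq_mul_inv,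
      one_le_div (by positivity)]
    exact h5
  have h6 : (l * h ^ α) ^ s * ((c * h) ^ (α * s))⁻¹ = ρ ^ s := by
    rw [Real.rpow_mul hch0.le, Real.rpow_natCast, Real.mul_rpow hc0.le hh0.le, hcα,
      ← inv_pow, ← mul_pow]
    congr 1
    have : h ^ α ≠ 0 := by positivity
    field_simp
  have h7 : (N : ℝ)⁻¹ / h ≤ R⁻¹ := by
    rw [div_eq_mul_inv, ← mul_inv]
    exact inv_anti₀ hR hNR
  calc (l * h ^ α) ^ s * Ring.multichoose (α * s) n / h
      ≤ (l * h ^ α) ^ s * ((N : ℝ)⁻¹ * ((1 - c * h) ^ (2 * N))⁻¹ * ((c * h) ^ (α * s))⁻¹) / h := by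
        gcongr
    _ = ((N : ℝ)⁻¹ / h) * ((1 - c * h) ^ (2 * N))⁻¹ * ρ ^ s := by rw [← h6]; ring
    _ ≤ R⁻¹ * Real.exp (4 * c * (R + 1)) * ρ ^ s := by
        have : 0 ≤ ((1 - c * h) ^ (2 * N))⁻¹ := inv_nonneg.2 (pow_nonneg (by linarith) _)
        gcongr
    _ ≤ R⁻¹ * Real.exp (4 * c * (R + 1)) * ρ ^ s * (R ^ (1 - α) * (n * h) ^ (α - 1)) :=
        le_mul_of_one_le_right (by positivity) h4
    _ = _ := by ring

/-- Only the finitely many `s` with `α s < 1` remain, and for them the asymptotic bound with a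
constant depending on `s` is enough. -/
theorem multichoose_lattice_bound {α l R ρ : ℝ} (hα : 0 < α) (hα1 : α ≤ 1)
    (hl : 0 < l) (hR : 0 < R) (hρ : 0 < ρ) :
    ∃ C : ℝ, 0 ≤ C ∧ ∀ᶠ h : ℝ in 𝓝[>] 0, ∀ n : ℕ, n ≠ 0 → n * h ≤ R → ∀ s : ℕ, s ≠ 0 →
      (l * h ^ α) ^ s * Ring.multichoose (α * s) n / h ≤ C * ρ ^ s * (n * h) ^ (α - 1) := by
  obtain ⟨C, hC, hev⟩ := multichoose_lattice_bound_of_one_le hα hα1 hl hR hρ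
  have hM : ∀ s : ℕ, ∃ M : ℝ, 0 ≤ M ∧ (s ≠ 0 → ∀ n : ℕ, n ≠ 0 →
      Ring.multichoose (α * s) n ≤ M * (n : ℝ) ^ (α * s - 1)) := by
    intro s
    rcases eq_or_ne s 0 with rfl | hs
    · exact ⟨0, le_rfl, fun h => absurd rfl h⟩
    · obtain ⟨M, hM, h⟩ := exists_multichoose_le_rpow (show 0 < α * s by positivity)
      exact ⟨M, hM, fun _ => h⟩
  choose M hM0 hM using hM
  set c : ℕ → ℝ := fun s => l ^ s * M s * (R ^ α) ^ (s - 1) * (ρ ^ s)⁻¹ with hc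
  have hc0 : ∀ s, 0 ≤ c s := fun s => by have := hM0 s; positivity
  set S := ⌈α⁻¹⌉₊ with hS
  have hCS : 0 ≤ ∑ s ∈ Finset.range S, c s := Finset.sum_nonneg fun s _ => hc0 s
  refine ⟨C + ∑ s ∈ Finset.range S, c s, by positivity, ?_⟩
  filter_upwards [hev, self_mem_nhdsWithin] with h hh hh0 n hn hnR s hs
  have hh0 : 0 < h := hh0
  have hn0 : (0 : ℝ) < n := by positivity
  have hnh : (0 : ℝ) < n * h := by positivity
  rcases le_or_gt 1 (α * s) with h1 | h1
  · refine (hh n hn hnR s h1).trans ?_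
    gcongr
    linarith
  · have hsS : s ∈ Finset.range S := by
      rw [Finset.mem_range, hS, Nat.lt_ceil, ← one_div, lt_div_iff₀ hα]
      linarith
    have hle : c s ≤ C + ∑ s ∈ Finset.range S, c s :=
      (Finset.single_le_sum (fun s _ => hc0 s) hsS).trans (by linarith)
    have e1 : (n * h) ^ (α * s - 1) = (n * h) ^ (α - 1) * ((n * h) ^ α) ^ (s - 1) := by
      rw [← Real.rpow_natCast, ← Real.rpow_mul hnh.le, ← Real.rpow_add hnh, Nat.cast_sub
        (Nat.one_le_iff_ne_zero.2 hs)]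
      congr 1
      push_cast
      ring
    calc (l * h ^ α) ^ s * Ring.multichoose (α * s) n / h
        ≤ (l * h ^ α) ^ s * (M s * (n : ℝ) ^ (α * s - 1)) / h := by
          have := hM s hs n hn
          gcongr
      _ = l ^ s * M s * (n * h) ^ (α * s - 1) := by
          rw [Real.mul_rpow hn0.le hh0.le, Real.rpow_sub_one hh0.ne', Real.rpow_mul hh0.le,
            Real.rpow_natCast, mul_pow]
          ring
      _ = l ^ s * M s * ((n * h) ^ (α - 1) * ((n * h) ^ α) ^ (s - 1)) := by rw [e1]
      _ ≤ l ^ s * M s * ((n * h) ^ (α - 1) * (R ^ α) ^ (s - 1)) := by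
          have := hM0 s
          gcongr
      _ = c s * ρ ^ s * (n * h) ^ (α - 1) := by
          simp only [hc]
          have : ρ ^ s ≠ 0 := by positivity
          field_simp
      _ ≤ _ := by gcongr

/-! ### Pointwise limits and uniform bounds of the lattice densities -/

theorem tendsto_mul_rpow_nhdsGT {α : ℝ} (l : ℝ) (hα : 0 < α) :
    Tendsto (fun h : ℝ => l * h ^ α) (𝓝[>] 0) (𝓝 0) := by
  have := (Real.continuous_rpow_const hα.le).tendsto 0
  rw [Real.zero_rpow hα.ne'] at this
  simpa using (tendsto_nhdsWithin_of_tendsto_nhds this).const_mul l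

theorem eventually_mul_rpow_lt {α l ε : ℝ} (hα : 0 < α) (hε : 0 < ε) :
    ∀ᶠ h : ℝ in 𝓝[>] 0, l * h ^ α < ε :=
  (tendsto_mul_rpow_nhdsGT l hα).eventually_lt_const hε

theorem coeff_discreteLaplacian_pow_of_ne_zero {a l : ℝ} (ha : 0 ≤ a) (ha1 : a ≤ 1) (hl : 0 < l)
    (hl4 : l < 1 / 4) (m : ℕ) {n : ℕ} (hn : n ≠ 0) :
    PowerSeries.coeff n (discreteLaplacian a l ^ m) = (l + 1) ^ m *
      ∑' s : ℕ, Ring.multichoose (m : ℝ) (s + 1) * (-l) ^ (s + 1) *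
        Ring.multichoose (a * (s + 1 : ℕ)) n := by
  obtain ⟨k, rfl⟩ := Nat.exists_eq_succ_of_ne_zero hn
  exact coeff_succ_discreteLaplacian_pow ha ha1 hl hl4 m k

/-- The choice `ρ = 1 / 4` leaves a geometric series of ratio `1 / 2` after `2 ^ (m + s + 1)` is
spent on `multichoose m (s + 1)`. -/
theorem multichoose_term_bound {α l R : ℝ} (hα : 0 < α) (hα1 : α ≤ 1) (hl : 0 < l) (hR : 0 < R) :
    ∃ C : ℝ, 0 ≤ C ∧ ∀ᶠ h : ℝ in 𝓝[>] 0, ∀ n : ℕ, n ≠ 0 → n * h ≤ R → ∀ m s : ℕ,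
      ‖Ring.multichoose (m : ℝ) (s + 1) * (-(l * h ^ α)) ^ (s + 1) *
        Ring.multichoose (α * (s + 1 : ℕ)) n / h‖ ≤
      2 ^ m * C * (n * h) ^ (α - 1) * ((1 / 2) * (1 / 2) ^ s) := by
  obtain ⟨C, hC, hev⟩ := multichoose_lattice_bound hα hα1 hl hR (show (0 : ℝ) < 1 / 4 by norm_num)
  refine ⟨C, hC, ?_⟩
  filter_upwards [hev, self_mem_nhdsWithin] with h hh hh0 n hn hnR m s
  have hh0 : 0 < h := hh0
  have h1 := hh n hn hnR (s + 1) (Nat.succ_ne_zero s)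
  have h2 := multichoose_natCast_le m (s + 1)
  have h3 := multichoose_nonneg (Nat.cast_nonneg (α := ℝ) m) (s + 1)
  have h4 := multichoose_nonneg (show 0 ≤ α * (s + 1 : ℕ) by positivity) n
  rw [mul_assoc, mul_div_assoc, norm_mul, Real.norm_of_nonneg h3, norm_div, norm_mul, norm_pow,
    norm_neg, Real.norm_of_nonneg h4, Real.norm_of_nonneg (show 0 ≤ l * h ^ α by positivity),
    Real.norm_of_nonneg hh0.le]
  calc _ ≤ 2 ^ (m + (s + 1)) * (C * (1 / 4) ^ (s + 1) * (n * h) ^ (α - 1)) := by gcongr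
    _ = _ := by
      rw [pow_add, ← pow_succ', show (1 / 4 : ℝ) = (1 / 2) * (1 / 2) by norm_num, mul_pow]
      have : (2 : ℝ) ^ (s + 1) * (1 / 2) ^ (s + 1) = 1 := by rw [← mul_pow]; norm_num
      linear_combination (2 : ℝ) ^ m * C * (1 / 2) ^ (s + 1) * (n * h) ^ (α - 1) * this

theorem hasSum_half_mul_geometric : HasSum (fun s : ℕ => (1 / 2 : ℝ) * (1 / 2) ^ s) 1 := by
  have := hasSum_geometric_two.mul_left (1 / 2 : ℝ)
  norm_num at this ⊢
  exact this

theorem coeff_pow_lattice_bound {α l R : ℝ} (hα : 0 < α) (hα1 : α ≤ 1) (hl : 0 < l)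
    (hR : 0 < R) :
    ∃ C : ℝ, 0 ≤ C ∧ ∀ᶠ h : ℝ in 𝓝[>] 0, ∀ n : ℕ, n ≠ 0 → n * h ≤ R → ∀ m : ℕ,
      |PowerSeries.coeff n (discreteLaplacian α (l * h ^ α) ^ m) / h| ≤
        C * 4 ^ m * (n * h) ^ (α - 1) := by
  obtain ⟨C, hC, hev⟩ := multichoose_term_bound hα hα1 hl hR
  refine ⟨C, hC, ?_⟩
  filter_upwards [hev, self_mem_nhdsWithin,
    eventually_mul_rpow_lt (l := l) hα (show (0 : ℝ) < 1 / 4 by norm_num)] with h hh hh0 h4 n hn hnR m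
  have hh0 : 0 < h := hh0
  have hlam : 0 < l * h ^ α := by positivity
  rw [coeff_discreteLaplacian_pow_of_ne_zero hα.le hα1 hlam h4 m hn, mul_div_assoc, ← tsum_div_const,
    abs_mul, abs_of_nonneg (by positivity)]
  have h5 := tsum_of_norm_bounded (hasSum_half_mul_geometric.mul_left
    (2 ^ m * C * (n * h) ^ (α - 1))) (hh n hn hnR m)
  rw [Real.norm_eq_abs, mul_one] at h5
  have h6 : (l * h ^ α + 1) ^ m ≤ 2 ^ m := pow_le_pow_left₀ (by positivity) (by linarith) m
  calc _ ≤ (2 : ℝ) ^ m * (2 ^ m * C * (n * h) ^ (α - 1)) := by gcongr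
    _ = _ := by rw [show (4 : ℝ) = 2 * 2 by norm_num, mul_pow]; ring

theorem prabhakarKernelReg_eq {a z x : ℝ} (m : ℕ) (hx : 0 < x) :
    prabhakarKernelReg a m z x =
      fracSeries a a (fun s => Ring.multichoose (m : ℝ) (s + 1) * z ^ (s + 1)) x := by
  rw [prabhakarKernelReg, if_pos hx, fracSeries]
  refine tsum_congr fun s => ?_
  rw [multichoose_eq_div, show a * ((s : ℝ) + 1) = a * s + a by ring]

/-- Dominated convergence in `s`: the powers of `h` combine to `h^(α (s + 1) - 1)`, exactly the
scaling of `multichoose (α (s + 1)) ⌊x / h⌋`. -/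
theorem tendsto_coeff_pow_lattice {α l x : ℝ} (hα : 0 < α) (hα1 : α ≤ 1) (hl : 0 < l)
    (hx : 0 < x) (m : ℕ) :
    Tendsto (fun h : ℝ =>
        PowerSeries.coeff ⌊x / h⌋₊ (discreteLaplacian α (l * h ^ α) ^ m) / h)
      (𝓝[>] 0) (𝓝 (prabhakarKernelReg α m (-l) x)) := by
  have hR : 0 < x + 1 := by linarith
  obtain ⟨C, hC, hev⟩ := multichoose_term_bound hα hα1 hl hR
  have hy := tendsto_floor_div_mul hx
  have hB : ∀ᶠ h : ℝ in 𝓝[>] 0, ((⌊x / h⌋₊ : ℝ) * h) ^ (α - 1) < x ^ (α - 1) + 1 :=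
    (hy.rpow_const (Or.inl hx.ne')).eventually_lt_const (by linarith)
  have hlim : Tendsto (fun h : ℝ => ∑' s : ℕ,
      Ring.multichoose (m : ℝ) (s + 1) * (-(l * h ^ α)) ^ (s + 1) *
        Ring.multichoose (α * (s + 1 : ℕ)) ⌊x / h⌋₊ / h) (𝓝[>] 0)
      (𝓝 (prabhakarKernelReg α m (-l) x)) := by
    rw [prabhakarKernelReg_eq m hx, fracSeries]
    refine tendsto_tsum_of_dominated_convergence
      (bound := fun s => 2 ^ m * C * (x ^ (α - 1) + 1) * ((1 / 2) * (1 / 2) ^ s))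
      (hasSum_half_mul_geometric.mul_left _).summable (fun s => ?_) ?_
    · have h1 := tendsto_rpow_mul_multichoose_floor
        (show 0 < α * (s + 1 : ℕ) by positivity) hx
      have h2 := h1.const_mul (Ring.multichoose (m : ℝ) (s + 1) * (-l) ^ (s + 1))
      push_cast at h2
      rw [show α * ((s : ℝ) + 1) = α * s + α by ring] at h2
      refine h2.congr' ?_
      filter_upwards [self_mem_nhdsWithin] with h hh
      have hh : 0 < h := hh
      rw [show α * ((s + 1 : ℕ) : ℝ) = α * s + α by push_cast; ring, Real.rpow_sub_one hh.ne',
        show α * (s : ℝ) + α = α * (s + 1 : ℕ) by push_cast; ring, Real.rpow_mul hh.le,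
        Real.rpow_natCast, ← neg_mul, mul_pow]
      ring
    · filter_upwards [hev, hB, hy.eventually_lt_const (show x < x + 1 by linarith),
        (tendsto_floor_div_atTop hx).eventually_gt_atTop 0] with h hh hBh hxh hn s
      refine (hh _ hn.ne' hxh.le m s).trans ?_
      gcongr
  have h1 : Tendsto (fun h : ℝ => (l * h ^ α + 1) ^ m) (𝓝[>] 0) (𝓝 1) := by
    simpa using ((tendsto_mul_rpow_nhdsGT l hα).add_const 1).pow m
  have h2 := h1.mul hlim
  rw [one_mul] at h2
  refine h2.congr' ?_
  filter_upwards [self_mem_nhdsWithin, (tendsto_floor_div_atTop hx).eventually_gt_atTop 0,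
    eventually_mul_rpow_lt (l := l) hα (show (0 : ℝ) < 1 / 4 by norm_num)] with h hh0 hn h4
  have hh0 : 0 < h := hh0
  rw [coeff_discreteLaplacian_pow_of_ne_zero hα.le hα1 (by positivity) h4 m hn.ne', mul_div_assoc,
    ← tsum_div_const]

/-- The lattice bound passes to the limit, so the kernels inherit the growth `4 ^ m` together with
the singularity `x^(α - 1)`. -/
theorem abs_prabhakarKernelReg_le {α l R : ℝ} (hα : 0 < α) (hα1 : α ≤ 1) (hl : 0 < l)
    (hR : 0 < R) :
    ∃ C : ℝ, 0 ≤ C ∧ ∀ x : ℝ, 0 < x → x ≤ R → ∀ m : ℕ,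
      |prabhakarKernelReg α m (-l) x| ≤ C * 4 ^ m * x ^ (α - 1) := by
  obtain ⟨C, hC, hev⟩ := coeff_pow_lattice_bound hα hα1 hl hR
  refine ⟨C, hC, fun x hx hxR m => ?_⟩
  refine le_of_tendsto_of_tendsto (tendsto_coeff_pow_lattice hα hα1 hl hx m).abs
    (((tendsto_floor_div_mul hx).rpow_const (Or.inl hx.ne')).const_mul (C * 4 ^ m)) ?_
  filter_upwards [hev, self_mem_nhdsWithin,
    (tendsto_floor_div_atTop hx).eventually_gt_atTop 0] with h hh hh0 hn
  have hh0 : 0 < h := hh0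
  refine hh _ hn.ne' ?_ m
  refine le_trans ?_ hxR
  rw [← le_div_iff₀ hh0]
  exact Nat.floor_le (by positivity)

theorem abs_mlCoeff_mul_four_pow_summable {b ξ t : ℝ} (hb : 0 < b) (ht : 0 ≤ t) :
    Summable fun m => |mlCoeff b ξ t m| * 4 ^ m := by
  refine (abs_mlCoeff_mul_summable (ξ := ξ) hb ht (expBdd_pow 4)).congr fun m => ?_
  rw [norm_mul, Real.norm_eq_abs, Real.norm_of_nonneg (by positivity)]

theorem stateProb_eq_tsum (a b l ξ t : ℝ) (n : ℕ) : stateProb a b l ξ n t =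
    ∑' m, mlCoeff b ξ t m * PowerSeries.coeff n (discreteLaplacian a l ^ m) := rfl

theorem stateDensityReg_eq_tsum (a b l ξ t x : ℝ) : stateDensityReg a b l ξ t x =
    ∑' m : ℕ, mlCoeff b ξ t m * prabhakarKernelReg a m (-l) x := rfl

theorem stateProb_lattice_bound {α β l ξ t R : ℝ} (hα : 0 < α) (hα1 : α ≤ 1) (hβ : 0 < β)
    (hl : 0 < l) (ht : 0 ≤ t) (hR : 0 < R) :
    ∃ C : ℝ, 0 ≤ C ∧ ∀ᶠ h : ℝ in 𝓝[>] 0, ∀ n : ℕ, n ≠ 0 → n * h ≤ R →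
      |stateProb α β (l * h ^ α) ξ n t / h| ≤ C * (n * h) ^ (α - 1) := by
  obtain ⟨C, hC, hev⟩ := coeff_pow_lattice_bound hα hα1 hl hR
  have hs := abs_mlCoeff_mul_four_pow_summable (ξ := ξ) hβ ht
  refine ⟨(∑' m, |mlCoeff β ξ t m| * 4 ^ m) * C, mul_nonneg (tsum_nonneg fun m => by positivity) hC,
    ?_⟩
  filter_upwards [hev, self_mem_nhdsWithin] with h hh hh0 n hn hnR
  have hh0 : 0 < h := hh0
  rw [stateProb_eq_tsum, ← tsum_div_const, ← Real.norm_eq_abs, mul_assoc]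
  refine tsum_of_norm_bounded (hs.hasSum.mul_right _) fun m => ?_
  rw [mul_div_assoc, norm_mul, Real.norm_eq_abs, Real.norm_eq_abs, mul_assoc]
  refine mul_le_mul_of_nonneg_left ((hh n hn hnR m).trans (le_of_eq (by ring))) (abs_nonneg _)

theorem tendsto_stateProb_lattice {α β l ξ t x : ℝ} (hα : 0 < α) (hα1 : α ≤ 1) (hβ : 0 < β)
    (hl : 0 < l) (ht : 0 ≤ t) (hx : 0 < x) :
    Tendsto (fun h : ℝ => stateProb α β (l * h ^ α) ξ ⌊x / h⌋₊ t / h)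
      (𝓝[>] 0) (𝓝 (stateDensityReg α β l ξ t x)) := by
  have hR : 0 < x + 1 := by linarith
  obtain ⟨C, hC, hev⟩ := coeff_pow_lattice_bound hα hα1 hl hR
  have hy := tendsto_floor_div_mul hx
  have hB : ∀ᶠ h : ℝ in 𝓝[>] 0, ((⌊x / h⌋₊ : ℝ) * h) ^ (α - 1) < x ^ (α - 1) + 1 :=
    (hy.rpow_const (Or.inl hx.ne')).eventually_lt_const (by linarith)
  simp only [stateProb_eq_tsum, ← tsum_div_const, stateDensityReg_eq_tsum]
  refine tendsto_tsum_of_dominated_convergence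
    (bound := fun m => |mlCoeff β ξ t m| * 4 ^ m * (C * (x ^ (α - 1) + 1)))
    ((abs_mlCoeff_mul_four_pow_summable hβ ht).mul_right _) (fun m => ?_) ?_
  · simp only [mul_div_assoc]
    exact (tendsto_coeff_pow_lattice hα hα1 hl hx m).const_mul _
  · filter_upwards [hev, hB, hy.eventually_lt_const (show x < x + 1 by linarith),
      (tendsto_floor_div_atTop hx).eventually_gt_atTop 0] with h hh hBh hxh hn m
    rw [mul_div_assoc, norm_mul, Real.norm_eq_abs, Real.norm_eq_abs, mul_assoc]
    refine mul_le_mul_of_nonneg_left ((hh _ hn.ne' hxh.le m).trans ?_) (abs_nonneg _)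
    calc C * 4 ^ m * ((⌊x / h⌋₊ : ℝ) * h) ^ (α - 1) ≤ C * 4 ^ m * (x ^ (α - 1) + 1) := by gcongr
      _ = _ := by ring

theorem stateProb_zero_eq {α β l ξ t : ℝ} (hl : 0 < l) :
    stateProb α β l ξ 0 t = mittagLeffler β (-ξ * t ^ β) := by
  rw [stateProb_eq_tsum, mittagLeffler_eq_tsum_mlCoeff]
  simp only [coeff_zero_discreteLaplacian_pow hl]

theorem mlDensity_eq {a l x : ℝ} (hx : 0 < x) :
    mlDensity a l x = fracSeries a a (fun s => -(-l) ^ (s + 1)) x := by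
  rw [fracSeries_eq_rpow_mul hx, mlDensity, if_pos hx, mittagLefflerGen, mul_comm l, mul_assoc,
    ← tsum_mul_left]
  congr 1
  refine tsum_congr fun s => ?_
  rw [mul_pow, pow_succ]
  ring

/-- Makes the Laplacian density the case `m = 1` of all statements on Prabhakar kernels. -/
theorem prabhakarKernelReg_one {a l x : ℝ} : prabhakarKernelReg a (1 : ℕ) (-l) x =
    -mlDensity a l x := by
  rcases lt_or_ge 0 x with hx | hx
  · rw [prabhakarKernelReg_eq 1 hx, mlDensity_eq hx, fracSeries, fracSeries, ← tsum_neg]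
    refine tsum_congr fun s => ?_
    simp
  · simp [prabhakarKernelReg, mlDensity, not_lt.2 hx]

/-- A limit of nonnegative jump densities, which avoids complete monotonicity of the Mittag-Leffler
function. -/
theorem mlDensity_nonneg {α l x : ℝ} (hα : 0 < α) (hα1 : α ≤ 1) (hl : 0 < l) :
    0 ≤ mlDensity α l x := by
  rcases lt_or_ge 0 x with hx | hx
  · have h := tendsto_coeff_pow_lattice hα hα1 hl hx 1
    rw [prabhakarKernelReg_one] at h
    refine neg_nonpos.1 (le_of_tendsto h ?_)
    filter_upwards [self_mem_nhdsWithin,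
      (tendsto_floor_div_atTop hx).eventually_gt_atTop 0] with h hh0 hn
    have hh0 : 0 < h := hh0
    obtain ⟨k, hk⟩ := Nat.exists_eq_succ_of_ne_zero hn.ne'
    rw [hk, pow_one]
    exact div_nonpos_of_nonpos_of_nonneg
      (coeff_succ_discreteLaplacian_nonpos hα.le hα1 (by positivity) k) hh0.le
  · simp [mlDensity, not_lt.2 hx]

/-! ### Causal locally integrable functions as distributions -/

/-- A locally integrable function vanishing on the negative half-line. -/
structure CausalLocInt (f : ℝ → ℝ) : Prop where
  locallyIntegrable : LocallyIntegrable f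
  eq_zero : ∀ x < 0, f x = 0

theorem RealTest.exists_bound (φ : RealTest) : ∃ R : ℝ, 0 < R ∧ ∀ x : ℝ, R ≤ |x| → φ x = 0 :=
  φ.hasCompactSupport.exists_pos_le_norm

theorem ofFun_apply {f : ℝ → ℝ} (hf : LocallyIntegrable f) (φ : RealTest) :
    ofFun f φ = ∫ x, φ x * f x :=
  TestFunction.integralAgainstBilinCLM_eq_integral (hf.locallyIntegrableOn _)

theorem integrable_test_mul {f : ℝ → ℝ} (hf : LocallyIntegrable f) (φ : RealTest) :
    Integrable (fun x => φ x * f x) :=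
  φ.integrable_bilin (ContinuousLinearMap.mul ℝ ℝ) (hf.locallyIntegrableOn _)

theorem CausalLocInt.of_bound {f : ℝ → ℝ} {e : ℝ} (he : -1 < e) (h0 : ∀ x < 0, f x = 0)
    (hc : ContinuousOn f (Ioi 0))
    (hb : ∀ R : ℝ, 0 < R → ∃ M : ℝ, ∀ x : ℝ, 0 < x → x ≤ R → |f x| ≤ M * x ^ e) :
    CausalLocInt f := by
  refine ⟨locallyIntegrable_iff.2 fun K hK => ?_, h0⟩
  obtain ⟨R, hR, hKR⟩ := hK.isBounded.subset_closedBall_lt 0 0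
  obtain ⟨M, hM⟩ := hb R hR
  have h1 : IntegrableOn f (Iio 0) :=
    (integrableOn_congr_fun (fun x hx => h0 x hx) measurableSet_Iio).2 integrableOn_zero
  have h2 : IntegrableOn f (Ioc 0 R) := by
    have hi := (intervalIntegral.intervalIntegrable_rpow' (a := 0) (b := R) he).const_mul M
    rw [intervalIntegrable_iff_integrableOn_Ioc_of_le hR.le] at hi
    refine Integrable.mono' hi
      ((hc.mono Ioc_subset_Ioi_self).aestronglyMeasurable measurableSet_Ioc) ?_
    exact (ae_restrict_iff' measurableSet_Ioc).2 (Eventually.of_forall fun x hx => hM x hx.1 hx.2)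
  have h3 : IntegrableOn f {(0 : ℝ)} := integrableOn_singleton (hx := by simp)
  refine ((h1.union h3).union h2).mono_set fun x hx => ?_
  have hx2 := hKR hx
  rw [Metric.mem_closedBall, dist_zero_right, Real.norm_eq_abs] at hx2
  rcases lt_trichotomy x 0 with h | h | h
  · exact Or.inl (Or.inl h)
  · exact Or.inl (Or.inr h)
  · exact Or.inr ⟨h, (le_abs_self x).trans hx2⟩

theorem causalLocInt_of_eq_fracSeries {f : ℝ → ℝ} {a b : ℝ} {c : ℕ → ℝ} (ha : 0 < a) (hb : 0 < b)
    (hc : ExpBdd c) (h0 : ∀ x < 0, f x = 0) (hf : ∀ x, 0 < x → f x = fracSeries a b c x) :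
    CausalLocInt f := by
  refine CausalLocInt.of_bound (e := b - 1) (by linarith) h0
    ((continuousOn_fracSeries ha hb hc).congr hf) fun R hR => ?_
  obtain ⟨M, -, hM⟩ := abs_fracSeries_le ha hb hR hc
  exact ⟨M, fun x hx hxR => by rw [hf x hx]; exact hM x hx hxR⟩

theorem expBdd_mlDensity (l : ℝ) : ExpBdd (fun s => -(-l) ^ (s + 1)) := by
  have := (expBdd_pow (-l)).comp_succ.const_mul (-1)
  simpa using this

theorem causalLocInt_mlDensity {a l : ℝ} (ha : 0 < a) : CausalLocInt (mlDensity a l) :=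
  causalLocInt_of_eq_fracSeries ha ha (expBdd_mlDensity l)
    (fun x hx => by simp [mlDensity, not_lt.2 hx.le]) fun x hx => mlDensity_eq hx

theorem mittagLeffler_eq_fracSeries {a l x : ℝ} (hx : 0 ≤ x) :
    mittagLeffler a (-l * x ^ a) = fracSeries a 1 (fun s => (-l) ^ s) x := by
  rw [mittagLeffler_eq_tsum_mlCoeff, tsum_mlCoeff_mul_eq hx]
  simp only [mul_one]

theorem causalLocInt_survivalFun {a l : ℝ} (ha : 0 < a) : CausalLocInt (survivalFun a l) :=
  causalLocInt_of_eq_fracSeries ha one_pos (expBdd_pow (-l))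
    (fun x hx => by simp [survivalFun, not_le.2 hx]) fun x hx => by
      rw [survivalFun, if_pos hx.le, mittagLeffler_eq_fracSeries hx.le]

theorem expBdd_multichoose (m : ℕ) : ExpBdd (fun s => Ring.multichoose (m : ℝ) s) := by
  refine ⟨2 ^ m, 2, by positivity, by norm_num, fun s => ?_⟩
  rw [abs_of_nonneg (multichoose_nonneg (Nat.cast_nonneg m) s), ← pow_add]
  exact multichoose_natCast_le m s

theorem causalLocInt_prabhakarKernelReg {a z : ℝ} (ha : 0 < a) (m : ℕ) :
    CausalLocInt (prabhakarKernelReg a m z) :=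
  causalLocInt_of_eq_fracSeries ha ha ((expBdd_multichoose m).mul (expBdd_pow z)).comp_succ
    (fun x hx => by simp [prabhakarKernelReg, not_lt.2 hx.le])
    fun x hx => prabhakarKernelReg_eq m hx

/-! ### Limits of lattice densities in the sense of distributions -/

/-- The function `Θ(x) x^e`. -/
def powFun (e x : ℝ) : ℝ := if 0 < x then x ^ e else 0

theorem causalLocInt_powFun {e : ℝ} (he : -1 < e) : CausalLocInt (powFun e) := by
  refine CausalLocInt.of_bound he (fun x hx => by simp [powFun, not_lt.2 hx.le]) ?_
    fun R _ => ⟨1, fun x hx _ => ?_⟩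
  · refine ContinuousOn.congr (f := fun x => x ^ e) (fun x hx =>
      (Real.continuousAt_rpow_const _ _ (Or.inl (ne_of_gt hx))).continuousWithinAt) fun x hx => ?_
    exact if_pos hx
  · rw [powFun, if_pos hx, one_mul, abs_of_nonneg (by positivity)]

theorem measurable_latticeDensity (h : ℝ) (c : ℕ → ℝ) : Measurable (latticeDensity h c) := by
  refine Measurable.ite measurableSet_Ici ?_ measurable_const
  exact ((measurable_from_nat (f := c)).comp
    (Nat.measurable_floor.comp (measurable_id.div_const h))).div_const h

theorem tendsto_inv_mul_integral_test (φ : RealTest) :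
    Tendsto (fun h : ℝ => h⁻¹ * ∫ x in (0 : ℝ)..h, φ x) (𝓝[>] 0) (𝓝 (φ 0)) := by
  have h1 := intervalIntegral.integral_hasDerivAt_right (a := 0) (b := 0)
    (φ.continuous.intervalIntegrable 0 0) (φ.continuous.stronglyMeasurableAtFilter _ _)
    φ.continuous.continuousAt
  have h2 := h1.tendsto_slope_zero_right
  simpa using h2

/-- From the second cell on, rounding down to the lattice at most halves `x`, so the lattice bound
is dominated by a fixed locally integrable power. -/
theorem rpow_floor_mul_le {α h x : ℝ} (hα : 0 ≤ α) (hα1 : α ≤ 1) (hh : 0 < h) (hx : h ≤ x) :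
    ((⌊x / h⌋₊ : ℝ) * h) ^ (α - 1) ≤ 2 * x ^ (α - 1) := by
  have hx0 : 0 < x := hh.trans_le hx
  have h1 : 1 ≤ x / h := (one_le_div hh).2 hx
  have hn : (1 : ℝ) ≤ ⌊x / h⌋₊ := by exact_mod_cast (Nat.one_le_floor_iff _).2 h1
  have h2 : x / 2 ≤ (⌊x / h⌋₊ : ℝ) * h := by
    have := (Nat.lt_floor_add_one (x / h)).le
    rw [div_le_iff₀ hh] at this
    nlinarith
  refine (Real.rpow_le_rpow_of_nonpos (by positivity) h2 (by linarith)).trans ?_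
  rw [Real.div_rpow hx0.le (by norm_num), div_eq_mul_inv, mul_comm, ← Real.rpow_neg (by norm_num)]
  gcongr
  calc (2 : ℝ) ^ (-(α - 1)) ≤ 2 ^ (1 : ℝ) :=
        Real.rpow_le_rpow_of_exponent_le (by norm_num) (by linarith)
    _ = 2 := Real.rpow_one 2

/-- The cell `[0, h)` carries mass `A` and averages `φ` near `0`, giving the atom; on `[h, ∞)`
dominated convergence applies. -/
theorem tendsto_integral_latticeDensity {α A : ℝ} {c : ℝ → ℕ → ℝ} {f : ℝ → ℝ} (hα : 0 < α)
    (hα1 : α ≤ 1) (h0 : ∀ᶠ h : ℝ in 𝓝[>] 0, c h 0 = A) (hf0 : ∀ x ≤ 0, f x = 0)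
    (hlim : ∀ x, 0 < x → Tendsto (fun h : ℝ => c h ⌊x / h⌋₊ / h) (𝓝[>] 0) (𝓝 (f x)))
    (hb : ∀ R : ℝ, 0 < R → ∃ C : ℝ, 0 ≤ C ∧ ∀ᶠ h : ℝ in 𝓝[>] 0, ∀ n : ℕ, n ≠ 0 → n * h ≤ R →
      |c h n / h| ≤ C * (n * h) ^ (α - 1)) (φ : RealTest) :
    Tendsto (fun h : ℝ => ∫ x, latticeDensity h (c h) x * φ x) (𝓝[>] 0)
      (𝓝 (A * φ 0 + ∫ x, φ x * f x)) := by
  obtain ⟨R, hR, hφR⟩ := φ.exists_bound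
  obtain ⟨C, hC, hev⟩ := hb R hR
  set F : ℝ → ℝ → ℝ := fun h x => (Ici h).indicator (latticeDensity h (c h)) x * φ x with hF
  have hbound : ∀ᶠ h : ℝ in 𝓝[>] 0, ∀ x, ‖F h x‖ ≤ ‖φ x * (2 * C * powFun (α - 1) x)‖ := by
    filter_upwards [hev, self_mem_nhdsWithin] with h hh hh0 x
    have hh0 : 0 < h := hh0
    by_cases hx : h ≤ x
    · have hx0 : 0 < x := hh0.trans_le hx
      by_cases hxR : R ≤ |x|
      · simp [hF, hφR x hxR]
      · rw [abs_of_pos hx0, not_le] at hxR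
        have h1 : 1 ≤ x / h := (one_le_div hh0).2 hx
        have hn : ⌊x / h⌋₊ ≠ 0 := by
          have := (Nat.one_le_floor_iff _).2 h1
          omega
        have hnR : (⌊x / h⌋₊ : ℝ) * h ≤ R := by
          refine le_trans ?_ hxR.le
          rw [← le_div_iff₀ hh0]
          exact Nat.floor_le (by positivity)
        have h2 := (hh _ hn hnR).trans
          (mul_le_mul_of_nonneg_left (rpow_floor_mul_le hα.le hα1 hh0 hx) hC)
        simp only [hF, indicator_of_mem (mem_Ici.2 hx), latticeDensity, if_pos hx0.le, powFun,
          if_pos hx0]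
        rw [norm_mul, norm_mul, mul_comm, Real.norm_eq_abs (c h _ / h)]
        refine mul_le_mul_of_nonneg_left (h2.trans (le_trans (le_of_eq ?_) (Real.le_norm_self _)))
          (norm_nonneg _)
        ring
    · have : F h x = 0 := by simp [hF, hx]
      rw [this, norm_zero]
      exact norm_nonneg _
  have hFint : ∀ᶠ h : ℝ in 𝓝[>] 0, Integrable (F h) := by
    filter_upwards [hbound] with h hh
    refine Integrable.mono (integrable_test_mul
      ((causalLocInt_powFun (show -1 < α - 1 by linarith)).locallyIntegrable.smul (2 * C)) φ) ?_
      (Eventually.of_forall hh)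
    exact (((measurable_latticeDensity h (c h)).indicator measurableSet_Ici).aestronglyMeasurable).mul
      φ.aestronglyMeasurable
  have hlimF : Tendsto (fun h => ∫ x, F h x) (𝓝[>] 0) (𝓝 (∫ x, φ x * f x)) := by
    refine tendsto_integral_filter_of_dominated_convergence
      (fun x => ‖φ x * (2 * C * powFun (α - 1) x)‖) ?_ ?_ ?_ ?_
    · exact hFint.mono fun h hh => hh.aestronglyMeasurable
    · exact hbound.mono fun h hh => Eventually.of_forall hh
    · exact (integrable_test_mul ((causalLocInt_powFun
        (show -1 < α - 1 by linarith)).locallyIntegrable.smul (2 * C)) φ).norm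
    · refine Eventually.of_forall fun x => ?_
      rcases le_or_gt x 0 with hx | hx
      · rw [hf0 x hx, mul_zero]
        refine tendsto_const_nhds.congr' ?_
        filter_upwards [self_mem_nhdsWithin] with h hh
        have : ¬ h ≤ x := not_le.2 (hx.trans_lt hh)
        simp [hF, this]
      · rw [mul_comm]
        refine ((hlim x hx).mul_const (φ x)).congr' ?_
        filter_upwards [Ioo_mem_nhdsGT hx] with h hh
        simp [hF, hh.2.le, latticeDensity, hx.le]
  have hlim0 := ((tendsto_inv_mul_integral_test φ).const_mul A).add hlimF
  refine hlim0.congr' ?_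
  filter_upwards [hFint, h0, self_mem_nhdsWithin] with h hh hA hh0
  have hh0 : 0 < h := hh0
  have hsplit : ∀ x, latticeDensity h (c h) x * φ x =
      (Ico 0 h).indicator (fun x => A * h⁻¹ * φ x) x + F h x := by
    intro x
    rcases lt_or_ge x 0 with hx | hx
    · have h1 : ¬ h ≤ x := not_le.2 (hx.trans hh0)
      simp [hF, latticeDensity, not_le.2 hx, h1]
    · rcases lt_or_ge x h with hxh | hxh
      · have : ⌊x / h⌋₊ = 0 := Nat.floor_eq_zero.2 ((div_lt_one hh0).2 hxh)
        simp [hF, latticeDensity, hx, hxh, not_le.2 hxh, this, hA]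
        exact Or.inl (div_eq_mul_inv A h)
      · simp [hF, hxh, not_lt.2 hxh]
  simp_rw [hsplit]
  rw [integral_add _ hh, integral_indicator measurableSet_Ico, integral_const_mul,
    intervalIntegral.integral_of_le hh0.le, integral_Ico_eq_integral_Ioc, mul_assoc]
  · refine IntegrableOn.integrable_indicator ?_ measurableSet_Ico
    exact ((φ.continuous.integrableOn_Icc).mono_set Ico_subset_Icc_self).const_mul _

/-! ### Series of Prabhakar kernels -/

theorem prabhakarKernel_apply {a z : ℝ} (ha : 0 < a) (m : ℕ) (φ : RealTest) :
    prabhakarKernel a m z φ = φ 0 + ∫ x, φ x * prabhakarKernelReg a m z x := by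
  rw [← ofFun_apply (causalLocInt_prabhakarKernelReg ha m).locallyIntegrable]
  rfl

theorem exists_integral_norm_prabhakarKernelReg_le {α l : ℝ} (hα : 0 < α) (hα1 : α ≤ 1)
    (hl : 0 < l) (φ : RealTest) :
    ∃ C : ℝ, 0 ≤ C ∧ ∀ m : ℕ, ∫ x, ‖φ x * prabhakarKernelReg α m (-l) x‖ ≤ C * 4 ^ m := by
  obtain ⟨R, hR, hφR⟩ := φ.exists_bound
  obtain ⟨C, hC, hb⟩ := abs_prabhakarKernelReg_le hα hα1 hl hR
  have hp := (causalLocInt_powFun (show -1 < α - 1 by linarith)).locallyIntegrable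
  refine ⟨C * ∫ x, ‖φ x * powFun (α - 1) x‖,
    mul_nonneg hC (integral_nonneg fun _ => norm_nonneg _), fun m => ?_⟩
  rw [mul_right_comm, ← integral_const_mul]
  refine integral_mono_of_nonneg (Eventually.of_forall fun _ => norm_nonneg _)
    ((integrable_test_mul hp φ).norm.const_mul _) (Eventually.of_forall fun x => ?_)
  simp only [norm_mul]
  rcases le_or_gt x 0 with hx | hx
  · simp only [prabhakarKernelReg, if_neg (not_lt.2 hx), norm_zero, mul_zero]
    positivity
  · by_cases hxR : R ≤ |x|
    · simp [hφR x hxR]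
    · rw [abs_of_pos hx, not_le] at hxR
      have := hb x hx hxR.le m
      rw [← mul_assoc, mul_comm _ ‖φ x‖, mul_assoc]
      refine mul_le_mul_of_nonneg_left ?_ (norm_nonneg _)
      rw [powFun, if_pos hx, Real.norm_eq_abs (x ^ (α - 1)), abs_of_nonneg (a := x ^ (α - 1)) (by positivity)]
      exact this

theorem expBdd_prabhakarKernel_apply {α l : ℝ} (hα : 0 < α) (hα1 : α ≤ 1)
    (hl : 0 < l) (φ : RealTest) : ExpBdd fun m => prabhakarKernel α m (-l) φ := by
  obtain ⟨C, hC, h⟩ := exists_integral_norm_prabhakarKernelReg_le hα hα1 hl φ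
  refine ⟨|φ 0| + C, 4, by positivity, by norm_num, fun m => ?_⟩
  simp only [prabhakarKernel_apply hα, add_mul]
  refine (abs_add_le _ _).trans (add_le_add ?_ ?_)
  · exact le_mul_of_one_le_right (abs_nonneg _) (one_le_pow₀ (by norm_num))
  · exact (norm_integral_le_integral_norm _).trans (h m)

/-- Sum and integral are exchanged thanks to the `4 ^ m` bound. The coefficients are kept general so
that the result applies to the shifted sequence too. -/
theorem hasSum_mul_prabhakarKernel_apply {α l : ℝ} (hα : 0 < α) (hα1 : α ≤ 1)
    (hl : 0 < l) {c : ℕ → ℝ} (hc : Summable fun m => |c m| * 4 ^ m) (φ : RealTest) :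
    HasSum (fun m => c m * prabhakarKernel α m (-l) φ)
      ((∑' m, c m) * φ 0 + ∫ x, φ x * ∑' m, c m * prabhakarKernelReg α m (-l) x) := by
  obtain ⟨C, hC, h⟩ := exists_integral_norm_prabhakarKernelReg_le hα hα1 hl φ
  have hc1 : Summable c := by
    refine Summable.of_norm_bounded hc fun m => ?_
    exact le_mul_of_one_le_right (norm_nonneg _) (one_le_pow₀ (by norm_num))
  have h1 := hasSum_integral_of_summable_integral_norm (μ := volume)
    (F := fun (m : ℕ) x => c m * (φ x * prabhakarKernelReg α m (-l) x))
    (fun m => (integrable_test_mul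
      (causalLocInt_prabhakarKernelReg hα m).locallyIntegrable φ).const_mul _) (by
      refine Summable.of_nonneg_of_le (fun m => integral_nonneg fun _ => norm_nonneg _)
        (fun m => ?_) (hc.mul_right C)
      simp only [norm_mul (c m)]
      rw [integral_const_mul, Real.norm_eq_abs (c m), mul_assoc, mul_comm _ C]
      exact mul_le_mul_of_nonneg_left (h m) (abs_nonneg _))
  have h2 := (hc1.hasSum.mul_right (φ 0)).add h1
  simp only [integral_const_mul, ← mul_add, ← prabhakarKernel_apply hα] at h2
  have h3 : ∫ x, ∑' m, c m * (φ x * prabhakarKernelReg α m (-l) x) =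
      ∫ x, φ x * ∑' m, c m * prabhakarKernelReg α m (-l) x := by
    congr 1
    ext x
    rw [← tsum_mul_left]
    exact tsum_congr fun m => by ring
  rwa [h3] at h2

/-! ### Causal convolution -/

/-- The function `y ↦ (c δ + f)_x (φ (x + y))`. -/
def shiftPairing (c : ℝ) (f : ℝ → ℝ) (φ : ℝ → ℝ) (y : ℝ) : ℝ := c * φ y + ∫ x, φ (x + y) * f x

theorem apply_shiftTest {c : ℝ} {f : ℝ → ℝ} (hf : LocallyIntegrable f) (φ : RealTest) (y : ℝ) :
    (c • dirac0 + ofFun f) (shiftTest y φ) = shiftPairing c f φ y := by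
  have h : (c • dirac0 + ofFun f) (shiftTest y φ) =
      c * (shiftTest y φ) 0 + ofFun f (shiftTest y φ) := rfl
  rw [h, ofFun_apply hf, shiftPairing]
  have h2 : ∀ x, (shiftTest y φ) x = φ (x + y) := fun _ => rfl
  simp only [h2, zero_add]

/-- Reflecting `φ` turns the pairing into a convolution, from which its smoothness and derivative
are obtained. -/
theorem integral_shift_eq_convolution (f φ : ℝ → ℝ) (y : ℝ) :
    ∫ x, φ (x + y) * f x =
      (MeasureTheory.convolution f (fun z => φ (-z)) (ContinuousLinearMap.mul ℝ ℝ) volume) (-y) := by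
  rw [MeasureTheory.convolution_def]
  congr 1
  ext x
  rw [ContinuousLinearMap.mul_apply', mul_comm]
  congr 2
  ring

theorem hasCompactSupport_comp_neg {φ : ℝ → ℝ} (hφ : HasCompactSupport φ) :
    HasCompactSupport fun z => φ (-z) :=
  hφ.comp_homeomorph (Homeomorph.neg ℝ)

theorem contDiff_shiftPairing {c : ℝ} {f : ℝ → ℝ} (hf : LocallyIntegrable f) (φ : RealTest) :
    ContDiff ℝ ((⊤ : ℕ∞) : WithTop ℕ∞) (shiftPairing c f φ) := by
  have h1 : ContDiff ℝ ((⊤ : ℕ∞) : WithTop ℕ∞) fun z => φ (-z) := φ.contDiff.comp contDiff_neg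
  have h2 := (hasCompactSupport_comp_neg φ.hasCompactSupport).contDiff_convolution_right
    (ContinuousLinearMap.mul ℝ ℝ) hf h1
  have h3 : shiftPairing c f φ = fun y => c * φ y +
      (MeasureTheory.convolution f (fun z => φ (-z)) (ContinuousLinearMap.mul ℝ ℝ) volume) (-y) := by
    ext y
    rw [shiftPairing, integral_shift_eq_convolution]
  rw [h3]
  exact (contDiff_const.mul φ.contDiff).add (h2.comp contDiff_neg)

theorem lineDeriv_test_apply (φ : RealTest) (x : ℝ) : (∂_{(1 : ℝ)} φ) x = deriv φ x := by
  rw [TestFunction.lineDerivOp_eq_lineDerivCLM ℝ, TestFunction.lineDerivCLM_apply_of_le (by simp)]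
  rw [(φ.contDiff.differentiable (by simp)).differentiableAt.lineDeriv_eq_fderiv,
    fderiv_apply_one_eq_deriv]

theorem hasDerivAt_test (φ : RealTest) (x : ℝ) : HasDerivAt φ ((∂_{(1 : ℝ)} φ) x) x := by
  rw [lineDeriv_test_apply]
  exact (φ.contDiff.differentiable (by simp)).differentiableAt.hasDerivAt

theorem hasDerivAt_shiftPairing {c : ℝ} {f : ℝ → ℝ} (hf : LocallyIntegrable f) (φ : RealTest) (y : ℝ) :
    HasDerivAt (shiftPairing c f φ) (shiftPairing c f (∂_{(1 : ℝ)} φ : RealTest) y) y := by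
  have h1 : ContDiff ℝ ((1 : ℕ∞) : WithTop ℕ∞) fun z => φ (-z) :=
    (φ.contDiff.comp contDiff_neg).of_le (by exact_mod_cast le_top)
  have h2 := (hasCompactSupport_comp_neg φ.hasCompactSupport).hasDerivAt_convolution_right
    (ContinuousLinearMap.mul ℝ ℝ) hf h1 (-y)
  have hd : deriv (fun z => φ (-z)) = fun z => -(∂_{(1 : ℝ)} φ : RealTest) (-z) := by
    ext z
    have := (hasDerivAt_test φ (-z)).comp z (hasDerivAt_neg z)
    rw [mul_neg_one] at this
    exact this.deriv
  have h3 : shiftPairing c f φ = fun y => c * φ y +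
      (MeasureTheory.convolution f (fun z => φ (-z)) (ContinuousLinearMap.mul ℝ ℝ) volume) (-y) := by
    ext y
    rw [shiftPairing, integral_shift_eq_convolution]
  rw [h3, shiftPairing]
  refine ((hasDerivAt_test φ y).const_mul c).add ?_
  have h4 := h2.comp y (hasDerivAt_neg y)
  have h5 : ∫ x, (∂_{(1 : ℝ)} φ : RealTest) (x + y) * f x =
      (MeasureTheory.convolution f (deriv fun z => φ (-z)) (ContinuousLinearMap.mul ℝ ℝ)
        volume) (-y) * -1 := by
    rw [integral_shift_eq_convolution, hd, MeasureTheory.convolution_def,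
      MeasureTheory.convolution_def, mul_neg_one, ← integral_neg]
    congr 1
    ext t
    simp
  rw [h5]
  exact h4

theorem exists_test_eq_shiftPairing {c : ℝ} {f : ℝ → ℝ} (hf : CausalLocInt f) (φ : RealTest) :
    ∃ ψ : RealTest, ∀ y > -1, ψ y = shiftPairing c f φ y := by
  obtain ⟨R, hR, hφR⟩ := φ.exists_bound
  have hzero : ∀ y, R ≤ y → shiftPairing c f φ y = 0 := by
    intro y hy
    rw [shiftPairing, hφR y (hy.trans (le_abs_self y)), mul_zero, zero_add]
    refine integral_eq_zero_of_ae (Eventually.of_forall fun x => ?_)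
    rcases lt_or_ge x 0 with hx | hx
    · simp [hf.eq_zero x hx]
    · have : R ≤ |x + y| := by rw [abs_of_nonneg (by linarith)]; linarith
      simp [hφR _ this]
  have hsm : ContDiff ℝ ((⊤ : ℕ∞) : WithTop ℕ∞)
      fun y => Real.smoothTransition (y + 2) * shiftPairing c f φ y :=
    (Real.smoothTransition.contDiff.comp (contDiff_id.add contDiff_const)).mul
      (contDiff_shiftPairing hf.locallyIntegrable φ)
  refine ⟨⟨fun y => Real.smoothTransition (y + 2) * shiftPairing c f φ y, hsm, ?_,
    fun _ _ => trivial⟩, fun y hy => ?_⟩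
  · refine HasCompactSupport.of_support_subset_isCompact (isCompact_Icc (a := -2) (b := R))
      fun y hy => ?_
    rw [Function.mem_support] at hy
    constructor
    · by_contra hcon
      exact hy (by simp [Real.smoothTransition.zero_of_nonpos (show y + 2 ≤ 0 by linarith)])
    · by_contra hcon
      exact hy (by simp [hzero y (by linarith)])
  · change Real.smoothTransition (y + 2) * shiftPairing c f φ y = _
    rw [Real.smoothTransition.one_of_one_le (by linarith), one_mul]

theorem test_apply_zero_of_tsupport_subset {u : RealTest} (hu : tsupport u ⊆ Iio 0) {x : ℝ}
    (hx : 0 ≤ x) : u x = 0 :=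
  image_eq_zero_of_notMem_tsupport fun h => not_lt.2 hx (hu h)

theorem isVanishingOn_atom_add_ofFun {c : ℝ} {f : ℝ → ℝ} (hf : CausalLocInt f) :
    Distribution.IsVanishingOn (c • dirac0 + ofFun f) (Iio (0 : ℝ)) := by
  intro u hu
  have h : (c • dirac0 + ofFun f) u = c * u 0 + ofFun f u := rfl
  rw [h, ofFun_apply hf.locallyIntegrable, test_apply_zero_of_tsupport_subset hu le_rfl, mul_zero,
    zero_add]
  refine integral_eq_zero_of_ae (Eventually.of_forall fun x => ?_)
  rcases lt_or_ge x 0 with hx | hx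
  · simp [hf.eq_zero x hx]
  · simp [test_apply_zero_of_tsupport_subset hu hx]

/-- Asking for the identity for every `ψ` with the right values on `(-1, ∞)` frees later arguments
from the cutoff that was used to construct one. -/
theorem isCausalConv_of_forall {S R : RealDistribution} {c : ℝ} {f : ℝ → ℝ}
    (hS : Distribution.IsVanishingOn S (Iio (0 : ℝ))) (hf : CausalLocInt f)
    (h : ∀ φ ψ : RealTest, (∀ y > -1, ψ y = shiftPairing c f φ y) → R φ = S ψ) :
    IsCausalConv S (c • dirac0 + ofFun f) R := by
  refine ⟨hS, isVanishingOn_atom_add_ofFun hf, fun φ => ?_⟩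
  obtain ⟨ψ, hψ⟩ := exists_test_eq_shiftPairing (c := c) hf φ
  refine ⟨ψ, ⟨1, one_pos, fun y hy => ?_⟩, h φ ψ hψ⟩
  rw [apply_shiftTest hf.locallyIntegrable, hψ y hy]

/-- The convolution of two functions on the line. -/
def convFun (k f : ℝ → ℝ) (x : ℝ) : ℝ := ∫ y, k y * f (x - y)

theorem convFun_eq_integral {k f : ℝ → ℝ} (hk : ∀ x < 0, k x = 0) (hf : ∀ x < 0, f x = 0) {x : ℝ}
    (hx : 0 ≤ x) : convFun k f x = ∫ τ in (0 : ℝ)..x, k (x - τ) * f τ := by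
  rw [convFun, ← integral_sub_left_eq_self _ volume x, intervalIntegral.integral_of_le hx,
    ← integral_Icc_eq_integral_Ioc, ← integral_indicator measurableSet_Icc]
  congr 1
  ext τ
  rw [sub_sub_cancel]
  by_cases hτ : τ ∈ Icc 0 x
  · rw [indicator_of_mem hτ]
  · rw [indicator_of_notMem hτ]
    rcases lt_or_ge τ 0 with h | h
    · rw [hf τ h, mul_zero]
    · rw [hk (x - τ) (by
        by_contra hcon
        exact hτ ⟨h, by linarith⟩), zero_mul]

theorem CausalLocInt.integrable_indicator {k : ℝ → ℝ} (hk : CausalLocInt k) (M : ℝ) :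
    Integrable ((Icc 0 M).indicator k) :=
  (hk.locallyIntegrable.integrableOn_isCompact isCompact_Icc).integrable_indicator measurableSet_Icc

/-- Nonnegative `x`, `y` with sum at most `M` both lie in `[0, M]`. Truncation thus makes causal
functions integrable without changing their convolution up to `M`. -/
theorem mul_indicator_eq {k f : ℝ → ℝ} (hk : CausalLocInt k) (hf : CausalLocInt f) {M x y : ℝ}
    (h : x + y ≤ M) : k y * f x = (Icc 0 M).indicator k y * (Icc 0 M).indicator f x := by
  rcases lt_or_ge y 0 with hy | hy
  · rw [hk.eq_zero y hy, indicator_of_notMem (fun h => not_lt.2 h.1 hy)]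
    simp
  rcases lt_or_ge x 0 with hx | hx
  · rw [hf.eq_zero x hx, indicator_of_notMem (s := Icc 0 M) (a := x) (fun h => not_lt.2 h.1 hx)]
    simp
  · rw [indicator_of_mem (show y ∈ Icc 0 M from ⟨hy, by linarith⟩),
      indicator_of_mem (show x ∈ Icc 0 M from ⟨hx, by linarith⟩)]

theorem convFun_eq_truncated {k f : ℝ → ℝ} (hk : CausalLocInt k) (hf : CausalLocInt f) {M x : ℝ}
    (hx : x ≤ M) : convFun k f x = convFun ((Icc 0 M).indicator k) ((Icc 0 M).indicator f) x := by
  rw [convFun, convFun]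
  congr 1
  ext y
  exact mul_indicator_eq hk hf (by linarith)

theorem causalLocInt_convFun {k f : ℝ → ℝ} (hk : CausalLocInt k) (hf : CausalLocInt f) :
    CausalLocInt (convFun k f) := by
  refine ⟨locallyIntegrable_iff.2 fun K hK => ?_, fun x hx => ?_⟩
  · obtain ⟨M, hM, hKM⟩ := hK.isBounded.subset_closedBall_lt 0 0
    have h1 := (hk.integrable_indicator M).integrable_convolution (ContinuousLinearMap.mul ℝ ℝ)
      (hf.integrable_indicator M)
    refine IntegrableOn.congr_fun h1.integrableOn (fun x hx => ?_) hK.measurableSet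
    have hx2 := hKM hx
    rw [Metric.mem_closedBall, dist_zero_right, Real.norm_eq_abs] at hx2
    exact (convFun_eq_truncated hk hf ((le_abs_self x).trans hx2)).symm
  · refine integral_eq_zero_of_ae (Eventually.of_forall fun y => ?_)
    rcases lt_or_ge y 0 with h | h
    · simp [hk.eq_zero y h]
    · simp [hf.eq_zero (x - y) (by linarith)]

/-- Fubini for the truncated functions, with the substitution `z = x + y`. -/
theorem integral_test_mul_convFun {k f : ℝ → ℝ} (hk : CausalLocInt k) (hf : CausalLocInt f)
    (φ : RealTest) : ∫ z, φ z * convFun k f z = ∫ y, (∫ x, φ (x + y) * f x) * k y := by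
  obtain ⟨M, hM, hφM⟩ := φ.exists_bound
  set k' := (Icc 0 M).indicator k with hk'
  set f' := (Icc 0 M).indicator f with hf'
  have hki : Integrable k' := hk.integrable_indicator M
  have hfi : Integrable f' := hf.integrable_indicator M
  have h1 : ∀ z, φ z * convFun k f z = ∫ y, φ z * (k' y * f' (z - y)) := by
    intro z
    rw [integral_const_mul]
    by_cases hz : M ≤ |z|
    · simp [hφM z hz]
    · rw [convFun_eq_truncated hk hf (le_trans (le_abs_self z) (not_le.1 hz).le)]
      rfl
  have h2 : ∀ y, (∫ x, φ (x + y) * f x) * k y = ∫ z, φ z * (k' y * f' (z - y)) := by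
    intro y
    rw [← integral_add_right_eq_self (fun z => φ z * (k' y * f' (z - y))) y, ← integral_mul_const]
    congr 1
    ext x
    rw [add_sub_cancel_right, mul_assoc, mul_comm (f x)]
    by_cases hz : M ≤ |x + y|
    · simp [hφM _ hz]
    · rw [mul_indicator_eq hk hf (le_trans (le_abs_self _) (not_le.1 hz).le)]
  simp_rw [h1, h2]
  refine integral_integral_swap ?_
  have h3 := hki.convolution_integrand (ContinuousLinearMap.mul ℝ ℝ) hfi
  obtain ⟨B, hB⟩ := φ.hasCompactSupport.exists_bound_of_continuous φ.continuous
  exact h3.bdd_mul (c := B) (φ.continuous.comp continuous_fst).aestronglyMeasurable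
    (Eventually.of_forall fun p => hB p.1)

/-- The function part of `k * (c δ + f)`. -/
theorem isCausalConv_ofFun_apply {k f : ℝ → ℝ} (c : ℝ) (hk : CausalLocInt k) (hf : CausalLocInt f)
    (φ ψ : RealTest) (hψ : ∀ y > -1, ψ y = shiftPairing c f φ y) :
    ofFun (fun x => c * k x + convFun k f x) φ = ofFun k ψ := by
  have hc := causalLocInt_convFun hk hf
  have hck : LocallyIntegrable fun x => c * k x := hk.locallyIntegrable.smul c
  have hadd : LocallyIntegrable fun x => c * k x + convFun k f x := hck.add hc.locallyIntegrable
  rw [ofFun_apply hadd, ofFun_apply hk.locallyIntegrable]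
  have h1 : ∀ x, φ x * (c * k x + convFun k f x) = φ x * (c * k x) + φ x * convFun k f x :=
    fun x => mul_add _ _ _
  simp_rw [h1]
  rw [integral_add (integrable_test_mul hck φ) (integrable_test_mul hc.locallyIntegrable φ),
    integral_test_mul_convFun hk hf]
  have h2 : ∀ y, ψ y * k y = φ y * (c * k y) + (∫ x, φ (x + y) * f x) * k y := by
    intro y
    rcases lt_or_ge y 0 with h | h
    · simp [hk.eq_zero y h]
    · rw [hψ y (by linarith), shiftPairing]
      ring
  -- The pairing is not a test function, but its product with `k` is a difference of two products of
  -- test functions with locally integrable functions.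
  have h3 : Integrable fun y => (∫ x, φ (x + y) * f x) * k y := by
    have := (integrable_test_mul hk.locallyIntegrable ψ).sub (integrable_test_mul hck φ)
    refine this.congr (Eventually.of_forall fun y => ?_)
    simp only [Pi.sub_apply, h2]
    ring
  simp_rw [h2]
  rw [integral_add (integrable_test_mul hck φ) h3]

theorem isCausalConv_ofFun {k f : ℝ → ℝ} (c : ℝ) (hk : CausalLocInt k) (hf : CausalLocInt f) :
    IsCausalConv (ofFun k) (c • dirac0 + ofFun f) (ofFun fun x => c * k x + convFun k f x) := by
  refine isCausalConv_of_forall ?_ hf (isCausalConv_ofFun_apply c hk hf)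
  have := isVanishingOn_atom_add_ofFun (c := 0) hk
  rwa [zero_smul, zero_add] at this

/-- Differentiation of a causal convolution falls on the first factor. -/
theorem lineDeriv_causalConv_apply {k f : ℝ → ℝ} {c : ℝ} (hk : CausalLocInt k)
    (hf : CausalLocInt f) {φ ψ : RealTest} (hψ : ∀ y > -1, ψ y = shiftPairing c f φ y) :
    (∂_{(1 : ℝ)} (ofFun fun x => c * k x + convFun k f x)) φ = (∂_{(1 : ℝ)} (ofFun k)) ψ := by
  rw [Distribution.lineDerivOp_apply_apply, Distribution.lineDerivOp_apply_apply, map_neg, map_neg]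
  -- The half-line `(-1, ∞)` is open, so `ψ'` agrees there with the pairing of `φ'`.
  rw [isCausalConv_ofFun_apply c hk hf (∂_{(1 : ℝ)} φ) (∂_{(1 : ℝ)} ψ)]
  intro y hy
  rw [lineDeriv_test_apply]
  refine HasDerivAt.deriv ?_
  refine (hasDerivAt_shiftPairing hf.locallyIntegrable φ y).congr_of_eventuallyEq ?_
  filter_upwards [lt_mem_nhds hy] with z hz using hψ z hz

/-! ### Series of Prabhakar kernels as fractional power series -/

/-- The coefficients of `∑ c_m (1 + z)^(-m)` in the powers of `-z`. -/
def multichooseSum (c : ℕ → ℝ) (s : ℕ) : ℝ := ∑' m : ℕ, c m * Ring.multichoose (m : ℝ) s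

theorem summable_mul_two_pow {c : ℕ → ℝ} (hc : Summable fun m => |c m| * 4 ^ m) :
    Summable fun m => |c m| * 2 ^ m := by
  refine Summable.of_nonneg_of_le (fun m => by positivity) (fun m => ?_) hc
  gcongr
  norm_num

theorem norm_mul_multichoose_le (c : ℕ → ℝ) (m s : ℕ) :
    ‖c m * Ring.multichoose (m : ℝ) s‖ ≤ |c m| * 2 ^ m * 2 ^ s := by
  rw [norm_mul, Real.norm_eq_abs, Real.norm_of_nonneg (multichoose_nonneg (Nat.cast_nonneg m) s),
    mul_assoc, ← pow_add]
  exact mul_le_mul_of_nonneg_left (multichoose_natCast_le m s) (abs_nonneg _)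

theorem hasSum_multichooseSum {c : ℕ → ℝ} (hc : Summable fun m => |c m| * 4 ^ m) (s : ℕ) :
    HasSum (fun m : ℕ => c m * Ring.multichoose (m : ℝ) s) (multichooseSum c s) :=
  (Summable.of_norm_bounded ((summable_mul_two_pow hc).mul_right (2 ^ s))
    fun m => norm_mul_multichoose_le c m s).hasSum

theorem expBdd_multichooseSum {c : ℕ → ℝ} (hc : Summable fun m => |c m| * 4 ^ m) :
    ExpBdd (multichooseSum c) := by
  refine ⟨∑' m, |c m| * 2 ^ m, 2, tsum_nonneg fun m => by positivity, by norm_num, fun s => ?_⟩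
  rw [multichooseSum, ← Real.norm_eq_abs]
  exact tsum_of_norm_bounded ((summable_mul_two_pow hc).hasSum.mul_right (2 ^ s))
    fun m => norm_mul_multichoose_le c m s

/-- Exchanging the sums over `m` and `s` exhibits the whole series as one fractional series, to
which the convolution formula applies. -/
theorem tsum_mul_prabhakarKernelReg_eq {a z x : ℝ} (ha : 0 < a) (hx : 0 < x) {c : ℕ → ℝ}
    (hc : Summable fun m => |c m| * 4 ^ m) :
    ∑' m : ℕ, c m * prabhakarKernelReg a m z x =
      fracSeries a a (fun s => multichooseSum c (s + 1) * z ^ (s + 1)) x := by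
  have hexp : ExpBdd fun s => (2 : ℝ) ^ (s + 1) * z ^ (s + 1) :=
    ((expBdd_pow 2).mul (expBdd_pow z)).comp_succ
  have hsum : Summable (Function.uncurry fun (m s : ℕ) => c m *
      (Ring.multichoose (m : ℝ) (s + 1) * z ^ (s + 1) *
        (x ^ (a * s + a - 1) / Real.Gamma (a * s + a)))) := by
    refine Summable.of_norm_bounded (g := fun p : ℕ × ℕ => (|c p.1| * 2 ^ p.1) *
      ‖2 ^ (p.2 + 1) * z ^ (p.2 + 1) * (x ^ (a * p.2 + a - 1) / Real.Gamma (a * p.2 + a))‖)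
      ((summable_mul_two_pow hc).mul_of_nonneg (fracSeries_summable ha ha hx hexp)
        (fun m => by positivity) (fun s => norm_nonneg _)) fun p => ?_
    simp only [Function.uncurry]
    have h := norm_mul_multichoose_le c p.1 (p.2 + 1)
    rw [← mul_assoc, ← mul_assoc, mul_assoc (2 ^ (p.2 + 1)), norm_mul (2 ^ (p.2 + 1)), mul_assoc _ (z ^ _),
      norm_mul, Real.norm_of_nonneg (show (0 : ℝ) ≤ 2 ^ (p.2 + 1) by positivity), ← mul_assoc]
    exact mul_le_mul_of_nonneg_right h (norm_nonneg _)
  calc ∑' m : ℕ, c m * prabhakarKernelReg a m z x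
      = ∑' m : ℕ, ∑' s : ℕ, c m * (Ring.multichoose (m : ℝ) (s + 1) * z ^ (s + 1) *
          (x ^ (a * s + a - 1) / Real.Gamma (a * s + a))) := by
        refine tsum_congr fun m => ?_
        rw [prabhakarKernelReg_eq m hx, fracSeries, tsum_mul_left]
    _ = ∑' s : ℕ, ∑' m : ℕ, c m * (Ring.multichoose (m : ℝ) (s + 1) * z ^ (s + 1) *
          (x ^ (a * s + a - 1) / Real.Gamma (a * s + a))) := hsum.tsum_comm.symm
    _ = _ := by
        rw [fracSeries]
        refine tsum_congr fun s => ?_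
        rw [mul_assoc, multichooseSum, ← tsum_mul_right]
        exact tsum_congr fun m => by ring

theorem expBdd_multichooseSum_mul {c : ℕ → ℝ} (hc : Summable fun m => |c m| * 4 ^ m) (z : ℝ) :
    ExpBdd fun s => multichooseSum c (s + 1) * z ^ (s + 1) :=
  ((expBdd_multichooseSum hc).mul (expBdd_pow z)).comp_succ

theorem tsum_mul_prabhakarKernelReg_of_nonpos {a z x : ℝ} (hx : x ≤ 0) (c : ℕ → ℝ) :
    ∑' m : ℕ, c m * prabhakarKernelReg a m z x = 0 := by
  simp [prabhakarKernelReg, not_lt.2 hx]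

theorem causalLocInt_tsum_prabhakarKernelReg {a z : ℝ} (ha : 0 < a) {c : ℕ → ℝ}
    (hc : Summable fun m => |c m| * 4 ^ m) :
    CausalLocInt fun x => ∑' m : ℕ, c m * prabhakarKernelReg a m z x :=
  causalLocInt_of_eq_fracSeries ha ha (expBdd_multichooseSum_mul hc z)
    (fun _ hx => tsum_mul_prabhakarKernelReg_of_nonpos hx.le c)
    fun _ hx => tsum_mul_prabhakarKernelReg_eq ha hx hc

/-! ### Index shifts and convolution with the Mittag-Leffler density -/

theorem sum_range_multichoose (r : ℝ) (s : ℕ) :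
    ∑ k ∈ Finset.range (s + 1), Ring.multichoose r k = Ring.multichoose (r + 1) s := by
  induction s with
  | zero => simp
  | succ s ih => rw [Finset.sum_range_succ, ih, Ring.multichoose_succ_succ, add_comm]

/-- The sequence `c` moved one step to the right. -/
def shiftSeq (c : ℕ → ℝ) : ℕ → ℝ
  | 0 => 0
  | m + 1 => c m

theorem summable_shiftSeq {c : ℕ → ℝ} (hc : Summable fun m => |c m| * 4 ^ m) :
    Summable fun m => |shiftSeq c m| * 4 ^ m := by
  rw [← summable_nat_add_iff 1]
  refine (hc.mul_right 4).congr fun m => ?_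
  rw [shiftSeq, pow_succ, mul_assoc]

theorem tsum_shiftSeq_mul (c y : ℕ → ℝ) (h : Summable fun m => shiftSeq c m * y m) :
    ∑' m, shiftSeq c m * y m = ∑' m, c m * y (m + 1) := by
  rw [h.tsum_eq_zero_add]
  simp [shiftSeq]

/-- Shifting `c` multiplies `∑ c_m (1 + z)^(-m)` by `(1 + z)⁻¹`, which takes partial sums of the
coefficients of powers of `-z`. -/
theorem multichooseSum_shiftSeq {c : ℕ → ℝ} (hc : Summable fun m => |c m| * 4 ^ m) (s : ℕ) :
    multichooseSum (shiftSeq c) s = ∑ k ∈ Finset.range (s + 1), multichooseSum c k := by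
  rw [multichooseSum, tsum_shiftSeq_mul c _ (hasSum_multichooseSum (summable_shiftSeq hc) s).summable]
  have h := hasSum_sum (s := Finset.range (s + 1)) fun k _ => hasSum_multichooseSum hc k
  rw [← h.tsum_eq]
  refine tsum_congr fun m => ?_
  rw [← Finset.mul_sum, sum_range_multichoose, Nat.cast_succ]

theorem summable_of_abs_mul_four_pow {c : ℕ → ℝ} (hc : Summable fun m => |c m| * 4 ^ m) :
    Summable c :=
  Summable.of_norm_bounded hc fun _ =>
    le_mul_of_one_le_right (norm_nonneg _) (one_le_pow₀ (by norm_num))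

theorem summable_mul_prabhakarKernelReg {α l x : ℝ} (hα : 0 < α) (hα1 : α ≤ 1) (hl : 0 < l)
    (hx : 0 < x) {c : ℕ → ℝ} (hc : Summable fun m => |c m| * 4 ^ m) :
    Summable fun m : ℕ => c m * prabhakarKernelReg α m (-l) x := by
  obtain ⟨C, -, h⟩ := abs_prabhakarKernelReg_le hα hα1 hl hx
  refine Summable.of_norm_bounded (hc.mul_right (C * x ^ (α - 1))) fun m => ?_
  rw [norm_mul, Real.norm_eq_abs, Real.norm_eq_abs, mul_assoc]
  refine mul_le_mul_of_nonneg_left ((h x hx le_rfl m).trans (le_of_eq (by ring))) (abs_nonneg _)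

theorem ExpBdd.sub {f g : ℕ → ℝ} (hf : ExpBdd f) (hg : ExpBdd g) :
    ExpBdd fun s => f s - g s := by
  obtain ⟨C, K, hC, hK, h⟩ := hf
  obtain ⟨C', K', hC', hK', h'⟩ := hg
  refine ⟨C + C', K + K', by positivity, by positivity, fun s => ?_⟩
  calc |f s - g s| ≤ |f s| + |g s| := abs_sub _ _
    _ ≤ C * K ^ s + C' * K' ^ s := add_le_add (h s) (h' s)
    _ ≤ C * (K + K') ^ s + C' * (K + K') ^ s := by gcongr <;> linarith
    _ = (C + C') * (K + K') ^ s := by ring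

/-- A convolution of two series with second parameter `a` has parameter `2 a`, that is, it starts
one index later. -/
theorem fracSeries_add_exponent {a x : ℝ} {g : ℕ → ℝ} (ha : 0 < a) (hx : 0 < x)
    (hg : ExpBdd (shiftSeq g)) : fracSeries a (a + a) g x = fracSeries a a (shiftSeq g) x := by
  rw [fracSeries, fracSeries, (fracSeries_summable ha ha hx hg).of_norm.tsum_eq_zero_add]
  simp only [shiftSeq, zero_mul, zero_add]
  refine tsum_congr fun s => ?_
  push_cast
  rw [show a * ((s : ℝ) + 1) + a = a * s + (a + a) by ring]

/-- The convolution of the Mittag-Leffler density with a series of Prabhakar kernels. -/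
theorem mlDensity_conv_tsum {α l x : ℝ} (hα : 0 < α) (hα1 : α ≤ 1) (hl : 0 < l) (hx : 0 < x)
    {c : ℕ → ℝ} (hc : Summable fun m => |c m| * 4 ^ m) :
    IntervalIntegrable (fun τ => mlDensity α l (x - τ) *
      ∑' m : ℕ, c m * prabhakarKernelReg α m (-l) τ) volume 0 x ∧
    ∑' m : ℕ, c m * prabhakarKernelReg α (m + 1 : ℕ) (-l) x =
      ∑' m : ℕ, c m * prabhakarKernelReg α m (-l) x - (∑' m, c m) * mlDensity α l x -
      ∫ τ in (0 : ℝ)..x, mlDensity α l (x - τ) *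
        ∑' m : ℕ, c m * prabhakarKernelReg α m (-l) τ := by
  set z := -l with hz
  set w : ℕ → ℝ := fun s => -z ^ (s + 1) with hw
  set Q : ℕ → ℝ := fun s => multichooseSum c (s + 1) * z ^ (s + 1) with hQ
  have hwe : ExpBdd w := expBdd_mlDensity l
  have hQe : ExpBdd Q := expBdd_multichooseSum_mul hc z
  have hcongr : ∀ τ ∈ Ioo 0 x, fracSeries α α w (x - τ) * fracSeries α α Q τ =
      mlDensity α l (x - τ) * ∑' m : ℕ, c m * prabhakarKernelReg α m z τ := by
    intro τ hτ
    rw [mlDensity_eq (sub_pos.2 hτ.2), tsum_mul_prabhakarKernelReg_eq hα hτ.1 hc]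
  have hI := intervalIntegrable_fracSeries_conv hα hα hα hx hwe hQe
  have hV := integral_fracSeries_conv hα hα hα hx hwe hQe
  refine ⟨?_, ?_⟩
  · rw [intervalIntegrable_iff_integrableOn_Ioo_of_le hx.le] at hI ⊢
    exact hI.congr_fun hcongr measurableSet_Ioo
  · have hV2 : ∫ τ in (0 : ℝ)..x, fracSeries α α w (x - τ) * fracSeries α α Q τ =
        ∫ τ in (0 : ℝ)..x, mlDensity α l (x - τ) *
          ∑' m : ℕ, c m * prabhakarKernelReg α m z τ := by
      rw [intervalIntegral.integral_of_le hx.le, intervalIntegral.integral_of_le hx.le,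
        integral_Ioc_eq_integral_Ioo, integral_Ioc_eq_integral_Ioo]
      exact setIntegral_congr_fun measurableSet_Ioo hcongr
    have hc' := summable_shiftSeq hc
    set R : ℕ → ℝ := fun s => multichooseSum (shiftSeq c) (s + 1) * z ^ (s + 1) with hR
    have hRe : ExpBdd R := expBdd_multichooseSum_mul hc' z
    have hL : ∑' m : ℕ, c m * prabhakarKernelReg α (m + 1 : ℕ) z x = fracSeries α α R x := by
      rw [← tsum_mul_prabhakarKernelReg_eq hα hx hc',
        tsum_shiftSeq_mul c (fun m : ℕ => prabhakarKernelReg α m z x)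
          (summable_mul_prabhakarKernelReg hα hα1 hl hx hc')]
    set g : ℕ → ℝ := fun n => ∑ p ∈ Finset.HasAntidiagonal.antidiagonal n, w p.1 * Q p.2 with hg
    have hA : multichooseSum c 0 = ∑' m, c m := by simp [multichooseSum]
    -- In the Cauchy product the powers of `z` combine, leaving `-z ^ (s + 1)` times the sum of
    -- `multichooseSum c k` over `1 ≤ k ≤ s`. In `R` the sum runs over `0 ≤ k ≤ s + 1`; its two
    -- extra ends are `Q s` and the atom's term.
    have hcoef : ∀ s, shiftSeq g s = Q s - (∑' m, c m) * w s - R s := by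
      intro s
      simp only [hR, hQ, hw]
      rw [multichooseSum_shiftSeq hc, ← hA, Finset.sum_range_succ, Finset.sum_range_succ']
      cases s with
      | zero =>
        simp [shiftSeq]
        ring
      | succ n =>
        rw [shiftSeq, hg]
        simp only [hw, hQ]
        rw [Finset.Nat.sum_antidiagonal_eq_sum_range_succ
          (fun i j => -z ^ (i + 1) * (multichooseSum c (j + 1) * z ^ (j + 1))),
          ← Finset.sum_range_reflect]
        have : ∀ i ∈ Finset.range (n + 1), -z ^ (n + 1 - 1 - i + 1) *
            (multichooseSum c (n - (n + 1 - 1 - i) + 1) * z ^ (n - (n + 1 - 1 - i) + 1)) =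
            multichooseSum c (i + 1) * (-z ^ (n + 1 + 1)) := by
          intro i hi
          have hi' : i ≤ n := Nat.lt_succ_iff.1 (Finset.mem_range.1 hi)
          obtain ⟨j, rfl⟩ := Nat.exists_eq_add_of_le hi'
          rw [show i + j + 1 - 1 - i = j by omega, show i + j - j = i by omega]
          ring
        rw [Finset.sum_congr rfl this, ← Finset.sum_mul]
        ring
    have hge : ExpBdd (shiftSeq g) := by
      rw [show shiftSeq g = fun s => Q s - (∑' m, c m) * w s - R s from funext hcoef]
      exact (hQe.sub (hwe.const_mul _)).sub hRe
    rw [← hV2, hV, fracSeries_add_exponent hα hx hge, hL, mlDensity_eq hx,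
      tsum_mul_prabhakarKernelReg_eq hα hx hc]
    have h1 := ((fracSeries_hasSum hα hα hx hQe).sub
      ((fracSeries_hasSum hα hα hx hwe).mul_left (∑' m, c m))).sub (fracSeries_hasSum hα hα hx hRe)
    have h2 : fracSeries α α (shiftSeq g) x = fracSeries α α Q x -
        (∑' m, c m) * fracSeries α α w x - fracSeries α α R x := by
      rw [← h1.tsum_eq, fracSeries]
      refine tsum_congr fun s => ?_
      rw [hcoef]
      ring
    linarith

/-! ### The Laplacian density -/

theorem hasDerivAt_mittagLeffler_rpow {α l x : ℝ} (hα : 0 < α) (hx : 0 < x) :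
    HasDerivAt (fun y : ℝ => mittagLeffler α (-l * y ^ α)) (-mlDensity α l x) x := by
  have h := hasDerivAt_fracSeries_one hα hx (expBdd_pow (-l))
  have h1 : fracSeries α α (fun s => (-l) ^ (s + 1)) x = -mlDensity α l x := by
    rw [mlDensity_eq hx, fracSeries, fracSeries, ← tsum_neg]
    exact tsum_congr fun s => by ring
  rw [h1] at h
  refine h.congr_of_eventuallyEq ?_
  filter_upwards [lt_mem_nhds hx] with y hy using mittagLeffler_eq_fracSeries hy.le

theorem survivalFun_zero {α l : ℝ} (hα : 0 < α) : survivalFun α l 0 = 1 := by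
  rw [survivalFun, if_pos le_rfl, mittagLeffler_eq_tsum_mlCoeff,
    tsum_eq_single 0 fun m hm => by rw [mlCoeff_zero hα, if_neg hm, zero_mul]]
  simp [mlCoeff_zero hα]

theorem continuousOn_survivalFun {α l R : ℝ} (hα : 0 < α) (hR : 0 < R) :
    ContinuousOn (survivalFun α l) (Icc 0 R) :=
  (continuousOn_fracSeries_Icc hα le_rfl hR (expBdd_pow (-l))).congr fun x hx => by
    rw [survivalFun, if_pos hx.1, mittagLeffler_eq_fracSeries hx.1]

theorem hasDerivAt_survivalFun {α l x : ℝ} (hα : 0 < α) (hx : 0 < x) :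
    HasDerivAt (survivalFun α l) (-mlDensity α l x) x := by
  refine (hasDerivAt_mittagLeffler_rpow hα hx).congr_of_eventuallyEq ?_
  filter_upwards [lt_mem_nhds hx] with y hy using by rw [survivalFun, if_pos hy.le]

theorem integral_eq_intervalIntegral_of_causal {g : ℝ → ℝ} {R : ℝ} (hR : 0 < R)
    (h0 : ∀ x < 0, g x = 0) (h1 : ∀ x, R < x → g x = 0) : ∫ x, g x = ∫ x in (0 : ℝ)..R, g x := by
  rw [intervalIntegral.integral_of_le hR.le, ← integral_Icc_eq_integral_Ioc]
  refine (setIntegral_eq_integral_of_forall_compl_eq_zero fun x hx => ?_).symm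
  rcases lt_or_ge x 0 with h | h
  · exact h0 x h
  · exact h1 x (not_le.1 fun h' => hx ⟨h, h'⟩)

theorem laplacianDensity_apply {α : ℝ} (l : ℝ) (hα : 0 < α) (φ : RealTest) :
    laplacianDensity α l φ = φ 0 - ∫ x, φ x * mlDensity α l x := by
  rw [← ofFun_apply (causalLocInt_mlDensity hα).locallyIntegrable]
  rfl

theorem laplacianDensity_eq_atom_add_ofFun {α : ℝ} (l : ℝ) (hα : 0 < α) :
    laplacianDensity α l = (1 : ℝ) • dirac0 + ofFun fun x => -mlDensity α l x := by
  ext φ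
  have h : ((1 : ℝ) • dirac0 + ofFun fun x => -mlDensity α l x) φ =
    1 * φ 0 + ofFun (fun x => -mlDensity α l x) φ := rfl
  have hn : LocallyIntegrable fun x => -mlDensity α l x :=
    (causalLocInt_mlDensity hα).locallyIntegrable.neg
  rw [h, ofFun_apply hn, laplacianDensity_apply l hα]
  simp only [mul_neg, integral_neg, one_mul, sub_eq_add_neg]

/-- Integration by parts on `[0, R]`; the delta is the boundary term at `0`, where the survival
function jumps to `1`. -/
theorem laplacianDensity_eq_lineDeriv {α : ℝ} (l : ℝ) (hα : 0 < α) :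
    laplacianDensity α l = ∂_{(1 : ℝ)} (ofFun (survivalFun α l)) := by
  ext φ
  have hS := (causalLocInt_survivalFun (l := l) hα)
  have hW := (causalLocInt_mlDensity (l := l) hα)
  rw [Distribution.lineDerivOp_apply_apply, map_neg, ofFun_apply hS.locallyIntegrable,
    laplacianDensity_apply l hα]
  obtain ⟨R, hR, hφR⟩ := RealTest.exists_bound φ
  have hφ' : ∀ x, R < x → (∂_{(1 : ℝ)} φ) x = 0 := by
    intro x hx
    rw [lineDeriv_test_apply]
    have : φ =ᶠ[𝓝 x] fun _ => 0 := by
      filter_upwards [lt_mem_nhds hx] with y hy using hφR y (hy.le.trans (le_abs_self y))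
    rw [this.deriv_eq, deriv_const]
  have hφ0 : ∀ x, R < x → φ x = 0 := fun x hx => hφR x (hx.le.trans (le_abs_self x))
  have hi1 := integrable_test_mul hS.locallyIntegrable (∂_{(1 : ℝ)} φ)
  have hi2 := integrable_test_mul hW.locallyIntegrable φ
  rw [integral_eq_intervalIntegral_of_causal hR (fun x hx => by rw [hW.eq_zero x hx, mul_zero])
      (fun x hx => by rw [hφ0 x hx, zero_mul]),
    integral_eq_intervalIntegral_of_causal hR (fun x hx => by rw [hS.eq_zero x hx, mul_zero])
      (fun x hx => by rw [hφ' x hx, zero_mul])]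
  have hkey := intervalIntegral.integral_eq_sub_of_hasDerivAt_of_le hR.le
    (f := fun x => φ x * survivalFun α l x)
    (f' := fun x => (∂_{(1 : ℝ)} φ) x * survivalFun α l x + φ x * (-mlDensity α l x))
    (φ.contDiff.continuous.continuousOn.mul (continuousOn_survivalFun hα hR))
    (fun x hx => (hasDerivAt_test φ x).mul (hasDerivAt_survivalFun hα hx.1))
    (by
      simp only [mul_neg]
      exact hi1.intervalIntegrable.add hi2.intervalIntegrable.neg)
  simp only [mul_neg, ← sub_eq_add_neg] at hkey
  rw [intervalIntegral.integral_sub hi1.intervalIntegrable hi2.intervalIntegrable, survivalFun_zero hα, hφR R (le_abs_self R)] at hkey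
  linarith

theorem tendsto_latticeDensity_coeff {α l : ℝ} (hα : 0 < α) (hα1 : α ≤ 1) (hl : 0 < l)
    (φ : RealTest) :
    Tendsto (fun h : ℝ => ∫ x, latticeDensity h
        (fun n => PowerSeries.coeff n (discreteLaplacian α (l * h ^ α))) x * φ x)
      (𝓝[>] 0) (𝓝 (laplacianDensity α l φ)) := by
  have h := tendsto_integral_latticeDensity (A := 1) (f := fun x => -mlDensity α l x)
    (c := fun h n => PowerSeries.coeff n (discreteLaplacian α (l * h ^ α))) hα hα1 ?_ ?_ ?_ ?_ φ
  · rw [laplacianDensity_apply l hα, sub_eq_add_neg, ← integral_neg]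
    simpa only [one_mul, mul_neg] using h
  · filter_upwards [self_mem_nhdsWithin] with h hh
    have := coeff_zero_discreteLaplacian_pow (a := α)
      (mul_pos hl (Real.rpow_pos_of_pos (show (0 : ℝ) < h from hh) α)) 1
    rwa [pow_one] at this
  · intro x hx
    simp [mlDensity, not_lt.2 hx]
  · intro x hx
    simpa only [pow_one, prabhakarKernelReg_one] using tendsto_coeff_pow_lattice hα hα1 hl hx 1
  · intro R hR
    obtain ⟨C, hC, hev⟩ := coeff_pow_lattice_bound hα hα1 hl hR
    refine ⟨C * 4 ^ 1, by positivity, ?_⟩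
    filter_upwards [hev] with h hh n hn hnR
    simpa only [pow_one] using hh n hn hnR 1

/-! ### The Laplace transform of the Mittag-Leffler density -/

/-- The Volterra equation of the Mittag-Leffler density. -/
theorem mlDensity_volterra {α l x : ℝ} (hα : 0 < α) (hx : 0 < x) :
    mlDensity α l x + l * ((Real.Gamma α)⁻¹ *
        ∫ τ in (0 : ℝ)..x, (x - τ) ^ (α - 1) * mlDensity α l τ) =
      l * (x ^ (α - 1) / Real.Gamma α) := by
  set w : ℕ → ℝ := fun s => -(-l) ^ (s + 1) with hw
  have hwe : ExpBdd w := expBdd_mlDensity l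
  have h1 : ∫ τ in (0 : ℝ)..x, (x - τ) ^ (α - 1) * mlDensity α l τ =
      ∫ τ in (0 : ℝ)..x, (x - τ) ^ (α - 1) * fracSeries α α w τ := by
    rw [intervalIntegral.integral_of_le hx.le, intervalIntegral.integral_of_le hx.le]
    exact setIntegral_congr_fun measurableSet_Ioc fun τ hτ => by rw [mlDensity_eq hτ.1]
  -- The fractional integral of order `α` moves the series by one index, so after multiplication by
  -- `l` it cancels everything but the term `s = 0`.
  rw [h1, (integral_rpow_fracSeries hα hα hα hx hwe).2, mlDensity_eq hx, fracSeries, fracSeries,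
    (fracSeries_summable hα hα hx hwe).of_norm.tsum_eq_zero_add, ← tsum_mul_left, add_assoc,
    ← Summable.tsum_add]
  · rw [(tsum_congr fun s => ?_ : _ = ∑' _ : ℕ, (0 : ℝ))]
    · simp [hw]
    · simp only [hw]
      push_cast
      rw [show α * ((s : ℝ) + 1) + α = α * s + (α + α) by ring]
      ring
  · exact (summable_nat_add_iff 1).2 (fracSeries_summable hα hα hx hwe).of_norm
  · exact (fracSeries_summable hα (by positivity) hx hwe).of_norm.mul_left l

/-- Positivity allows dropping the integral in the Volterra equation. Unlike the series estimates,
the bound is global, which the Laplace integral requires. -/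
theorem mlDensity_le {α l x : ℝ} (hα : 0 < α) (hα1 : α ≤ 1) (hl : 0 < l) (hx : 0 < x) :
    mlDensity α l x ≤ l * (x ^ (α - 1) / Real.Gamma α) := by
  rw [← mlDensity_volterra hα hx, le_add_iff_nonneg_right]
  have : 0 ≤ ∫ τ in (0 : ℝ)..x, (x - τ) ^ (α - 1) * mlDensity α l τ :=
    intervalIntegral.integral_nonneg hx.le fun τ hτ =>
      mul_nonneg (Real.rpow_nonneg (sub_nonneg.2 hτ.2) _) (mlDensity_nonneg hα hα1 hl)
  have := (Real.Gamma_pos_of_pos hα)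
  positivity

theorem integrableOn_exp_mul_rpow {α s : ℝ} (hα : 0 < α) (hs : 0 < s) :
    IntegrableOn (fun x : ℝ => Real.exp (-s * x) * x ^ (α - 1)) (Ioi 0) := by
  have h := integrableOn_rpow_mul_exp_neg_mul_rpow (s := α - 1) (by linarith) one_pos hs
  simpa only [Real.rpow_one, mul_comm] using h

theorem integrableOn_exp_mul_mlDensity {α l s : ℝ} (hα : 0 < α) (hα1 : α ≤ 1) (hl : 0 < l)
    (hs : 0 < s) :
    IntegrableOn (fun x : ℝ => Real.exp (-s * x) * mlDensity α l x) (Ioi 0) := by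
  refine Integrable.mono' ((integrableOn_exp_mul_rpow hα hs).const_mul (l / Real.Gamma α)) ?_ ?_
  · exact ((Real.continuous_exp.comp (continuous_const.mul continuous_id)).aestronglyMeasurable.mul
      (causalLocInt_mlDensity hα).locallyIntegrable.aestronglyMeasurable).restrict
  · refine ae_restrict_of_forall_mem measurableSet_Ioi fun x hx => ?_
    rw [norm_mul, Real.norm_of_nonneg (Real.exp_pos _).le,
      Real.norm_of_nonneg (mlDensity_nonneg hα hα1 hl)]
    calc _ ≤ Real.exp (-s * x) * (l * (x ^ (α - 1) / Real.Gamma α)) :=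
          mul_le_mul_of_nonneg_left (mlDensity_le hα hα1 hl hx) (Real.exp_pos _).le
      _ = _ := by ring

/-- The Laplace transform turns the Volterra equation into a linear equation for `A`, with `∫ e^(-s
x) x^(α - 1) = Γ(α) s^(-α)`. -/
theorem integral_exp_mul_mlDensity {α l s : ℝ} (hα : 0 < α) (hα1 : α ≤ 1) (hl : 0 < l)
    (hs : 0 < s) :
    ∫ x in Ioi (0 : ℝ), Real.exp (-s * x) * mlDensity α l x = l / (s ^ α + l) := by
  have hf := integrableOn_exp_mul_mlDensity hα hα1 hl hs
  have hg := integrableOn_exp_mul_rpow hα hs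
  have hΓ := Real.Gamma_pos_of_pos hα
  have hsα := Real.rpow_pos_of_pos hs α
  have hB : ∫ x in Ioi (0 : ℝ), Real.exp (-s * x) * x ^ (α - 1) =
      (1 / s) ^ α * Real.Gamma α := by
    rw [← Real.integral_rpow_mul_exp_neg_mul_Ioi hα hs]
    exact setIntegral_congr_fun measurableSet_Ioi fun x _ => by rw [neg_mul, mul_comm]
  have hconv := integral_posConvolution hf hg (ContinuousLinearMap.mul ℝ ℝ)
  set A := ∫ x in Ioi (0 : ℝ), Real.exp (-s * x) * mlDensity α l x with hA
  rw [hB] at hconv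
  simp only [ContinuousLinearMap.mul_apply'] at hconv
  have hpt : ∀ x ∈ Ioi (0 : ℝ),
      ∫ t in (0 : ℝ)..x, Real.exp (-s * t) * mlDensity α l t *
        (Real.exp (-s * (x - t)) * (x - t) ^ (α - 1)) =
      Real.exp (-s * x) * x ^ (α - 1) -
        Real.Gamma α / l * (Real.exp (-s * x) * mlDensity α l x) := by
    intro x hx
    have h1 : ∀ t, Real.exp (-s * t) * mlDensity α l t *
        (Real.exp (-s * (x - t)) * (x - t) ^ (α - 1)) =
        Real.exp (-s * x) * ((x - t) ^ (α - 1) * mlDensity α l t) := by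
      intro t
      rw [show -s * x = -s * t + -s * (x - t) by ring, Real.exp_add]
      ring
    simp only [h1]
    rw [intervalIntegral.integral_const_mul]
    have hv := mlDensity_volterra (l := l) hα hx
    have : ∫ τ in (0 : ℝ)..x, (x - τ) ^ (α - 1) * mlDensity α l τ =
        x ^ (α - 1) - Real.Gamma α / l * mlDensity α l x := by
      field_simp at hv ⊢
      linarith
    rw [this]
    ring
  rw [setIntegral_congr_fun measurableSet_Ioi hpt, integral_sub hg (hf.const_mul _),
    integral_const_mul, hB, ← hA, one_div, Real.inv_rpow hs.le] at hconv
  rw [eq_div_iff (by positivity)]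
  field_simp at hconv
  linarith

/-! ### Analytic continuation to the right half-plane -/

theorem cpow_ofReal_re_pos {α : ℝ} (hα : 0 < α) (hα1 : α ≤ 1) {s : ℂ} (hs : 0 < s.re) :
    0 < (s ^ (α : ℂ)).re := by
  have hs0 : s ≠ 0 := fun h => by simp [h] at hs
  rw [Complex.cpow_ofReal_re]
  refine mul_pos (Real.rpow_pos_of_pos (norm_pos_iff.2 hs0) _) (Real.cos_pos_of_mem_Ioo ?_)
  have h := Complex.abs_arg_lt_pi_div_two_iff.2 (Or.inl hs)
  have h2 : |s.arg * α| < Real.pi / 2 := by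
    rw [abs_mul, abs_of_pos hα]
    exact (mul_le_of_le_one_right (abs_nonneg _) hα1).trans_lt h
  exact abs_lt.1 h2

theorem cpow_ofReal_add_ne_zero {α l : ℝ} (hα : 0 < α) (hα1 : α ≤ 1) (hl : 0 < l) {s : ℂ}
    (hs : 0 < s.re) : s ^ (α : ℂ) + (l : ℂ) ≠ 0 := fun h => by
  have := congrArg Complex.re h
  rw [Complex.add_re, Complex.ofReal_re, Complex.zero_re] at this
  linarith [cpow_ofReal_re_pos hα hα1 hs]

/-- The measure with density `mlDensity`. -/
def mlMeasure (α l : ℝ) : Measure ℝ :=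
  (volume.restrict (Ioi 0)).withDensity fun x => ENNReal.ofReal (mlDensity α l x)

theorem aemeasurable_mlDensity {α l : ℝ} (hα : 0 < α) :
    AEMeasurable (fun x => ENNReal.ofReal (mlDensity α l x)) (volume.restrict (Ioi 0)) :=
  (causalLocInt_mlDensity hα).locallyIntegrable.aestronglyMeasurable.aemeasurable.restrict.ennreal_ofReal

/-- As the density is nonnegative, its Laplace integral is a complex moment generating function,
whose holomorphy is known. -/
theorem complexMGF_mlMeasure {α l : ℝ} (hα : 0 < α) (hα1 : α ≤ 1) (hl : 0 < l) (s : ℂ) :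
    ProbabilityTheory.complexMGF id (mlMeasure α l) (-s) =
      ∫ x in Ioi (0 : ℝ), Complex.exp (-s * x) * (mlDensity α l x : ℂ) := by
  rw [ProbabilityTheory.complexMGF, mlMeasure, integral_withDensity_eq_integral_toReal_smul₀
    (aemeasurable_mlDensity hα) (Eventually.of_forall fun x => ENNReal.ofReal_lt_top)]
  refine integral_congr_ae (Eventually.of_forall fun x => ?_)
  simp only [ENNReal.toReal_ofReal (mlDensity_nonneg hα hα1 hl), id, Complex.real_smul, mul_comm]

theorem Iio_subset_integrableExpSet_mlMeasure {α l : ℝ} (hα : 0 < α) (hα1 : α ≤ 1) (hl : 0 < l) :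
    Iio 0 ⊆ interior (ProbabilityTheory.integrableExpSet id (mlMeasure α l)) := by
  refine interior_maximal (fun t ht => ?_) isOpen_Iio
  change Integrable (fun x : ℝ => Real.exp (t * x)) (mlMeasure α l)
  rw [mlMeasure, integrable_withDensity_iff_integrable_smul₀'
    (aemeasurable_mlDensity hα) (Eventually.of_forall fun x => ENNReal.ofReal_lt_top)]
  refine (integrableOn_exp_mul_mlDensity hα hα1 hl (neg_pos.2 ht)).congr
    (Eventually.of_forall fun x => ?_)
  simp only [ENNReal.toReal_ofReal (mlDensity_nonneg hα hα1 hl), smul_eq_mul, neg_neg, mul_comm]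

theorem integral_cexp_mul_mlDensity {α l : ℝ} (hα : 0 < α) (hα1 : α ≤ 1) (hl : 0 < l)
    {s : ℂ} (hs : 0 < s.re) :
    ∫ x in Ioi (0 : ℝ), Complex.exp (-s * x) * (mlDensity α l x : ℂ) =
      l / (s ^ (α : ℂ) + l) := by
  set U : Set ℂ := {z | 0 < z.re} with hU
  have hUo : IsOpen U := isOpen_lt continuous_const Complex.continuous_re
  have hUc : IsPreconnected U := (convex_halfSpace_re_gt 0).isPreconnected
  have hf : DifferentiableOn ℂ
      (fun z => ProbabilityTheory.complexMGF id (mlMeasure α l) (-z)) U := by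
    refine ProbabilityTheory.differentiableOn_complexMGF.comp differentiableOn_id.neg fun z hz => ?_
    refine Iio_subset_integrableExpSet_mlMeasure hα hα1 hl ?_
    exact (Complex.neg_re z).trans_lt (neg_neg_of_pos hz)
  have hg : DifferentiableOn ℂ (fun z : ℂ => (l : ℂ) / (z ^ (α : ℂ) + l)) U := by
    intro z hz
    refine DifferentiableAt.differentiableWithinAt ?_
    refine (differentiableAt_const _).div (DifferentiableAt.add_const _ ?_)
      (cpow_ofReal_add_ne_zero hα hα1 hl hz)
    exact differentiableAt_id.cpow_const (Or.inl hz)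
  have hreal : ∀ r : ℝ, 0 < r → ProbabilityTheory.complexMGF id (mlMeasure α l) (-(r : ℂ)) =
      (l : ℂ) / ((r : ℂ) ^ (α : ℂ) + l) := by
    intro r hr
    rw [complexMGF_mlMeasure hα hα1 hl, ← Complex.ofReal_cpow hr.le]
    have h := congrArg (fun x : ℝ => (x : ℂ)) (integral_exp_mul_mlDensity hα hα1 hl hr)
    have h2 := integral_complex_ofReal (μ := volume.restrict (Ioi (0 : ℝ)))
      (f := fun x => Real.exp (-r * x) * mlDensity α l x)
    rw [h] at h2
    push_cast at h2
    exact h2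
  have hfreq : ∃ᶠ z : ℂ in 𝓝[≠] (1 : ℂ),
      ProbabilityTheory.complexMGF id (mlMeasure α l) (-z) = (l : ℂ) / (z ^ (α : ℂ) + l) := by
    have ht : Tendsto (fun r : ℝ => (r : ℂ)) (𝓝[>] 1) (𝓝[≠] (1 : ℂ)) := by
      refine tendsto_nhdsWithin_iff.2 ⟨tendsto_nhdsWithin_of_tendsto_nhds ?_, ?_⟩
      · simpa using Complex.continuous_ofReal.tendsto 1
      · filter_upwards [self_mem_nhdsWithin] with r hr
        exact fun h => (ne_of_gt (mem_Ioi.1 hr)) (Complex.ofReal_eq_one.1 h)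
    refine ht.frequently (Eventually.frequently ?_)
    filter_upwards [self_mem_nhdsWithin] with r hr using hreal r (one_pos.trans hr)
  rw [← complexMGF_mlMeasure hα hα1 hl]
  exact (hf.analyticOnNhd hUo).eqOn_of_preconnected_of_frequently_eq (hg.analyticOnNhd hUo) hUc
    (by simp [hU]) hfreq hs

theorem hasLaplaceTransform_laplacianDensity {α l : ℝ} (hα : 0 < α) (hα1 : α ≤ 1) (hl : 0 < l)
    {s : ℂ} (hs : 0 < s.re) :
    HasLaplaceTransform (laplacianDensity α l) s (s ^ (α : ℂ) / (s ^ (α : ℂ) + (l : ℂ))) := by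
  have hW := causalLocInt_mlDensity (l := l) hα
  refine ⟨1, fun x => -mlDensity α l x, hW.locallyIntegrable.neg,
    fun x hx => neg_eq_zero.2 (hW.eq_zero x hx), laplacianDensity_eq_atom_add_ofFun l hα, ?_, ?_⟩
  · have h := integrableOn_exp_mul_mlDensity hα hα1 hl hs
    refine Integrable.mono' h ?_ ?_
    · refine AEStronglyMeasurable.mul (Continuous.aestronglyMeasurable (by fun_prop)) ?_
      exact (Complex.continuous_ofReal.comp_aestronglyMeasurable
        hW.locallyIntegrable.neg.aestronglyMeasurable).restrict
    · refine Eventually.of_forall fun x => ?_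
      rw [norm_mul, Complex.norm_exp, Complex.norm_real, norm_neg,
        Real.norm_of_nonneg (mlDensity_nonneg hα hα1 hl)]
      simp
  · simp only [Complex.ofReal_neg, mul_neg, integral_neg]
    rw [integral_cexp_mul_mlDensity hα hα1 hl hs]
    have := cpow_ofReal_add_ne_zero hα hα1 hl hs
    push_cast
    field_simp
    ring

/-! ### The state density -/

section StateDensity

variable {α β l ξ : ℝ}

/-- Absorbing `t ^ β` into `ξ` and evaluating at time `1` removes the restriction `0 ≤ t`. -/
theorem summable_abs_mlCoeff_mul_four_pow (hβ : 0 < β) (ξ t : ℝ) :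
    Summable fun m => |mlCoeff β ξ t m| * 4 ^ m := by
  have h := abs_mlCoeff_mul_four_pow_summable (ξ := ξ * t ^ β) hβ zero_le_one
  simpa only [mlCoeff, Real.one_rpow, mul_one, neg_mul] using h

theorem causalLocInt_stateDensityReg (hα : 0 < α) (hβ : 0 < β) (l ξ t : ℝ) :
    CausalLocInt (stateDensityReg α β l ξ t) :=
  causalLocInt_tsum_prabhakarKernelReg hα (summable_abs_mlCoeff_mul_four_pow hβ ξ t)

theorem stateDensityReg_of_nonpos {x : ℝ} (hx : x ≤ 0) (t : ℝ) : stateDensityReg α β l ξ t x = 0 :=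
  tsum_mul_prabhakarKernelReg_of_nonpos hx _

theorem mittagLeffler_eq_tsum (b ξ t : ℝ) :
    mittagLeffler b (-ξ * t ^ b) = ∑' m, mlCoeff b ξ t m := rfl

theorem stateDensity_apply (hα : 0 < α) (hβ : 0 < β) (l ξ t : ℝ) (φ : RealTest) :
    stateDensity α β l ξ t φ =
      mittagLeffler β (-ξ * t ^ β) * φ 0 + ∫ x, φ x * stateDensityReg α β l ξ t x := by
  rw [← ofFun_apply (causalLocInt_stateDensityReg hα hβ l ξ t).locallyIntegrable]
  rfl

theorem hasSum_stateDensity (hα : 0 < α) (hα1 : α ≤ 1) (hβ : 0 < β) (hl : 0 < l) (t : ℝ)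
    (φ : RealTest) :
    HasSum (fun m : ℕ => mlCoeff β ξ t m * prabhakarKernel α m (-l) φ)
      (stateDensity α β l ξ t φ) := by
  rw [stateDensity_apply hα hβ]
  exact hasSum_mul_prabhakarKernel_apply hα hα1 hl (summable_abs_mlCoeff_mul_four_pow hβ ξ t) φ

theorem tendsto_latticeDensity_stateProb (hα : 0 < α) (hα1 : α ≤ 1) (hβ : 0 < β) (hl : 0 < l)
    {t : ℝ} (ht : 0 ≤ t) (φ : RealTest) :
    Tendsto (fun h : ℝ => ∫ x, latticeDensity h (fun n => stateProb α β (l * h ^ α) ξ n t) x * φ x)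
      (𝓝[>] 0) (𝓝 (stateDensity α β l ξ t φ)) := by
  rw [stateDensity_apply hα hβ]
  refine tendsto_integral_latticeDensity (c := fun h n => stateProb α β (l * h ^ α) ξ n t)
    hα hα1 ?_ (fun x hx => stateDensityReg_of_nonpos hx t)
    (fun x hx => tendsto_stateProb_lattice hα hα1 hβ hl ht hx)
    (fun R hR => stateProb_lattice_bound hα hα1 hβ hl ht hR) φ
  filter_upwards [self_mem_nhdsWithin] with h hh
  exact stateProb_zero_eq (mul_pos hl (Real.rpow_pos_of_pos hh α))

theorem tendsto_latticeDensity_stateProb_pointwise (hα : 0 < α) (hα1 : α ≤ 1) (hβ : 0 < β)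
    (hl : 0 < l) {t : ℝ} (ht : 0 ≤ t) {x : ℝ} (hx : 0 < x) :
    Tendsto (fun h : ℝ => latticeDensity h (fun n => stateProb α β (l * h ^ α) ξ n t) x)
      (𝓝[>] 0) (𝓝 (stateDensityReg α β l ξ t x)) := by
  simp only [latticeDensity, if_pos hx.le]
  exact tendsto_stateProb_lattice hα hα1 hβ hl ht hx

/-! ### The Cauchy problem -/

theorem stateDensity_zero (hα : 0 < α) (hα1 : α ≤ 1) (hβ : 0 < β) (hl : 0 < l) :
    stateDensity α β l ξ 0 = dirac0 := by
  ext φ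
  rw [← (hasSum_stateDensity hα hα1 hβ hl 0 φ).tsum_eq,
    tsum_eq_single 0 fun m hm => by rw [mlCoeff_zero hβ, if_neg hm, zero_mul], mlCoeff_zero hβ,
    if_pos rfl, one_mul, prabhakarKernel_apply hα]
  have h : ∀ x, prabhakarKernelReg α (0 : ℕ) (-l) x = 0 := by
    intro x
    rcases lt_or_ge 0 x with hx | hx
    · rw [prabhakarKernelReg_eq 0 hx, fracSeries]
      simp [Ring.multichoose_zero_succ]
    · simp [prabhakarKernelReg, not_lt.2 hx]
  simp only [h, mul_zero, integral_zero, add_zero]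
  rfl

theorem hasCaputoDeriv_stateDensity_apply (hα : 0 < α) (hα1 : α ≤ 1) (hβ : 0 < β) (hβ1 : β ≤ 1)
    (hl : 0 < l) {t : ℝ} (ht : 0 < t) (φ : RealTest) :
    HasCaputoDeriv β (fun r => stateDensity α β l ξ r φ) t
      (-ξ * ∑' m : ℕ, mlCoeff β ξ t m * prabhakarKernel α (m + 1 : ℕ) (-l) φ) := by
  have h := hasCaputoDeriv_tsum_mlCoeff (ξ := ξ) hβ hβ1 ht (expBdd_prabhakarKernel_apply hα hα1 hl φ)
  simpa only [(hasSum_stateDensity hα hα1 hβ hl _ φ).tsum_eq] using h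

/-- Continuity up to time `0` is part of `HasCaputoDeriv`, here taken at time `1`. -/
theorem tendsto_stateDensity_apply (hα : 0 < α) (hα1 : α ≤ 1) (hβ : 0 < β) (hβ1 : β ≤ 1)
    (hl : 0 < l) (φ : RealTest) :
    Tendsto (fun t : ℝ => stateDensity α β l ξ t φ) (𝓝[>] 0) (𝓝 (dirac0 φ)) := by
  have h := (hasCaputoDeriv_stateDensity_apply (ξ := ξ) hα hα1 hβ hβ1 hl one_pos φ).1 0 (by simp)
  rw [← stateDensity_zero (ξ := ξ) hα hα1 hβ hl]
  refine (h.mono_of_mem_nhdsWithin (s := Ioi 0) ?_).tendsto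
  exact mem_of_superset (Ioo_mem_nhdsGT one_pos) Ioo_subset_Icc_self

/-- The function part of `W * P`, for the Mittag-Leffler density `W` and the state density `P`. -/
def jumpConv (α β l ξ t x : ℝ) : ℝ :=
  mittagLeffler β (-ξ * t ^ β) * mlDensity α l x +
    convFun (mlDensity α l) (stateDensityReg α β l ξ t) x

theorem causalLocInt_atom_add_convFun {k f : ℝ → ℝ} (c : ℝ) (hk : CausalLocInt k)
    (hf : CausalLocInt f) : CausalLocInt fun x => c * k x + convFun k f x where
  locallyIntegrable := (hk.locallyIntegrable.smul c).add
    (causalLocInt_convFun hk hf).locallyIntegrable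
  eq_zero x hx := by rw [hk.eq_zero x hx, (causalLocInt_convFun hk hf).eq_zero x hx]; ring

theorem causalLocInt_jumpConv (hα : 0 < α) (hβ : 0 < β) (l ξ t : ℝ) :
    CausalLocInt (jumpConv α β l ξ t) :=
  causalLocInt_atom_add_convFun _ (causalLocInt_mlDensity hα)
    (causalLocInt_stateDensityReg hα hβ l ξ t)

theorem jumpConv_eq (hα : 0 < α) (hβ : 0 < β) (t : ℝ) {x : ℝ} (hx : 0 ≤ x) :
    jumpConv α β l ξ t x = mittagLeffler β (-ξ * t ^ β) * mlDensity α l x +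
      ∫ τ in (0 : ℝ)..x, mlDensity α l (x - τ) * stateDensityReg α β l ξ t τ := by
  rw [jumpConv, convFun_eq_integral (causalLocInt_mlDensity hα).eq_zero
    (causalLocInt_stateDensityReg hα hβ l ξ t).eq_zero hx]

theorem tsum_mlCoeff_mul_prabhakarKernelReg_succ (hα : 0 < α) (hα1 : α ≤ 1) (hβ : 0 < β)
    (hl : 0 < l) (t x : ℝ) :
    ∑' m : ℕ, mlCoeff β ξ t m * prabhakarKernelReg α (m + 1 : ℕ) (-l) x =
      stateDensityReg α β l ξ t x - jumpConv α β l ξ t x := by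
  rcases lt_trichotomy x 0 with hx | rfl | hx
  · rw [stateDensityReg_of_nonpos hx.le, (causalLocInt_jumpConv hα hβ l ξ t).eq_zero x hx]
    simp [prabhakarKernelReg, not_lt.2 hx.le]
  · rw [stateDensityReg_of_nonpos le_rfl, jumpConv_eq hα hβ t le_rfl]
    simp [prabhakarKernelReg, mlDensity]
  · rw [jumpConv_eq hα hβ t hx.le,
      (mlDensity_conv_tsum hα hα1 hl hx (summable_abs_mlCoeff_mul_four_pow hβ ξ t)).2]
    simp only [mittagLeffler_eq_tsum, stateDensityReg_eq_tsum]
    ring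

/-- Summing the kernels against the shifted coefficients keeps the mass of the atom and turns the
density into the one found pointwise. -/
theorem tsum_mlCoeff_mul_prabhakarKernel_succ_apply (hα : 0 < α) (hα1 : α ≤ 1) (hβ : 0 < β)
    (hl : 0 < l) (t : ℝ) (φ : RealTest) :
    ∑' m : ℕ, mlCoeff β ξ t m * prabhakarKernel α (m + 1 : ℕ) (-l) φ =
      stateDensity α β l ξ t φ - ofFun (jumpConv α β l ξ t) φ := by
  have hc := summable_abs_mlCoeff_mul_four_pow hβ ξ t
  have hq := (causalLocInt_stateDensityReg hα hβ l ξ t).locallyIntegrable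
  have hj := (causalLocInt_jumpConv hα hβ l ξ t).locallyIntegrable
  have h := hasSum_mul_prabhakarKernel_apply hα hα1 hl (summable_shiftSeq hc) φ
  have hA : ∑' m, shiftSeq (mlCoeff β ξ t) m = mittagLeffler β (-ξ * t ^ β) := by
    have := tsum_shiftSeq_mul (mlCoeff β ξ t) (fun _ => 1)
      (by simpa only [mul_one] using summable_of_abs_mul_four_pow (summable_shiftSeq hc))
    simp only [mul_one] at this
    exact this
  have hB : ∀ x, ∑' m : ℕ, shiftSeq (mlCoeff β ξ t) m * prabhakarKernelReg α m (-l) x =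
      stateDensityReg α β l ξ t x - jumpConv α β l ξ t x := by
    intro x
    rw [← tsum_mlCoeff_mul_prabhakarKernelReg_succ hα hα1 hβ hl]
    refine tsum_shiftSeq_mul (mlCoeff β ξ t) (fun m : ℕ => prabhakarKernelReg α m (-l) x) ?_
    rcases lt_or_ge 0 x with hx | hx
    · exact summable_mul_prabhakarKernelReg hα hα1 hl hx (summable_shiftSeq hc)
    · simp [prabhakarKernelReg, not_lt.2 hx, summable_zero]
  rw [← tsum_shiftSeq_mul (mlCoeff β ξ t) (fun m : ℕ => prabhakarKernel α m (-l) φ) h.summable,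
    h.tsum_eq, hA, stateDensity_apply hα hβ, ofFun_apply hj]
  simp only [hB, mul_sub]
  rw [integral_sub (integrable_test_mul hq φ) (integrable_test_mul hj φ)]
  ring

theorem isCausalConv_mlDensity_stateDensity (hα : 0 < α) (hβ : 0 < β) (l ξ t : ℝ) :
    IsCausalConv (ofFun (mlDensity α l)) (stateDensity α β l ξ t) (ofFun (jumpConv α β l ξ t)) :=
  isCausalConv_ofFun _ (causalLocInt_mlDensity hα) (causalLocInt_stateDensityReg hα hβ l ξ t)

/-- Convolution with the Laplacian density, in terms of the shifted pairing. -/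
theorem stateDensity_sub_jumpConv_apply (hα : 0 < α) (hβ : 0 < β) (t : ℝ) (φ ψ : RealTest)
    (hψ : ∀ y > -1, ψ y =
      shiftPairing (mittagLeffler β (-ξ * t ^ β)) (stateDensityReg α β l ξ t) φ y) :
    (stateDensity α β l ξ t - ofFun (jumpConv α β l ξ t)) φ = laplacianDensity α l ψ := by
  have h1 : (stateDensity α β l ξ t - ofFun (jumpConv α β l ξ t)) φ =
    stateDensity α β l ξ t φ - ofFun (jumpConv α β l ξ t) φ := rfl
  have h2 : laplacianDensity α l ψ = ψ 0 - ofFun (mlDensity α l) ψ := rfl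
  rw [h1, h2, hψ 0 (by norm_num), ← isCausalConv_ofFun_apply _ (causalLocInt_mlDensity hα)
    (causalLocInt_stateDensityReg hα hβ l ξ t) φ ψ hψ, stateDensity_apply hα hβ, shiftPairing]
  simp only [add_zero]
  rfl

theorem isCausalConv_laplacianDensity_stateDensity (hα : 0 < α) (hβ : 0 < β) (l ξ t : ℝ) :
    IsCausalConv (laplacianDensity α l) (stateDensity α β l ξ t)
      (stateDensity α β l ξ t - ofFun (jumpConv α β l ξ t)) := by
  refine isCausalConv_of_forall ?_ (causalLocInt_stateDensityReg hα hβ l ξ t)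
    (stateDensity_sub_jumpConv_apply hα hβ t)
  have hW := causalLocInt_mlDensity (l := l) hα
  rw [laplacianDensity_eq_atom_add_ofFun l hα]
  exact isVanishingOn_atom_add_ofFun
    ⟨hW.locallyIntegrable.neg, fun x hx => neg_eq_zero.2 (hW.eq_zero x hx)⟩

/-- The function part of the convolution of the survival function with the state density. -/
def survivalConv (α β l ξ t x : ℝ) : ℝ :=
  mittagLeffler β (-ξ * t ^ β) * survivalFun α l x +
    convFun (survivalFun α l) (stateDensityReg α β l ξ t) x

theorem isCausalConv_survivalFun_stateDensity (hα : 0 < α) (hβ : 0 < β) (l ξ t : ℝ) :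
    IsCausalConv (ofFun (survivalFun α l)) (stateDensity α β l ξ t)
      (ofFun (survivalConv α β l ξ t)) :=
  isCausalConv_ofFun _ (causalLocInt_survivalFun hα) (causalLocInt_stateDensityReg hα hβ l ξ t)

/-- Both sides, tested against `φ`, are `𝒢` applied to the same `ψ`, as `𝒢` is the derivative of the
survival function. -/
theorem lineDeriv_survivalConv (hα : 0 < α) (hβ : 0 < β) (l ξ t : ℝ) :
    ∂_{(1 : ℝ)} (ofFun (survivalConv α β l ξ t)) =
      stateDensity α β l ξ t - ofFun (jumpConv α β l ξ t) := by
  ext φ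
  have hq := causalLocInt_stateDensityReg hα hβ l ξ t
  obtain ⟨ψ, hψ⟩ := exists_test_eq_shiftPairing (c := mittagLeffler β (-ξ * t ^ β)) hq φ
  rw [stateDensity_sub_jumpConv_apply hα hβ t φ ψ hψ, laplacianDensity_eq_lineDeriv l hα]
  exact lineDeriv_causalConv_apply (causalLocInt_survivalFun hα) hq hψ

theorem prabhakarFun_one (a b z : ℝ) : prabhakarFun a b 1 z = mittagLefflerGen a b z := by
  refine tsum_congr fun s => ?_
  rw [ascPochhammer_eval_one, div_self (by positivity), one_mul]

theorem prabhakarIntegralKernel_one (hl : 0 < l) (x : ℝ) :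
    prabhakarIntegralKernel α α 1 (-l) x = l⁻¹ * mlDensity α l x := by
  rw [prabhakarIntegralKernel, mlDensity, prabhakarFun_one]
  split_ifs
  · field_simp
  · simp

theorem isPrabhakarIntegral_stateDensity (hα : 0 < α) (hβ : 0 < β) (hl : 0 < l) (ξ t : ℝ) :
    IsPrabhakarIntegral α α 1 (-l) (stateDensity α β l ξ t)
      (l⁻¹ • ofFun (jumpConv α β l ξ t)) := by
  have hW := causalLocInt_mlDensity (l := l) hα
  have hk : CausalLocInt fun x => l⁻¹ * mlDensity α l x :=
    ⟨hW.locallyIntegrable.smul l⁻¹, fun x hx => by rw [hW.eq_zero x hx, mul_zero]⟩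
  have hq := causalLocInt_stateDensityReg hα hβ l ξ t
  rw [IsPrabhakarIntegral, funext (prabhakarIntegralKernel_one hl)]
  refine ⟨hk.locallyIntegrable, ?_⟩
  refine isCausalConv_of_forall ?_ hq fun φ ψ hψ => ?_
  · have := isVanishingOn_atom_add_ofFun (c := 0) hk
    rwa [zero_smul, zero_add] at this
  · have h : (l⁻¹ • ofFun (jumpConv α β l ξ t)) φ = l⁻¹ * ofFun (jumpConv α β l ξ t) φ := rfl
    rw [h, ofFun_apply hk.locallyIntegrable,
      show ofFun (jumpConv α β l ξ t) φ = ofFun (mlDensity α l) ψ from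
        isCausalConv_ofFun_apply _ hW hq φ ψ hψ, ofFun_apply hW.locallyIntegrable,
      ← integral_const_mul]
    exact integral_congr_ae (Eventually.of_forall fun x => by ring)

/-- The distributional evolution equation. -/
theorem hasCaputoDeriv_stateDensity (hα : 0 < α) (hα1 : α ≤ 1) (hβ : 0 < β) (hβ1 : β ≤ 1)
    (hl : 0 < l) {t : ℝ} (ht : 0 < t) (φ : RealTest) :
    HasCaputoDeriv β (fun r => stateDensity α β l ξ r φ) t
      (((-ξ) • (stateDensity α β l ξ t - ofFun (jumpConv α β l ξ t))) φ) := by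
  have h := hasCaputoDeriv_stateDensity_apply (ξ := ξ) hα hα1 hβ hβ1 hl ht φ
  rw [tsum_mlCoeff_mul_prabhakarKernel_succ_apply hα hα1 hβ hl] at h
  exact h

theorem expBdd_prabhakarKernelReg (hα : 0 < α) (hα1 : α ≤ 1) (hl : 0 < l) {x : ℝ} (hx : 0 < x) :
    ExpBdd fun m => prabhakarKernelReg α m (-l) x := by
  obtain ⟨C, hC, h⟩ := abs_prabhakarKernelReg_le hα hα1 hl hx
  refine ⟨C * x ^ (α - 1), 4, by positivity, by norm_num, fun m => ?_⟩
  exact (h x hx le_rfl m).trans (le_of_eq (by ring))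

theorem intervalIntegrable_mlDensity_mul_stateDensityReg (hα : 0 < α) (hα1 : α ≤ 1) (hβ : 0 < β)
    (hl : 0 < l) (t : ℝ) {x : ℝ} (hx : 0 < x) :
    IntervalIntegrable (fun τ => l * (x - τ) ^ (α - 1) *
      mittagLefflerGen α α (-l * (x - τ) ^ α) * stateDensityReg α β l ξ t τ) volume 0 x := by
  have h := (mlDensity_conv_tsum hα hα1 hl hx (summable_abs_mlCoeff_mul_four_pow hβ ξ t)).1
  rw [intervalIntegrable_iff_integrableOn_Ioo_of_le hx.le] at h ⊢
  refine h.congr_fun (fun τ hτ => ?_) measurableSet_Ioo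
  beta_reduce
  rw [mlDensity, if_pos (sub_pos.2 hτ.2)]
  rfl

/-- The pointwise evolution equation of the density on `x > 0`. -/
theorem hasCaputoDeriv_stateDensityReg (hα : 0 < α) (hα1 : α ≤ 1) (hβ : 0 < β) (hβ1 : β ≤ 1)
    (hl : 0 < l) {t : ℝ} (ht : 0 < t) {x : ℝ} (hx : 0 < x) :
    HasCaputoDeriv β (fun r : ℝ => stateDensityReg α β l ξ r x) t
      (-ξ * stateDensityReg α β l ξ t x + ξ * (mittagLeffler β (-ξ * t ^ β) *
        (l * x ^ (α - 1) * mittagLefflerGen α α (-l * x ^ α)) +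
        ∫ τ in (0 : ℝ)..x, l * (x - τ) ^ (α - 1) * mittagLefflerGen α α (-l * (x - τ) ^ α) *
          stateDensityReg α β l ξ t τ)) := by
  have h := hasCaputoDeriv_tsum_mlCoeff (ξ := ξ) hβ hβ1 ht (expBdd_prabhakarKernelReg hα hα1 hl hx)
  have hI : ∫ τ in (0 : ℝ)..x, mlDensity α l (x - τ) * stateDensityReg α β l ξ t τ =
      ∫ τ in (0 : ℝ)..x, l * (x - τ) ^ (α - 1) * mittagLefflerGen α α (-l * (x - τ) ^ α) *
          stateDensityReg α β l ξ t τ := by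
    rw [intervalIntegral.integral_of_le hx.le, intervalIntegral.integral_of_le hx.le,
      integral_Ioc_eq_integral_Ioo, integral_Ioc_eq_integral_Ioo]
    refine setIntegral_congr_fun measurableSet_Ioo fun τ hτ => ?_
    rw [mlDensity, if_pos (sub_pos.2 hτ.2)]
  rw [tsum_mlCoeff_mul_prabhakarKernelReg_succ hα hα1 hβ hl, jumpConv_eq hα hβ t hx.le, hI,
    mlDensity, if_pos hx] at h
  convert h using 1
  · rfl
  · ring

end StateDensity

end

theorem mainTheorem3 (α β l₀ ξ : ℝ) (hα : 0 < α) (hα1 : α ≤ 1) (hβ : 0 < β) (hβ1 : β ≤ 1)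
    (hl : 0 < l₀) (hξ : 0 < ξ) :
    -- the state probabilities solve the Cauchy problem of the space-time Mittag-Leffler process
    (∀ l : ℝ, 0 < l → ∀ n : ℕ,
      stateProb α β l ξ n 0 = (if n = 0 then 1 else 0) ∧
      ∀ t : ℝ, 0 < t → HasCaputoDeriv β (stateProb α β l ξ n) t
        (-ξ * ∑ k ∈ Finset.range (n + 1), stateProb α β l ξ k t *
          PowerSeries.coeff (n - k) (discreteLaplacian α l))) ∧
    -- all functions that define distributions are locally integrable
    (LocallyIntegrable (mlDensity α l₀) ∧ LocallyIntegrable (survivalFun α l₀) ∧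
      (∀ m : ℕ, LocallyIntegrable (prabhakarKernelReg α m (-l₀))) ∧
      ∀ t : ℝ, 0 ≤ t → LocallyIntegrable (stateDensityReg α β l₀ ξ t)) ∧
    -- the state density is the well-scaled limit of the state probabilities,
    -- and is given by the series of Prabhakar kernels
    (∀ t : ℝ, 0 ≤ t →
      (∀ φ : RealTest, Tendsto
        (fun h : ℝ => ∫ x, latticeDensity h (fun n => stateProb α β (l₀ * h ^ α) ξ n t) x * φ x)
        (𝓝[>] 0) (𝓝 (stateDensity α β l₀ ξ t φ))) ∧
      (∀ x : ℝ, 0 < x → Tendsto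
        (fun h : ℝ => latticeDensity h (fun n => stateProb α β (l₀ * h ^ α) ξ n t) x)
        (𝓝[>] 0) (𝓝 (stateDensityReg α β l₀ ξ t x))) ∧
      ∀ φ : RealTest, HasSum
        (fun m : ℕ => (-ξ * t ^ β) ^ m / Real.Gamma (β * m + 1) *
          prabhakarKernel α m (-l₀) φ)
        (stateDensity α β l₀ ξ t φ)) ∧
    -- the Laplacian density: well-scaled limit, derivative form, Laplace transform
    (∀ φ : RealTest, Tendsto
      (fun h : ℝ => ∫ x, latticeDensity h
        (fun n => PowerSeries.coeff n (discreteLaplacian α (l₀ * h ^ α))) x * φ x)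
      (𝓝[>] 0) (𝓝 (laplacianDensity α l₀ φ))) ∧
    laplacianDensity α l₀ = ∂_{(1 : ℝ)} (ofFun (survivalFun α l₀)) ∧
    (∀ x : ℝ, 0 < x →
      HasDerivAt (fun y : ℝ => mittagLeffler α (-l₀ * y ^ α)) (-mlDensity α l₀ x) x) ∧
    (∀ s : ℂ, 0 < s.re →
      HasLaplaceTransform (laplacianDensity α l₀) s
        (s ^ (α : ℂ) / (s ^ (α : ℂ) + (l₀ : ℂ)))) ∧
    -- initial condition
    stateDensity α β l₀ ξ 0 = dirac0 ∧
    (∀ φ : RealTest,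
      Tendsto (fun t : ℝ => stateDensity α β l₀ ξ t φ) (𝓝[>] 0) (𝓝 (dirac0 φ))) ∧
    -- the evolution equation in the sense of distributions, in all its forms
    (∀ t : ℝ, 0 < t → ∃ D CG CW CE CP : RealDistribution,
      (∀ φ : RealTest,
        HasCaputoDeriv β (fun r : ℝ => stateDensity α β l₀ ξ r φ) t (D φ)) ∧
      IsCausalConv (laplacianDensity α l₀) (stateDensity α β l₀ ξ t) CG ∧
      IsCausalConv (ofFun (mlDensity α l₀)) (stateDensity α β l₀ ξ t) CW ∧
      IsCausalConv (ofFun (survivalFun α l₀)) (stateDensity α β l₀ ξ t) CE ∧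
      IsPrabhakarIntegral α α 1 (-l₀) (stateDensity α β l₀ ξ t) CP ∧
      D = (-ξ) • CG ∧
      D = (-ξ) • stateDensity α β l₀ ξ t + ξ • CW ∧
      D = (-ξ) • ∂_{(1 : ℝ)} CE ∧
      D = (-ξ) • stateDensity α β l₀ ξ t + (ξ * l₀) • CP) ∧
    -- the evolution equation pointwise: mass of the atom at the origin, and density on `x > 0`
    (∀ t : ℝ, 0 < t →
      HasCaputoDeriv β (fun r : ℝ => mittagLeffler β (-ξ * r ^ β)) t
        (-ξ * mittagLeffler β (-ξ * t ^ β)) ∧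
      ∀ x : ℝ, 0 < x →
        IntervalIntegrable (fun τ : ℝ => l₀ * (x - τ) ^ (α - 1) *
          mittagLefflerGen α α (-l₀ * (x - τ) ^ α) * stateDensityReg α β l₀ ξ t τ) volume 0 x ∧
        HasCaputoDeriv β (fun r : ℝ => stateDensityReg α β l₀ ξ r x) t
          (-ξ * stateDensityReg α β l₀ ξ t x +
            ξ * (mittagLeffler β (-ξ * t ^ β) *
                (l₀ * x ^ (α - 1) * mittagLefflerGen α α (-l₀ * x ^ α)) +
              ∫ τ in (0 : ℝ)..x, l₀ * (x - τ) ^ (α - 1) *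
                mittagLefflerGen α α (-l₀ * (x - τ) ^ α) *
                stateDensityReg α β l₀ ξ t τ))) := by
  refine ⟨fun l _ n => ⟨stateProb_zero hβ n, fun t ht => hasCaputoDeriv_stateProb hβ hβ1 ht n⟩,
    ⟨(causalLocInt_mlDensity hα).locallyIntegrable, (causalLocInt_survivalFun hα).locallyIntegrable,
      fun m => (causalLocInt_prabhakarKernelReg hα m).locallyIntegrable,
      fun t _ => (causalLocInt_stateDensityReg hα hβ l₀ ξ t).locallyIntegrable⟩,
    fun t ht => ⟨tendsto_latticeDensity_stateProb hα hα1 hβ hl ht,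
      fun x hx => tendsto_latticeDensity_stateProb_pointwise hα hα1 hβ hl ht hx,
      hasSum_stateDensity hα hα1 hβ hl t⟩,
    tendsto_latticeDensity_coeff hα hα1 hl, laplacianDensity_eq_lineDeriv l₀ hα,
    fun x hx => hasDerivAt_mittagLeffler_rpow hα hx,
    fun s hs => hasLaplaceTransform_laplacianDensity hα hα1 hl hs,
    stateDensity_zero hα hα1 hβ hl, tendsto_stateDensity_apply hα hα1 hβ hβ1 hl,
    -- Unification sets `CG` to the state density minus `CW`, `D` to `(-ξ) • CG` and `CP` to `l₀⁻¹ •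
    -- CW`, so the four equations are linear algebra apart from `lineDeriv_survivalConv`.
    fun t ht => ⟨_, _, ofFun (jumpConv α β l₀ ξ t), ofFun (survivalConv α β l₀ ξ t), _,
      hasCaputoDeriv_stateDensity hα hα1 hβ hβ1 hl ht,
      isCausalConv_laplacianDensity_stateDensity hα hβ l₀ ξ t,
      isCausalConv_mlDensity_stateDensity hα hβ l₀ ξ t,
      isCausalConv_survivalFun_stateDensity hα hβ l₀ ξ t,
      isPrabhakarIntegral_stateDensity hα hβ hl ξ t, rfl, ?_, ?_, ?_⟩,
    fun t ht => ⟨hasCaputoDeriv_mittagLeffler hβ hβ1 ht, fun x hx =>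
      ⟨intervalIntegrable_mlDensity_mul_stateDensityReg hα hα1 hβ hl t hx,
        hasCaputoDeriv_stateDensityReg hα hα1 hβ hβ1 hl ht hx⟩⟩⟩
  · module
  · rw [lineDeriv_survivalConv hα hβ]
  · rw [smul_smul, mul_assoc, mul_inv_cancel₀ hl.ne', mul_one]
    module
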